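/- \textbf{Model.} Let $E$ be a set of potential edges and let $0\le p<1$. An oblivious flip adversary fixes an initial edge set $H_0\subseteq E$, a sequence $e_1,\dots,e_T\in E$, and how many queries are asked after each round $r=0,\dots,T$. In the resulting $p$-smoothed dynamic graph $G_0,\dots,G_T$, all of the following choices are independent: each $e\in E$ is in $G_0$ according to $H_0$ with probability $p$, and according to a fair coin with probability $1-p$; in round $i$ one flips the pair $x_i$ ($E(G_i)=E(G_{i-1})\triangle\{x_i\}$), where $x_i=e_i$ with probability $p$ and $x_i$ is uniform in $E$ with probability $1-p$. For the bipartite problems the node set consists of two sides of $n$ nodes each and $E$ consists of the $n^2$ pairs across; for connectivity there are $n$ nodes and $E$ consists of all $\binom n2$ pairs. A query asks, about the current graph: whether it has a perfect matching (bipartite perfect matching); the size of a maximum matching (bipartite maximum matching); the size of a minimum vertex cover (bipartite minimum vertex cover); whether it is connected (connectivity). Algorithms are deterministic word-RAM programs with $O(\log n)$-bit words, consisting of a preprocessing, an update and a query procedure. Preprocessing is given $n$, the adjacency matrix of $G_0$ and the integer $\lceil 1/(1-p)\rceil$. All amortized running times are $O(1)$ on a sequence if preprocessing and all $T$ updates together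 take at most $C\,T$ steps, and all queries together take at most $C$ times the number of queries, for a constant $C$. The algorithm succeeds w.h.p. if for every constant $d$ and all sufficiently large $n$, all queries are answered correctly with probability at least $1-n^{-d}$. \textbf{Lemma.} (i) For each of the problems bipartite perfect matching, bipartite maximum matching and bipartite minimum vertex cover there is an algorithm with the following property. Let $c>0$, $a>0$ and $k$ be constants. For all sufficiently large $n$, all $p\in[0,1-n^{-c}]$, all $T$ with $a\,n^6/(1-p)\le T\le n^k$, and every oblivious flip adversary, the algorithm has all amortized running times $O(1)$ on the $p$-smoothed dynamic graph (for every outcome of the smoothing, with a constant depending only on $a$), and it succeeds w.h.p. (ii) The same holds for connectivity with $T$ in the range $a\,n^3(\log n)^b/(1-p)\le T\le n^k$, for some absolute constant $b$; that is, on sequences of polynomial length at least $\tilde\Omega(n^3/(1-p))$. -/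

import Mathlib

open scoped symmDiff

/-! ## The machine: a word-RAM with a step count -/

/-- The unit-cost word operations (unsigned arithmetic modulo `2 ^ w`, bitwise operations, shifts,
comparisons). -/
inductive BinOp
  | add | sub | mul | div | mod | and | or | xor | shl | shr | eq | lt

def BinOp.eval {w : ℕ} : BinOp → BitVec w → BitVec w → BitVec w
  | .add, a, b => a + b
  | .sub, a, b => a - b
  | .mul, a, b => a * b
  | .div, a, b => a / b
  | .mod, a, b => a % b
  | .and, a, b => a &&& b
  | .or, a, b => a ||| b
  | .xor, a, b => a ^^^ b
  | .shl, a, b => a <<< b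
  | .shr, a, b => a >>> b
  | .eq, a, b => if a = b then 1 else 0
  | .lt, a, b => if a.toNat < b.toNat then 1 else 0

/-- Programs.  A program mentions finitely many registers and finitely many constants and does
not depend on the word size. -/
inductive Cmd
  | skip
  /-- `reg r := k` -/
  | const (r k : ℕ)
  /-- `reg r := reg a ∘ reg b` -/
  | op (o : BinOp) (r a b : ℕ)
  /-- `reg r := mem (reg a)` -/
  | load (r a : ℕ)
  /-- `mem (reg a) := reg b` -/
  | store (a b : ℕ)
  | seq (c d : Cmd)
  /-- `if reg r ≠ 0 then c else d` -/
  | ite (r : ℕ) (c d : Cmd)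
  /-- `while reg r ≠ 0 do c` -/
  | loop (r : ℕ) (c : Cmd)

/-- A configuration of the machine with `w`-bit words: registers, and a memory of `2 ^ w` words. -/
structure Machine (w : ℕ) where
  reg : ℕ → BitVec w
  mem : BitVec w → BitVec w

def Machine.setReg {w : ℕ} (s : Machine w) (r : ℕ) (x : BitVec w) : Machine w :=
  { s with reg := Function.update s.reg r x }

def Machine.setMem {w : ℕ} (s : Machine w) (a x : BitVec w) : Machine w :=
  { s with mem := Function.update s.mem a x }

/-- `c.Exec s s' t`: started in `s`, the program `c` halts in `s'` after exactly `t` steps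
(each basic instruction and each test of a register costs one step). -/
inductive Cmd.Exec {w : ℕ} : Cmd → Machine w → Machine w → ℕ → Prop
  | skip (s : Machine w) : Exec .skip s s 1
  | const (s : Machine w) (r k : ℕ) : Exec (.const r k) s (s.setReg r (BitVec.ofNat w k)) 1
  | op (s : Machine w) (o : BinOp) (r a b : ℕ) :
      Exec (.op o r a b) s (s.setReg r (o.eval (s.reg a) (s.reg b))) 1
  | load (s : Machine w) (r a : ℕ) : Exec (.load r a) s (s.setReg r (s.mem (s.reg a))) 1
  | store (s : Machine w) (a b : ℕ) : Exec (.store a b) s (s.setMem (s.reg a) (s.reg b)) 1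
  | seq {c d : Cmd} {s s' s'' : Machine w} {t t' : ℕ} :
      Exec c s s' t → Exec d s' s'' t' → Exec (.seq c d) s s'' (t + t')
  | ite_true {r : ℕ} {c d : Cmd} {s s' : Machine w} {t : ℕ} :
      s.reg r ≠ 0 → Exec c s s' t → Exec (.ite r c d) s s' (t + 1)
  | ite_false {r : ℕ} {c d : Cmd} {s s' : Machine w} {t : ℕ} :
      s.reg r = 0 → Exec d s s' t → Exec (.ite r c d) s s' (t + 1)
  | loop_stop {r : ℕ} {c : Cmd} {s : Machine w} : s.reg r = 0 → Exec (.loop r c) s s 1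
  | loop_step {r : ℕ} {c : Cmd} {s s' s'' : Machine w} {t t' : ℕ} :
      s.reg r ≠ 0 → Exec c s s' t → Exec (.loop r c) s' s'' t' →
      Exec (.loop r c) s s'' (t + t' + 1)

/-- The machine is deterministic: final configuration and running time are determined by the
program and the initial configuration. -/
theorem Cmd.Exec.det {w : ℕ} {c : Cmd} {s s₁ s₂ : Machine w} {t₁ t₂ : ℕ}
    (h₁ : c.Exec s s₁ t₁) (h₂ : c.Exec s s₂ t₂) : s₁ = s₂ ∧ t₁ = t₂ := by
  induction h₁ generalizing s₂ t₂ with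
  | skip | const | op | load | store => cases h₂; exact ⟨rfl, rfl⟩
  | seq _ _ ih ih' =>
    cases h₂ with
    | seq h h' =>
      obtain ⟨rfl, rfl⟩ := ih h
      obtain ⟨rfl, rfl⟩ := ih' h'
      exact ⟨rfl, rfl⟩
  | ite_true hr _ ih =>
    cases h₂ with
    | ite_true _ h => obtain ⟨rfl, rfl⟩ := ih h; exact ⟨rfl, rfl⟩
    | ite_false h0 _ => exact absurd h0 hr
  | ite_false hr _ ih =>
    cases h₂ with
    | ite_true h0 _ => exact absurd hr h0
    | ite_false _ h => obtain ⟨rfl, rfl⟩ := ih h; exact ⟨rfl, rfl⟩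
  | loop_stop hr =>
    cases h₂ with
    | loop_stop _ => exact ⟨rfl, rfl⟩
    | loop_step h0 _ _ => exact absurd hr h0
  | loop_step hr _ _ ih ih' =>
    cases h₂ with
    | loop_stop h0 => exact absurd h0 hr
    | loop_step _ h h' =>
      obtain ⟨rfl, rfl⟩ := ih h
      obtain ⟨rfl, rfl⟩ := ih' h'
      exact ⟨rfl, rfl⟩

/-! ## Dynamic graph problems and dynamic graph algorithms -/

/-- A dynamic graph problem: for every size `n`, the node pairs that may be edges, the two nodes
of each pair, and the correct answer to a query when a given set of pairs is the edge set. -/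
structure DynProblem where
  Pair : ℕ → Type
  [fintypePair : ∀ n, Fintype (Pair n)]
  [decEqPair : ∀ n, DecidableEq (Pair n)]
  ends : ∀ n, Pair n → Fin n × Fin n
  answer : ∀ n, Finset (Pair n) → ℕ

attribute [instance] DynProblem.fintypePair DynProblem.decEqPair

/-- A dynamic graph algorithm: a preprocessing, an update and a query procedure, working on a
common machine configuration. -/
structure DynAlg where
  pre : Cmd
  update : Cmd
  query : Cmd

/-- The configuration in which preprocessing starts: register `0` holds `n`, register `1` holds
the parameter `R`, memory holds the adjacency matrix of the initial graph (the entry of the pair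
`(u, v)` at address `u * n + v`); everything else is zero. -/
def startMachine (w : ℕ) (P : DynProblem) (n R : ℕ) (G₀ : Finset (P.Pair n)) : Machine w where
  reg := fun r => if r = 0 then BitVec.ofNat w n else if r = 1 then BitVec.ofNat w R else 0
  mem := fun a =>
    if ∃ e ∈ G₀, a.toNat = ((P.ends n e).1 : ℕ) * n + ((P.ends n e).2 : ℕ) then 1 else 0

/-- `A.Serve P n ops s tu tq out`: from configuration `s`, the algorithm serves the operations
`ops` (`some e` flips the pair `e`, handed over in registers `0` and `1`; `none` is a query, whose
answer is left in register `0`), spending `tu` steps in total on updates and `tq` steps in total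
on queries, and giving the answers `out`. -/
inductive DynAlg.Serve {w : ℕ} (A : DynAlg) (P : DynProblem) (n : ℕ) :
    List (Option (P.Pair n)) → Machine w → ℕ → ℕ → List ℕ → Prop
  | nil (s : Machine w) : Serve A P n [] s 0 0 []
  | change {e : P.Pair n} {ops : List (Option (P.Pair n))} {s s' : Machine w} {t tu tq : ℕ}
      {out : List ℕ} :
      A.update.Exec ((s.setReg 0 (BitVec.ofNat w (P.ends n e).1)).setReg 1
        (BitVec.ofNat w (P.ends n e).2)) s' t →
      Serve A P n ops s' tu tq out → Serve A P n (some e :: ops) s (t + tu) tq out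
  | ask {ops : List (Option (P.Pair n))} {s s' : Machine w} {t tu tq : ℕ} {out : List ℕ} :
      A.query.Exec s s' t →
      Serve A P n ops s' tu tq out →
      Serve A P n (none :: ops) s tu (t + tq) ((s'.reg 0).toNat :: out)

/-- A complete run on the initial graph `G₀` and the operations `ops`: preprocessing takes `tp`
steps, all updates together `tu`, all queries together `tq`, and the answers are `out`. -/
def DynAlg.Run (A : DynAlg) (P : DynProblem) (w n R : ℕ) (G₀ : Finset (P.Pair n))
    (ops : List (Option (P.Pair n))) (tp tu tq : ℕ) (out : List ℕ) : Prop :=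
  ∃ s : Machine w, A.pre.Exec (startMachine w P n R G₀) s tp ∧ A.Serve P n ops s tu tq out

/-- The correct answers to the queries among `ops`, when the current edge set is `G`. -/
def DynProblem.correctAnswers (P : DynProblem) (n : ℕ) :
    Finset (P.Pair n) → List (Option (P.Pair n)) → List ℕ
  | _, [] => []
  | G, some e :: ops => P.correctAnswers n (G ∆ {e}) ops
  | G, none :: ops => P.answer n G :: P.correctAnswers n G ops

/-- The operations with changes `x 0, x 1, …, x (T - 1)` and with `q r` queries asked about the
graph after `r` changes, for `r = 0, …, T`. -/
def opSequence {E : Type} {T : ℕ} (q : ℕ → ℕ) (x : Fin T → E) : List (Option E) :=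
  List.replicate (q 0) none ++
    (List.finRange T).flatMap fun i => some (x i) :: List.replicate (q (i + 1)) none

/-! ## The `p`-smoothed dynamic graph with an oblivious flip adversary -/

open Classical in
/-- The probability of an event under `p`-smoothing of the initial graph `H₀` and the flips `e`
fixed by the adversary.  Independently, every pair is in the initial graph `G₀` according to `H₀`
with probability `p` and according to a fair coin otherwise, and the `i`-th flipped pair `x i` is
`e i` with probability `p` and a uniformly random pair otherwise. -/
noncomputable def smoothedProb {E : Type} [Fintype E] {T : ℕ} (p : ℝ) (H₀ : Finset E)
    (e : Fin T → E) (event : Finset E → (Fin T → E) → Prop) : ℝ :=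
  ∑ G₀ : Finset E, ∑ x : Fin T → E,
    if event G₀ x then
      (∏ y : E, (p * (if y ∈ G₀ ↔ y ∈ H₀ then 1 else 0) + (1 - p) * (1 / 2))) *
        ∏ i, (p * (if x i = e i then 1 else 0) + (1 - p) * (1 / (Fintype.card E : ℝ)))
    else 0

/-- `A`, run with word size `w` on the `p`-smoothed dynamic graph obtained from `H₀` and `e`, with
query schedule `q`, has amortized preprocessing-and-update time and amortized query time at most
`C` (whatever the outcome of the smoothing), and answers all queries correctly with probability at
least `1 - δ`.  Of the real number `p` the algorithm is told `⌈1 / (1 - p)⌉`. -/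
def DynAlg.Succeeds (A : DynAlg) (P : DynProblem) (n : ℕ) (p : ℝ) (w T C : ℕ)
    (H₀ : Finset (P.Pair n)) (e : Fin T → P.Pair n) (q : ℕ → ℕ) (δ : ℝ) : Prop :=
  (∀ (G₀ : Finset (P.Pair n)) (x : Fin T → P.Pair n), ∃ (tp tu tq : ℕ) (out : List ℕ),
      A.Run P w n ⌈1 / (1 - p)⌉₊ G₀ (opSequence q x) tp tu tq out ∧
      tp + tu ≤ C * T ∧ tq ≤ C * ∑ r ∈ Finset.range (T + 1), q r) ∧
  1 - δ ≤ smoothedProb p H₀ e fun G₀ x => ∃ tp tu tq : ℕ,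
      A.Run P w n ⌈1 / (1 - p)⌉₊ G₀ (opSequence q x) tp tu tq
        (P.correctAnswers n G₀ (opSequence q x))

/-! ## The problems -/

/-- The bipartite graph with `n` nodes on each side whose edges are the `inl i — inr j` with
`(i, j) ∈ S`. -/
def bipGraph (n : ℕ) (S : Finset (Fin n × Fin n)) : SimpleGraph (Fin n ⊕ Fin n) :=
  SimpleGraph.fromRel fun a b => ∃ e ∈ S, a = Sum.inl e.1 ∧ b = Sum.inr e.2

/-- Node pairs of the node set `Fin n`, listed as `u < v`. -/
abbrev NodePair (n : ℕ) : Type := {e : Fin n × Fin n // e.1 < e.2}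

/-- The graph on `Fin n` with edge set `S`. -/
def pairGraph (n : ℕ) (S : Finset (NodePair n)) : SimpleGraph (Fin n) :=
  SimpleGraph.fromRel fun u v => ∃ e ∈ S, u = e.1.1 ∧ v = e.1.2

open Classical in
/-- Does the graph have a perfect matching (`1` for yes, `0` for no)? -/
noncomputable def bipartitePerfectMatching : DynProblem where
  Pair n := Fin n × Fin n
  ends _ e := e
  answer n S := if ∃ M : (bipGraph n S).Subgraph, M.IsPerfectMatching then 1 else 0

/-- The size of a maximum matching. -/
noncomputable def bipartiteMaximumMatching : DynProblem where
  Pair n := Fin n × Fin n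
  ends _ e := e
  answer n S := sSup {k | ∃ M : (bipGraph n S).Subgraph, M.IsMatching ∧ M.edgeSet.ncard = k}

/-- The size of a minimum vertex cover. -/
noncomputable def bipartiteMinimumVertexCover : DynProblem where
  Pair n := Fin n × Fin n
  ends _ e := e
  answer n S := (bipGraph n S).vertexCoverNum.toNat

open Classical in
/-- Is the graph connected (`1` for yes, `0` for no)? -/
noncomputable def dynamicConnectivity : DynProblem where
  Pair := NodePair
  ends _ e := e.1
  answer n S := if (pairGraph n S).Connected then 1 else 0

/-!
# Smoothed dynamic graphs: constant amortized time for long sequences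

**The algorithm.** On a long sequence of updates it is affordable to recompute the answer from
scratch after each of the first `L` updates, provided that the total cost of these recomputations is
`O(T)`. All later queries get the answer of a random graph: there is a perfect matching, the maximum
matching and the minimum vertex cover have size `n`, the graph is connected. This is `phaseAlg`. The
algorithm knows `R = ⌈1 / (1 - p)⌉`, which is at most `2 / (1 - p)` (`smoothing_param`).

* Bipartite problems: `L = n ^ 2 * R` rounds at `O(n ^ 4)` steps each (`matchingSize_runs`), in
  total `O(n ^ 6 / (1 - p))`. The program is an auction. A left node without partner takes the
  cheapest right node among its neighbours, evicts the owner, and raises the price by one; it gives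
  up if that price exceeds `n`. At the end some price in `1, …, n + 1` is not attained, and the gap
  yields a vertex cover as large as the matching (`AuctionInv.answers`). Together with weak duality
  (`SimpleGraph.Subgraph.IsMatching.ncard_edgeSet_le`) this gives all three answers at once.
* Connectivity: `L = ℓ ^ 2 * n * R` rounds with `ℓ = ⌈log₂ n⌉`, at `O(n ^ 2)` steps each
  (`connectivityCheck_runs`, a graph search), in total `O(n ^ 3 * log n ^ 2 / (1 - p))`.

**Why the fixed answer is right.** Let `N` be the number of pairs. For a set `B` of at most half of
the pairs, the indicator of the event that the current graph `G` misses `B` is the average over all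
`A ⊆ B` of the characters `(-1) ^ |G ∩ A|`. A character is multiplied by `-1` in each round whose
pair lies in `A`; as the pair is uniform with probability `1 - p`, the expectation shrinks in every
round by a factor of at most `1 - 2 * (1 - p) * |A| / N ≤ exp (-2 * (1 - p) / N) ^ |A|` in absolute
value. Hence after `L` rounds `B` is missed with probability at most `((1 + ε) / 2) ^ |B|`, where
`ε = exp (-2 * (1 - p) / N) ^ L`, for every initial graph. The union bound over the rounds and over
a family of sets `B` is `le_smoothedProb`.

If there is no perfect matching, Hall's theorem provides a rectangle of pairs that is missed
(`exists_bipartite_obstructions`), and if the graph is disconnected, then a cut is missed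
(`exists_connectivity_obstructions`). Summing over these families leaves less than any power of
`1 / n`. For the bipartite problems `ε ≤ 1 / 2`. For connectivity `ε ≤ exp (-ℓ ^ 2 / n)` may be
close to `1`, but `((1 + ε) / 2) ^ (n / 4)` is at most `exp (-ℓ ^ 2 / 16)`.
-/

/-! ### Running programs on natural numbers -/

/-- A machine configuration in which registers, memory cells and addresses hold natural numbers.
It stands for the machine obtained by reducing everything modulo `2 ^ w`, see
`NatState.toMachine`. -/
structure NatState where
  reg : ℕ → ℕ
  mem : ℕ → ℕ

/-- Write a register. -/
def NatState.set (σ : NatState) (r x : ℕ) : NatState :=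
  { σ with reg := fun i => if i = r then x else σ.reg i }

/-- Write a memory cell. -/
def NatState.put (σ : NatState) (a x : ℕ) : NatState :=
  { σ with mem := fun i => if i = a then x else σ.mem i }

@[simp] theorem NatState.set_reg (σ : NatState) (r x i : ℕ) :
    (σ.set r x).reg i = if i = r then x else σ.reg i := rfl

@[simp] theorem NatState.set_mem (σ : NatState) (r x i : ℕ) : (σ.set r x).mem i = σ.mem i := rfl

@[simp] theorem NatState.put_reg (σ : NatState) (a x i : ℕ) : (σ.put a x).reg i = σ.reg i := rfl

@[simp] theorem NatState.put_mem (σ : NatState) (a x i : ℕ) :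
    (σ.put a x).mem i = if i = a then x else σ.mem i := rfl

/-- The machine with `w`-bit words described by a configuration of natural numbers. -/
def NatState.toMachine (w : ℕ) (σ : NatState) : Machine w where
  reg r := BitVec.ofNat w (σ.reg r)
  mem a := BitVec.ofNat w (σ.mem a.toNat)

/-- Started in `σ`, the program `c` halts within `t` steps in a configuration satisfying `Q`. -/
def Cmd.Runs (w : ℕ) (c : Cmd) (σ : NatState) (t : ℕ) (Q : NatState → Prop) : Prop :=
  ∃ σ' t', c.Exec (σ.toMachine w) (σ'.toMachine w) t' ∧ t' ≤ t ∧ Q σ'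

theorem NatState.toMachine_set (w : ℕ) (σ : NatState) (r x : ℕ) :
    (σ.set r x).toMachine w = (σ.toMachine w).setReg r (BitVec.ofNat w x) := by
  simp only [toMachine, Machine.setReg, Machine.mk.injEq]
  refine ⟨?_, rfl⟩
  funext i
  by_cases h : i = r <;> simp [h, Function.update]

theorem NatState.toMachine_put (w : ℕ) (σ : NatState) {a : ℕ} (x : ℕ) (ha : a < 2 ^ w) :
    (σ.put a x).toMachine w = (σ.toMachine w).setMem (BitVec.ofNat w a) (BitVec.ofNat w x) := by
  simp only [toMachine, Machine.setMem, Machine.mk.injEq]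
  refine ⟨rfl, ?_⟩
  funext i
  by_cases h : i = BitVec.ofNat w a
  · simp [h, Nat.mod_eq_of_lt ha]
  · have : i.toNat ≠ a := by
      rintro rfl; simp at h
    simp [h, this]

theorem ofNat_ne_zero {w x : ℕ} (hx : x < 2 ^ w) : BitVec.ofNat w x ≠ 0 ↔ x ≠ 0 := by
  rw [Ne, Ne, ← BitVec.toNat_inj]
  simp [Nat.mod_eq_of_lt hx]

namespace Cmd

/-- Copy register `a` to register `r`. -/
abbrev mov (r a : ℕ) : Cmd := .op .or r a a

/-- Run the programs of a list one after the other. -/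
def block : List Cmd → Cmd
  | [] => .skip
  | c :: cs => .seq c (block cs)

/-- `for i := 0, …, reg n - 1 do c`, with scratch register `x`. -/
def forLoop (i n x : ℕ) (c : Cmd) : Cmd :=
  block [.const i 0, .op .lt x i n, .loop x (block [c, .const x 1, .op .add i i x, .op .lt x i n])]

namespace Runs

variable {w : ℕ} {c d : Cmd} {cs : List Cmd} {σ : NatState} {t t' : ℕ} {Q Q' : NatState → Prop}

theorem mono (h : Runs w c σ t Q) (ht : t ≤ t') (hQ : ∀ σ', Q σ' → Q' σ') : Runs w c σ t' Q' := by
  obtain ⟨σ', s, h1, h2, h3⟩ := h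
  exact ⟨σ', s, h1, h2.trans ht, hQ _ h3⟩

theorem seq (h : Runs w c σ t fun σ' => Runs w d σ' t' Q) : Runs w (.seq c d) σ (t + t') Q := by
  obtain ⟨σ', s, h1, h2, σ'', s', h3, h4, h5⟩ := h
  exact ⟨σ'', s + s', .seq h1 h3, by omega, h5⟩

theorem nil (h : Q σ) : Runs w (block []) σ (t + 1) Q := ⟨σ, 1, .skip _, by omega, h⟩

theorem cons (h : Runs w c σ t fun σ' => Runs w (block cs) σ' t' Q) :
    Runs w (block (c :: cs)) σ (t + t') Q := seq h

theorem cons_one (h : Runs w c σ 1 fun σ' => Runs w (block cs) σ' t Q) :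
    Runs w (block (c :: cs)) σ (t + 1) Q := by
  rw [Nat.add_comm]; exact seq h

theorem const' {r k : ℕ} (h : Q (σ.set r k)) : Runs w (.const r k) σ 1 Q :=
  ⟨_, 1, by rw [NatState.toMachine_set]; exact .const _ _ _, le_rfl, h⟩

theorem op' {o : BinOp} {r a b : ℕ} (x : ℕ)
    (hx : o.eval (BitVec.ofNat w (σ.reg a)) (BitVec.ofNat w (σ.reg b)) = BitVec.ofNat w x)
    (h : Q (σ.set r x)) : Runs w (.op o r a b) σ 1 Q :=
  ⟨_, 1, by rw [NatState.toMachine_set, ← hx]; exact .op _ _ _ _ _, le_rfl, h⟩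

theorem const {r k : ℕ} (h : Runs w (block cs) (σ.set r k) t Q) :
    Runs w (block (.const r k :: cs)) σ (t + 1) Q := cons_one (const' h)

theorem add {r a b : ℕ} (h : Runs w (block cs) (σ.set r (σ.reg a + σ.reg b)) t Q) :
    Runs w (block (.op .add r a b :: cs)) σ (t + 1) Q :=
  cons_one (op' _ (by simp [BinOp.eval, BitVec.ofNat_add]) h)

theorem mul {r a b : ℕ} (h : Runs w (block cs) (σ.set r (σ.reg a * σ.reg b)) t Q) :
    Runs w (block (.op .mul r a b :: cs)) σ (t + 1) Q :=
  cons_one (op' _ (by simp [BinOp.eval, BitVec.ofNat_mul]) h)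

theorem sub {r a b : ℕ} (hab : σ.reg b ≤ σ.reg a)
    (h : Runs w (block cs) (σ.set r (σ.reg a - σ.reg b)) t Q) :
    Runs w (block (.op .sub r a b :: cs)) σ (t + 1) Q := by
  refine cons_one (op' _ ?_ h)
  obtain ⟨k, hk⟩ := Nat.exists_eq_add_of_le hab
  simp [BinOp.eval, hk, BitVec.ofNat_add]

theorem mov {r a : ℕ} (h : Runs w (block cs) (σ.set r (σ.reg a)) t Q) :
    Runs w (block (Cmd.mov r a :: cs)) σ (t + 1) Q :=
  cons_one (op' _ (by simp [BinOp.eval]) h)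

theorem eq {r a b : ℕ} (ha : σ.reg a < 2 ^ w) (hb : σ.reg b < 2 ^ w)
    (h : Runs w (block cs) (σ.set r (if σ.reg a = σ.reg b then 1 else 0)) t Q) :
    Runs w (block (.op .eq r a b :: cs)) σ (t + 1) Q := by
  refine cons_one (op' _ ?_ h)
  have : BitVec.ofNat w (σ.reg a) = BitVec.ofNat w (σ.reg b) ↔ σ.reg a = σ.reg b := by
    rw [← BitVec.toNat_inj]; simp [Nat.mod_eq_of_lt, ha, hb]
  simp only [BinOp.eval, this]
  split_ifs <;> rfl

theorem lt {r a b : ℕ} (ha : σ.reg a < 2 ^ w) (hb : σ.reg b < 2 ^ w)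
    (h : Runs w (block cs) (σ.set r (if σ.reg a < σ.reg b then 1 else 0)) t Q) :
    Runs w (block (.op .lt r a b :: cs)) σ (t + 1) Q := by
  refine cons_one (op' _ ?_ h)
  simp only [BinOp.eval, BitVec.toNat_ofNat, Nat.mod_eq_of_lt, ha, hb]
  split_ifs <;> rfl

theorem load {r a : ℕ} (ha : σ.reg a < 2 ^ w)
    (h : Runs w (block cs) (σ.set r (σ.mem (σ.reg a))) t Q) :
    Runs w (block (.load r a :: cs)) σ (t + 1) Q := by
  refine cons_one ⟨_, 1, ?_, le_rfl, h⟩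
  have := Exec.load (σ.toMachine w) r a
  rw [NatState.toMachine_set]
  simpa [NatState.toMachine, Nat.mod_eq_of_lt ha] using this

theorem store {a b : ℕ} (ha : σ.reg a < 2 ^ w)
    (h : Runs w (block cs) (σ.put (σ.reg a) (σ.reg b)) t Q) :
    Runs w (block (.store a b :: cs)) σ (t + 1) Q := by
  refine cons_one ⟨_, 1, ?_, le_rfl, h⟩
  rw [NatState.toMachine_put _ _ _ ha]
  exact Exec.store _ _ _

theorem ite {r : ℕ} (hr : σ.reg r < 2 ^ w) (h1 : σ.reg r ≠ 0 → Runs w c σ t Q)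
    (h2 : σ.reg r = 0 → Runs w d σ t Q) : Runs w (.ite r c d) σ (t + 1) Q := by
  by_cases h : σ.reg r = 0
  · obtain ⟨σ', s, h3, h4, h5⟩ := h2 h
    refine ⟨σ', s + 1, .ite_false ?_ h3, by omega, h5⟩
    simp [NatState.toMachine, h]
  · obtain ⟨σ', s, h3, h4, h5⟩ := h1 h
    exact ⟨σ', s + 1, .ite_true ((ofNat_ne_zero hr).2 h) h3, by omega, h5⟩

theorem add_eq {r a b : ℕ} (x : ℕ) (hx : σ.reg a + σ.reg b = x)
    (h : Runs w (block cs) (σ.set r x) t Q) : Runs w (block (.op .add r a b :: cs)) σ (t + 1) Q :=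
  add (hx ▸ h)

theorem load_eq {r a : ℕ} (i x : ℕ) (hi : σ.reg a = i) (ha : i < 2 ^ w) (hx : σ.mem i = x)
    (h : Runs w (block cs) (σ.set r x) t Q) : Runs w (block (.load r a :: cs)) σ (t + 1) Q :=
  load (hi ▸ ha) (by rw [hi, hx]; exact h)

theorem store_eq {a b : ℕ} (i x : ℕ) (hi : σ.reg a = i) (ha : i < 2 ^ w) (hx : σ.reg b = x)
    (h : Runs w (block cs) (σ.put i x) t Q) : Runs w (block (.store a b :: cs)) σ (t + 1) Q :=
  store (hi ▸ ha) (by rw [hi, hx]; exact h)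

/-- A loop with an invariant `I k` that carries a bound `k` on the number of iterations left. -/
theorem loop {r : ℕ} (I : ℕ → NatState → Prop) (hI : ∀ k σ, I k σ → σ.reg r < 2 ^ w)
    (body : ∀ k σ, I k σ → σ.reg r ≠ 0 → Runs w c σ t fun σ' => ∃ k' < k, I k' σ')
    (k : ℕ) (σ : NatState) (h : I k σ) (hQ : ∀ k σ', I k σ' → σ'.reg r = 0 → Q σ') :
    Runs w (.loop r c) σ (k * (t + 1) + 1) Q := by
  induction k using Nat.strong_induction_on generalizing σ with
  | _ k ih =>
    by_cases h0 : σ.reg r = 0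
    · refine ⟨σ, 1, ?_, by omega, hQ _ _ h h0⟩
      constructor
      simp [NatState.toMachine, h0]
    · obtain ⟨σ', s, h1, h2, k', hk, h3⟩ := body k σ h h0
      obtain ⟨σ'', s', h4, h5, h6⟩ := ih k' hk σ' h3
      refine ⟨σ'', s + s' + 1, .loop_step ((ofNat_ne_zero (hI _ _ h)).2 h0) h1 h4, ?_, h6⟩
      have : (k' + 1) * (t + 1) ≤ k * (t + 1) := Nat.mul_le_mul_right _ hk
      linarith

/-- A counting loop with an invariant `I k` for the configuration before iteration `k`. The
invariant must not depend on the two registers that control the loop. -/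
theorem forLoop {i n x N : ℕ} (I : ℕ → NatState → Prop) (hin : i ≠ n) (hxn : x ≠ n) (hix : i ≠ x)
    (hN : N < 2 ^ w) (hn : ∀ k σ, I k σ → σ.reg n = N)
    (hstab : ∀ k σ, I k σ → ∀ y, I k (σ.set i y) ∧ I k (σ.set x y))
    (body : ∀ k < N, ∀ σ, I k σ → σ.reg i = k →
      Runs w c σ t fun σ' => I (k + 1) σ' ∧ σ'.reg i = k)
    (σ : NatState) (h0 : I 0 σ) (hQ : ∀ σ', I N σ' → Q σ') :
    Runs w (Cmd.forLoop i n x c) σ (N * (t + 5) + 4) Q := by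
  have key : Runs w (Cmd.forLoop i n x c) σ (N * (t + 4 + 1) + 1 + 1 + 1 + 1) Q := by
    have hn' := hn _ _ h0
    refine const (lt ?_ ?_ (cons (t := N * (t + 4 + 1) + 1) (t' := 1) ?_))
    · simp
    · simp [hin.symm, hn', hN]
    · refine loop (r := x) (I := fun k σ => k ≤ N ∧ I (N - k) σ ∧ σ.reg i = N - k ∧
        σ.reg x = if N - k < N then 1 else 0) ?_ ?_ N _ ?_ ?_
      · rintro k σ ⟨-, -, -, h⟩
        rw [h]; split_ifs
        · omega
        · positivity
      · rintro k σ ⟨hk, h, hi, hx⟩ hx0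
        have hlt : N - k < N := by
          by_contra hc; rw [if_neg hc] at hx; exact hx0 hx
        refine cons ((body _ hlt σ h hi).mono le_rfl ?_)
        rintro σ' ⟨h', hi'⟩
        have hnn := hn _ _ h'
        have hk' : N - k + 1 = N - (k - 1) := by omega
        refine const (add (lt ?_ ?_ (nil ⟨k - 1, by omega, by omega, ?_, ?_, ?_⟩)))
        · simp [hix]; omega
        · simp [hin.symm, hxn.symm, hnn, hN]
        · rw [hk'] at h'
          exact (hstab _ _ (hstab _ _ (hstab _ _ h' _).2 _).1 _).2
        · simp [hix, hi', ← hk']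
        · simp [hix, hi', ← hk', hin.symm, hxn.symm, hnn]
      · refine ⟨le_rfl, ?_, by simp [hix], by simp [hin.symm, hn']⟩
        rw [Nat.sub_self]
        exact (hstab _ _ (hstab _ _ h0 _).1 _).2
      · rintro k σ ⟨hk, h, hi, hx⟩ hx0
        have : k = 0 := by
          by_contra hc
          rw [if_pos (by omega)] at hx; omega
        subst this
        exact nil (hQ _ (by simpa using h))
  exact key.mono (by ring_nf; rfl) fun _ => id

end Runs

end Cmd

/-! ### Matchings and vertex covers of the same size -/

/-- Weak duality: no matching is larger than a vertex cover. -/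
theorem SimpleGraph.Subgraph.IsMatching.ncard_edgeSet_le {V : Type*} [Finite V] {G : SimpleGraph V}
    {M : G.Subgraph} (hM : M.IsMatching) {c : Set V} (hc : G.IsVertexCover c) :
    M.edgeSet.ncard ≤ c.ncard := by
  have h : ∀ e ∈ M.edgeSet, ∃ v, v ∈ e ∧ v ∈ c := by
    intro e
    induction e with
    | h a b =>
      intro he
      rcases hc (M.adj_sub he) with h | h
      · exact ⟨a, by simp, h⟩
      · exact ⟨b, by simp, h⟩
  rcases isEmpty_or_nonempty V with hV | hV
  · simp [Set.eq_empty_of_isEmpty M.edgeSet]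
  choose! f hf hfc using h
  refine Set.ncard_le_ncard_of_injOn f hfc ?_ (Set.toFinite c)
  intro e he e' he' hee
  have key : ∀ e ∈ M.edgeSet, ∃ b, M.Adj (f e) b ∧ e = s(f e, b) := by
    intro e he
    obtain ⟨b, hb⟩ := Sym2.mem_iff_exists.1 (hf e he)
    refine ⟨b, ?_, hb⟩
    rw [hb] at he
    exact he
  obtain ⟨b, h1, h2⟩ := key e he
  obtain ⟨b', h1', h2'⟩ := key e' he'
  rw [← hee] at h1' h2'
  rw [h2, h2', hM.eq_of_adj_left h1 h1']

theorem bipGraph_adj {n : ℕ} {S : Finset (Fin n × Fin n)} {a b : Fin n ⊕ Fin n} :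
    (bipGraph n S).Adj a b ↔ (∃ e ∈ S, a = Sum.inl e.1 ∧ b = Sum.inr e.2) ∨
      (∃ e ∈ S, b = Sum.inl e.1 ∧ a = Sum.inr e.2) := by
  rw [bipGraph, SimpleGraph.fromRel_adj]
  refine ⟨fun h => h.2, fun h => ⟨?_, h⟩⟩
  rintro rfl
  rcases h with ⟨e, -, h1, h2⟩ | ⟨e, -, h1, h2⟩ <;> simp [h1] at h2

/-- The subgraph formed by a set of pairs. -/
def pairSubgraph {n : ℕ} {S D : Finset (Fin n × Fin n)} (hD : D ⊆ S) :
    (bipGraph n S).Subgraph where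
  verts := {a | ∃ e ∈ D, a = Sum.inl e.1 ∨ a = Sum.inr e.2}
  Adj a b := (∃ e ∈ D, a = Sum.inl e.1 ∧ b = Sum.inr e.2) ∨
    (∃ e ∈ D, b = Sum.inl e.1 ∧ a = Sum.inr e.2)
  adj_sub h := bipGraph_adj.2 (h.imp (fun ⟨e, he, h⟩ => ⟨e, hD he, h⟩)
    fun ⟨e, he, h⟩ => ⟨e, hD he, h⟩)
  edge_vert := by
    rintro a b (⟨e, he, h, -⟩ | ⟨e, he, -, h⟩)
    exacts [⟨e, he, .inl h⟩, ⟨e, he, .inr h⟩]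
  symm := ⟨fun _ _ h => h.symm⟩

theorem pairSubgraph_isMatching {n : ℕ} {S D : Finset (Fin n × Fin n)} (hD : D ⊆ S)
    (h1 : Set.InjOn Prod.fst (D : Set (Fin n × Fin n)))
    (h2 : Set.InjOn Prod.snd (D : Set (Fin n × Fin n))) : (pairSubgraph hD).IsMatching := by
  rintro a ⟨e, he, rfl | rfl⟩
  · refine ⟨.inr e.2, .inl ⟨e, he, rfl, rfl⟩, ?_⟩
    rintro b (⟨e', he', h, rfl⟩ | ⟨e', he', -, h⟩)
    · rw [h1 he he' (Sum.inl_injective h)]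
    · cases h
  · refine ⟨.inl e.1, .inr ⟨e, he, rfl, rfl⟩, ?_⟩
    rintro b (⟨e', he', h, -⟩ | ⟨e', he', rfl, h⟩)
    · cases h
    · rw [h2 he he' (Sum.inr_injective h)]

theorem pairSubgraph_ncard_edgeSet {n : ℕ} {S D : Finset (Fin n × Fin n)} (hD : D ⊆ S) :
    (pairSubgraph hD).edgeSet.ncard = D.card := by
  have : (pairSubgraph hD).edgeSet =
      (fun e : Fin n × Fin n => s(Sum.inl e.1, Sum.inr e.2)) '' (D : Set (Fin n × Fin n)) := by
    ext e
    induction e with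
    | h a b =>
      simp only [SimpleGraph.Subgraph.mem_edgeSet, Set.mem_image, Finset.mem_coe, Sym2.eq_iff]
      constructor
      · rintro (⟨e, he, rfl, rfl⟩ | ⟨e, he, rfl, rfl⟩)
        exacts [⟨e, he, by simp⟩, ⟨e, he, by simp⟩]
      · rintro ⟨e, he, ⟨rfl, rfl⟩ | ⟨rfl, rfl⟩⟩
        exacts [.inl ⟨e, he, rfl, rfl⟩, .inr ⟨e, he, rfl, rfl⟩]
  rw [this, Set.ncard_image_of_injective, Set.ncard_coe_finset]
  intro e e' h
  simp only [Sym2.eq_iff] at h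
  ext <;> simp_all

/-- A matching and a vertex cover of the same size determine the answers to all three bipartite
problems. -/
theorem bipartite_answers {n : ℕ} {S D : Finset (Fin n × Fin n)} (hD : D ⊆ S)
    (h1 : Set.InjOn Prod.fst (D : Set (Fin n × Fin n)))
    (h2 : Set.InjOn Prod.snd (D : Set (Fin n × Fin n))) {X Y : Finset (Fin n)}
    (hcov : ∀ e ∈ S, e.1 ∈ X ∨ e.2 ∈ Y)
    (hcard : X.card + Y.card ≤ D.card) :
    bipartitePerfectMatching.answer n S = (if D.card = n then 1 else 0) ∧
      bipartiteMaximumMatching.answer n S = D.card ∧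
      bipartiteMinimumVertexCover.answer n S = D.card := by
  have hM := pairSubgraph_isMatching hD h1 h2
  have hMc := pairSubgraph_ncard_edgeSet hD
  set c : Set (Fin n ⊕ Fin n) := Sum.inl '' (X : Set (Fin n)) ∪ Sum.inr '' (Y : Set (Fin n))
  have hc : (bipGraph n S).IsVertexCover c := by
    intro a b hab
    rcases bipGraph_adj.1 hab with ⟨e, he, rfl, rfl⟩ | ⟨e, he, rfl, rfl⟩ <;>
      have := hcov e he <;> simp [c] <;> tauto
  have hcn : c.ncard ≤ D.card := by
    refine (Set.ncard_union_le _ _).trans ?_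
    rw [Set.ncard_image_of_injective _ Sum.inl_injective,
      Set.ncard_image_of_injective _ Sum.inr_injective]
    simpa using hcard
  refine ⟨?_, ?_, ?_⟩
  · have hle : D.card ≤ n := by
      rw [← Finset.card_image_of_injOn h1]
      simpa using (D.image Prod.fst).card_le_univ
    have key : (∃ M : (bipGraph n S).Subgraph, M.IsPerfectMatching) ↔ D.card = n := ?_
    · simp only [bipartitePerfectMatching, key]
    constructor
    · rintro ⟨M, hMM, hsp⟩
      refine le_antisymm hle (le_trans ?_ ((hMM.ncard_edgeSet_le hc).trans hcn))
      choose f hf _ using fun i : Fin n => hMM (hsp (Sum.inl i))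
      have hr : ∀ i, ∃ j, f i = Sum.inr j := by
        intro i
        rcases bipGraph_adj.1 (M.adj_sub (hf i)) with ⟨e, -, -, h⟩ | ⟨e, -, -, h⟩
        exacts [⟨_, h⟩, by cases h]
      have := Set.ncard_le_ncard_of_injOn (s := (Set.univ : Set (Fin n))) (t := M.edgeSet)
        (fun i => s(Sum.inl i, f i)) (fun i _ => hf i) (by
          intro i _ j _ hij
          obtain ⟨k, hk⟩ := hr i
          obtain ⟨l, hl⟩ := hr j
          simp only [hk, hl, Sym2.eq_iff] at hij
          simp_all) (Set.toFinite _)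
      simpa using this
    · intro hn
      refine ⟨_, hM, ?_⟩
      have hs : ∀ f : Fin n × Fin n → Fin n, Set.InjOn f (D : Set (Fin n × Fin n)) →
          ∀ i, ∃ e ∈ D, f e = i := by
        intro f hf i
        have : D.image f = Finset.univ := by
          rw [← Finset.card_eq_iff_eq_univ, Finset.card_image_of_injOn hf, hn, Fintype.card_fin]
        simpa only [Finset.mem_image] using (Finset.ext_iff.1 this i).2 (Finset.mem_univ i)
      rintro (i | i)
      · obtain ⟨e, he, rfl⟩ := hs _ h1 i
        exact ⟨e, he, .inl rfl⟩
      · obtain ⟨e, he, rfl⟩ := hs _ h2 i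
        exact ⟨e, he, .inr rfl⟩
  · refine IsGreatest.csSup_eq ⟨⟨_, hM, hMc⟩, ?_⟩
    rintro k ⟨M, hMM, rfl⟩
    exact (hMM.ncard_edgeSet_le hc).trans hcn
  · obtain ⟨c', h3, h4⟩ := (bipGraph n S).vertexCoverNum_exists
    change (bipGraph n S).vertexCoverNum.toNat = _
    have h5 : c'.ncard = (bipGraph n S).vertexCoverNum.toNat := by rw [← h3]; rfl
    rw [← h5]
    refine le_antisymm ?_ (hMc ▸ hM.ncard_edgeSet_le h4)
    refine le_trans ?_ hcn
    have := hc.vertexCoverNum_le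
    rw [← h3] at this
    exact ENat.toNat_le_toNat this (Set.encard_ne_top_iff.2 (Set.toFinite _))

/-- The answers to the three bipartite problems if there is a matching of all nodes. -/
theorem bipartite_answers_of_injective {n : ℕ} {S : Finset (Fin n × Fin n)} {f : Fin n → Fin n}
    (hf : Function.Injective f) (hfS : ∀ i, (i, f i) ∈ S) :
    bipartitePerfectMatching.answer n S = 1 ∧ bipartiteMaximumMatching.answer n S = n ∧
      bipartiteMinimumVertexCover.answer n S = n := by
  have hinj : Function.Injective fun i => (i, f i) := fun i j h => (Prod.mk.inj h).1
  have := bipartite_answers (S := S) (D := Finset.univ.image fun i => (i, f i))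
    (by intro e; simp only [Finset.mem_image]; rintro ⟨i, -, rfl⟩; exact hfS i)
    (by rintro e he e' he' h; simp at he he'; grind)
    (by rintro e he e' he' h; simp at he he'; grind [Function.Injective])
    (X := Finset.univ) (Y := ∅) (by simp) (by simp [Finset.card_image_of_injective _ hinj])
  simpa [Finset.card_image_of_injective _ hinj] using this

/-! ### The auction algorithm for bipartite matching -/

/-- The state of an auction in which left nodes bid for right nodes: `p v` is the price of `v`,
`m v` is one more than the owner of `v` (or `0`), and `pend u` says that `u` still has to bid.
The node `u` may buy any `v` whose price is minimal among its neighbours and at most `n`; this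
raises the price of `v` by one and makes the former owner of `v` pending. By `slack` an owner has
paid at most one more than any of its neighbours costs now, and by `gave_up` a node that is neither
pending nor an owner has only neighbours of the highest price `n + 1`. -/
structure AuctionInv (n : ℕ) (E : ℕ → ℕ → Prop) (p m : ℕ → ℕ) (pend : ℕ → Prop) : Prop where
  mate_le : ∀ v < n, m v ≤ n
  inj : ∀ v < n, ∀ v' < n, m v ≠ 0 → m v = m v' → v = v'
  slack : ∀ v < n, ∀ u, m v = u + 1 → E u v ∧ ∀ v' < n, E u v' → p v ≤ p v' + 1
  pos : ∀ v < n, p v ≠ 0 → m v ≠ 0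
  not_pend : ∀ v < n, ∀ u, m v = u + 1 → ¬ pend u
  gave_up : ∀ u < n, ¬ pend u → (∀ v < n, m v ≠ u + 1) → ∀ v < n, E u v → n + 1 ≤ p v
  price_le : ∀ v < n, p v ≤ n + 1

theorem AuctionInv.start (n : ℕ) (E : ℕ → ℕ → Prop) :
    AuctionInv n E (fun _ => 0) (fun _ => 0) fun u => u < n := by
  constructor <;> simp +contextual

theorem AuctionInv.congr {n : ℕ} {E : ℕ → ℕ → Prop} {p m p' m' : ℕ → ℕ} {pend pend' : ℕ → Prop}
    (h : AuctionInv n E p m pend) (hp : ∀ v < n, p' v = p v) (hm : ∀ v < n, m' v = m v)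
    (hpend : ∀ u < n, pend' u ↔ pend u) : AuctionInv n E p' m' pend' := by
  constructor
  · intro v hv; rw [hm v hv]; exact h.mate_le v hv
  · intro v hv v' hv'; rw [hm v hv, hm v' hv']; exact h.inj v hv v' hv'
  · intro v hv u; rw [hm v hv, hp v hv]; intro hu
    refine ⟨(h.slack v hv u hu).1, fun v' hv' => ?_⟩
    rw [hp v' hv']; exact (h.slack v hv u hu).2 v' hv'
  · intro v hv; rw [hm v hv, hp v hv]; exact h.pos v hv
  · intro v hv u; rw [hm v hv]; intro hu
    have := h.mate_le v hv
    rw [hpend u (by omega)]; exact h.not_pend v hv u hu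
  · intro u hu; rw [hpend u hu]; intro h1 h2 v hv; rw [hp v hv]
    exact h.gave_up u hu h1 (fun v hv => by rw [← hm v hv]; exact h2 v hv) v hv
  · intro v hv; rw [hp v hv]; exact h.price_le v hv

theorem AuctionInv.giveUp {n : ℕ} {E : ℕ → ℕ → Prop} {p m : ℕ → ℕ} {pend : ℕ → Prop} {u : ℕ}
    (h : AuctionInv n E p m pend) (hE : ∀ v < n, E u v → n + 1 ≤ p v) :
    AuctionInv n E p m fun x => pend x ∧ x ≠ u := by
  refine ⟨h.mate_le, h.inj, h.slack, h.pos, fun v hv x hx => ?_, fun x hx => ?_, h.price_le⟩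
  · exact fun hc => h.not_pend v hv x hx hc.1
  · intro h1 h2
    by_cases hxu : x = u
    · subst hxu; exact hE
    · exact h.gave_up x hx (fun hc => h1 ⟨hc, hxu⟩) h2

theorem AuctionInv.buy {n : ℕ} {E : ℕ → ℕ → Prop} {p m : ℕ → ℕ} {pend : ℕ → Prop} {u v : ℕ}
    (h : AuctionInv n E p m pend) (hu : u < n) (hpu : pend u) (hv : v < n) (hE : E u v)
    (hmin : ∀ v' < n, E u v' → p v ≤ p v') (hp : p v < n + 1) :
    AuctionInv n E (fun x => if x = v then p v + 1 else p x) (fun x => if x = v then u + 1 else m x)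
      fun x => (pend x ∧ x ≠ u) ∨ m v = x + 1 := by
  have hnu : ∀ x < n, m x ≠ u + 1 := fun x hx hc => h.not_pend x hx u hc hpu
  have hle : ∀ x, p x ≤ if x = v then p v + 1 else p x := by
    intro x; split_ifs with hx
    · subst hx; omega
    · rfl
  constructor
  · intro x hx; split_ifs
    · omega
    · exact h.mate_le x hx
  · intro x hx x' hx'
    have := h.inj x hx x' hx'
    have := hnu x hx
    have := hnu x' hx'
    grind
  · intro x hx y
    by_cases hxv : x = v
    · subst hxv
      simp only [if_true]
      intro hy
      obtain rfl : u = y := by omega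
      refine ⟨hE, fun v' hv' hE' => ?_⟩
      have := hmin v' hv' hE'
      have := hle v'
      omega
    · simp only [if_neg hxv]
      intro hy
      refine ⟨(h.slack x hx y hy).1, fun v' hv' hE' => ?_⟩
      have := (h.slack x hx y hy).2 v' hv' hE'
      have := hle v'
      omega
  · intro x hx
    have := h.pos x hx
    grind
  · intro x hx y hy hc
    by_cases hxv : x = v
    · simp only [if_pos hxv] at hy
      obtain rfl : u = y := by omega
      rcases hc with hc | hc
      · exact hc.2 rfl
      · exact hnu v hv hc
    · simp only [if_neg hxv] at hy
      rcases hc with hc | hc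
      · exact h.not_pend x hx y hy hc.1
      · exact hxv (h.inj x hx v hv (by omega) (by omega))
  · intro x hx h1 h2 v' hv' hE'
    push Not at h1
    have hxu : x ≠ u := by
      rintro rfl
      exact h2 v hv (by simp)
    refine (h.gave_up x hx (fun hc => hxu (h1.1 hc)) (fun y hy hc => ?_) v' hv' hE').trans (hle v')
    by_cases hyv : y = v
    · subst hyv; exact h1.2 hc
    · exact h2 y hy (by simpa [hyv] using hc)
  · intro x hx
    have := h.price_le x hx
    split_ifs <;> omega

/-- The pair `(u, v)` of numbers belongs to `S`. -/
def InPairs {n : ℕ} (S : Finset (Fin n × Fin n)) (u v : ℕ) : Prop :=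
  ∃ e ∈ S, (e.1 : ℕ) = u ∧ (e.2 : ℕ) = v

/-- At the end of the auction the sold right nodes are as many as the nodes of some vertex cover.
As there are `n` right nodes, some price `g ∈ {1, …, n + 1}` does not occur; the right nodes
of price above `g` and the owners of the right nodes of price below `g` cover all edges. -/
theorem AuctionInv.answers {n : ℕ} {S : Finset (Fin n × Fin n)} {E : ℕ → ℕ → Prop} {p m : ℕ → ℕ}
    {pend : ℕ → Prop} (h : AuctionInv n E p m pend)
    (hE : ∀ u < n, ∀ v < n, E u v ↔ InPairs S u v) (hpend : ∀ u < n, ¬ pend u) {k : ℕ}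
    (hk : k = ((Finset.range n).filter fun v => m v ≠ 0).card) :
    bipartitePerfectMatching.answer n S = (if k = n then 1 else 0) ∧
      bipartiteMaximumMatching.answer n S = k ∧ bipartiteMinimumVertexCover.answer n S = k := by
  classical
  obtain ⟨g, hg1, hg2, hg⟩ : ∃ g, 1 ≤ g ∧ g ≤ n + 1 ∧ ∀ v < n, p v ≠ g := by
    by_contra! hcon
    have hsub : Finset.Icc 1 (n + 1) ⊆ (Finset.range n).image p := by
      intro g hg
      rw [Finset.mem_Icc] at hg
      obtain ⟨v, hv, hpv⟩ := hcon g hg.1 hg.2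
      exact Finset.mem_image.2 ⟨v, Finset.mem_range.2 hv, hpv⟩
    have := (Finset.card_le_card hsub).trans Finset.card_image_le
    simp at this
  set D : Finset (Fin n × Fin n) := S.filter fun e => m e.2 = e.1 + 1 with hDdef
  have hinjD2 : Set.InjOn Prod.snd (D : Set (Fin n × Fin n)) := by
    intro e he e' he' hee
    simp only [D, Finset.coe_filter, Set.mem_ofPred_eq] at he he'
    refine Prod.ext (Fin.ext ?_) hee
    have := he.2; have := he'.2; rw [hee] at *; omega
  have hinjD1 : Set.InjOn Prod.fst (D : Set (Fin n × Fin n)) := by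
    intro e he e' he' hee
    simp only [D, Finset.coe_filter, Set.mem_ofPred_eq] at he he'
    refine Prod.ext hee (Fin.ext ?_)
    refine h.inj _ e.2.2 _ e'.2.2 (by omega) ?_
    rw [he.2, he'.2, hee]
  -- the pair of a sold right node
  have hmem : ∀ v : Fin n, m v ≠ 0 → ∃ e ∈ D, e.2 = v := by
    intro v hv
    obtain ⟨u, hu⟩ := Nat.exists_eq_succ_of_ne_zero hv
    have hun := h.mate_le v v.2
    obtain ⟨e, he, rfl, hev⟩ := (hE u (by omega) v v.2).1 (h.slack v v.2 u hu).1
    have hev' : e.2 = v := Fin.ext hev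
    refine ⟨e, ?_, hev'⟩
    simp only [D, Finset.mem_filter]
    exact ⟨he, by rw [hev', hu]⟩
  have hDk : D.card = k := by
    rw [hk, ← Finset.card_image_of_injOn hinjD2,
      ← Finset.card_image_of_injective (D.image Prod.snd) Fin.val_injective]
    congr 1
    ext v
    simp only [Finset.mem_image, Finset.mem_filter, Finset.mem_range]
    constructor
    · rintro ⟨_, ⟨e, he, rfl⟩, rfl⟩
      have := (Finset.mem_filter.1 he).2
      exact ⟨e.2.2, by omega⟩
    · rintro ⟨hv, hmv⟩
      obtain ⟨e, he, hev⟩ := hmem ⟨v, hv⟩ hmv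
      exact ⟨_, ⟨e, he, rfl⟩, by rw [hev]⟩
  rw [← hDk]
  refine bipartite_answers (Finset.filter_subset _ _) hinjD1 hinjD2
    (X := (D.filter fun e => p e.2 < g).image Prod.fst)
    (Y := (D.filter fun e => ¬ p e.2 < g).image Prod.snd) ?_ ?_
  · intro e he
    by_cases hpe : p e.2 < g
    · left
      by_cases hex : ∃ v < n, m v = e.1 + 1
      · obtain ⟨v, hv, hmv⟩ := hex
        obtain ⟨e', he', hev⟩ := hmem ⟨v, hv⟩ (by simp [hmv])
        have hm' := (Finset.mem_filter.1 he').2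
        have h1 : e'.1 = e.1 := Fin.ext (by rw [hev] at hm'; simp only at hm'; omega)
        have h2 := (h.slack v hv e.1 hmv).2 e.2 e.2.2 ((hE _ e.1.2 _ e.2.2).2 ⟨e, he, rfl, rfl⟩)
        have h3 := hg v hv
        refine Finset.mem_image.2 ⟨e', Finset.mem_filter.2 ⟨he', ?_⟩, h1⟩
        rw [hev]; simp only; omega
      · push Not at hex
        have := h.gave_up e.1 e.1.2 (hpend _ e.1.2) hex e.2 e.2.2
          ((hE _ e.1.2 _ e.2.2).2 ⟨e, he, rfl, rfl⟩)
        omega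
    · right
      obtain ⟨e', he', hev⟩ := hmem e.2 (h.pos _ e.2.2 (by omega))
      exact Finset.mem_image.2 ⟨e', Finset.mem_filter.2 ⟨he', by rwa [hev]⟩, hev⟩
  · refine (Nat.add_le_add Finset.card_image_le Finset.card_image_le).trans ?_
    rw [Finset.card_filter_add_card_filter_not]

namespace Cmd.Runs

/-- A conditional at the end of a block. -/
theorem ite_last {w : ℕ} {c d : Cmd} {σ : NatState} {t : ℕ} {Q : NatState → Prop} {r : ℕ}
    (hr : σ.reg r < 2 ^ w) (h1 : σ.reg r ≠ 0 → Runs w c σ t Q)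
    (h2 : σ.reg r = 0 → Runs w d σ t Q) : Runs w (block [.ite r c d]) σ (t + 2) Q :=
  (cons (t' := 1) (ite hr (fun h => (h1 h).mono le_rfl fun _ h => nil (t := 0) h)
    fun h => (h2 h).mono le_rfl fun _ h => nil (t := 0) h))

end Cmd.Runs

/-! ### The matching program -/

/-- Registers and memory common to all configurations of the matching program: `n` in register
`2`, the number `c` (not used by the program) in register `3`, the addresses `n * n` of the prices
and `n * n + n` of the owners in registers `6` and `7`, the constants `n + 1` and `1` in registers
`8` and `9`, and the adjacency matrix `A`. -/
structure AuctionLayout (n c : ℕ) (A : ℕ → ℕ) (σ : NatState) : Prop where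
  r2 : σ.reg 2 = n
  r3 : σ.reg 3 = c
  r6 : σ.reg 6 = n * n
  r7 : σ.reg 7 = n * n + n
  r8 : σ.reg 8 = n + 1
  r9 : σ.reg 9 = 1
  adj : ∀ a < n * n, σ.mem a = A a

/-- A configuration with prices `p`, owners `m`, and `s` sold nodes. -/
structure AuctionState (n c : ℕ) (A p m : ℕ → ℕ) (s : ℕ) (σ : NatState) : Prop
    extends AuctionLayout n c A σ where
  r4 : σ.reg 4 = s
  price : ∀ v < n, σ.mem (n * n + v) = p v
  mate : ∀ v < n, σ.mem (n * n + n + v) = m v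

/-- The registers that hold data of the auction, as opposed to scratch registers. -/
def auctionRegs : List ℕ := [2, 3, 4, 6, 7, 8, 9]

theorem AuctionLayout.set {n c : ℕ} {A : ℕ → ℕ} {σ : NatState} (h : AuctionLayout n c A σ) (r x : ℕ)
    (hr : r ∉ [2, 3, 6, 7, 8, 9] := by decide) : AuctionLayout n c A (σ.set r x) := by
  obtain ⟨h1, h2, h3, h4, h5, h6, h7⟩ := h
  simp only [List.mem_cons, not_or] at hr
  constructor <;> simp_all [Ne.symm]

theorem AuctionState.set {n c : ℕ} {A p m : ℕ → ℕ} {s : ℕ} {σ : NatState}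
    (h : AuctionState n c A p m s σ) (r x : ℕ) (hr : r ∉ auctionRegs := by decide) :
    AuctionState n c A p m s (σ.set r x) := by
  have hr' : r ∉ [2, 3, 6, 7, 8, 9] := by simp [auctionRegs] at hr ⊢; tauto
  refine ⟨h.toAuctionLayout.set r x hr', ?_, h.price, h.mate⟩
  have : 4 ≠ r := by rintro rfl; exact hr (by decide)
  simp [this, h.r4]

theorem AuctionState.setSize {n c : ℕ} {A p m : ℕ → ℕ} {s : ℕ} {σ : NatState}
    (h : AuctionState n c A p m s σ) (x : ℕ) : AuctionState n c A p m x (σ.set 4 x) :=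
  ⟨h.toAuctionLayout.set 4 x, by simp, h.price, h.mate⟩

theorem AuctionState.putPrice {n c : ℕ} {A p m : ℕ → ℕ} {s : ℕ} {σ : NatState}
    (h : AuctionState n c A p m s σ) {v : ℕ} (hv : v < n) (x : ℕ) :
    AuctionState n c A (fun y => if y = v then x else p y) m s (σ.put (n * n + v) x) := by
  obtain ⟨⟨h1, h2, h3, h4, h5, h6, h7⟩, h8, h9, h10⟩ := h
  refine ⟨⟨h1, h2, h3, h4, h5, h6, fun a ha => ?_⟩, h8, fun y hy => ?_, fun y hy => ?_⟩
  · have : a ≠ n * n + v := by omega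
    simp [this, h7 a ha]
  · simp [h9 y hy]
  · have : n * n + n + y ≠ n * n + v := by omega
    simp [this, h10 y hy]

theorem AuctionState.putMate {n c : ℕ} {A p m : ℕ → ℕ} {s : ℕ} {σ : NatState}
    (h : AuctionState n c A p m s σ) {v : ℕ} (x : ℕ) :
    AuctionState n c A p (fun y => if y = v then x else m y) s (σ.put (n * n + n + v) x) := by
  obtain ⟨⟨h1, h2, h3, h4, h5, h6, h7⟩, h8, h9, h10⟩ := h
  refine ⟨⟨h1, h2, h3, h4, h5, h6, fun a ha => ?_⟩, h8, fun y hy => ?_, fun y hy => ?_⟩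
  · have : a ≠ n * n + n + v := by omega
    simp [this, h7 a ha]
  · have : n * n + y ≠ n * n + n + v := by omega
    simp [this, h9 y hy]
  · simp [h10 y hy]

namespace Cmd

/-- Compare the right node in register `16` with the cheapest neighbour of the left node in
register `12` found so far (register `15`, price in register `14`). -/
def auctionCompare : Cmd :=
  block [.op .mul 17 12 2, .op .add 17 17 16, .load 17 17,
    .ite 17 (block [.op .add 18 6 16, .load 18 18, .op .lt 19 18 14,
      .ite 19 (block [mov 14 18, mov 15 16]) (block [])]) (block [])]

/-- The left node in register `12` buys the right node in register `15`, whose price is in register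
`14`. The displaced node is left in register `12`; if there is none, register `13` becomes `0`. -/
def auctionBuy : Cmd :=
  block [.op .add 18 6 15, .op .add 14 14 9, .store 18 14, .op .add 18 7 15,
    .load 19 18, .op .add 17 12 9, .store 18 17,
    .ite 19 (block [.op .sub 12 19 9]) (block [.op .add 4 4 9, .const 13 0])]

/-- Let the left node in register `12` bid. Register `13` becomes `0` if no node is displaced. -/
def auctionBid : Cmd :=
  block [mov 14 8, forLoop 16 2 20 auctionCompare, .op .lt 17 14 8,
    .ite 17 auctionBuy
      (block [.const 13 0])]

/-- Leave the size of a maximum matching in register `4`. -/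
def matchingSize : Cmd :=
  block [.const 9 1, .op .mul 6 2 2, .op .add 7 6 2, .op .add 8 2 9, .op .add 11 2 2, .const 4 0,
    .const 21 0, forLoop 10 11 20 (block [.op .add 17 6 10, .store 17 21]),
    forLoop 10 2 20 (block [mov 12 10, .const 13 1, .loop 13 auctionBid])]

end Cmd

open Cmd Cmd.Runs

section

variable {n c w : ℕ} {A p m : ℕ → ℕ} {s : ℕ}

theorem mul_add_lt_mul_self {n u v : ℕ} (hu : u < n) (hv : v < n) : u * n + v < n * n := by
  have := Nat.mul_le_mul_right n (Nat.succ_le_of_lt hu)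
  rw [Nat.succ_mul] at this
  omega

/-- What a left node `u` knows after looking at the right nodes below `k`: the smallest price of
a neighbour is in register `14`, if it is at most `n`. -/
def AuctionScan (n : ℕ) (A p : ℕ → ℕ) (u k : ℕ) (σ : NatState) : Prop :=
  (∀ v < k, A (u * n + v) ≠ 0 → σ.reg 14 ≤ p v) ∧ σ.reg 14 ≤ n + 1 ∧
    (σ.reg 14 < n + 1 → σ.reg 15 < n ∧ A (u * n + σ.reg 15) ≠ 0 ∧ p (σ.reg 15) = σ.reg 14)

theorem AuctionScan.set {u k : ℕ} {σ : NatState} (h : AuctionScan n A p u k σ) (r x : ℕ)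
    (h1 : 14 ≠ r := by decide) (h2 : 15 ≠ r := by decide) : AuctionScan n A p u k (σ.set r x) := by
  simpa [AuctionScan, h1, h2] using h

theorem auctionCompare_runs (hw : n * n + 2 * n + 2 < 2 ^ w) (hA : ∀ a < n * n, A a ≤ 1)
    (hp : ∀ v < n, p v ≤ n + 1) {σ : NatState} {u k : ℕ} (hu : u < n) (hk : k < n)
    (hσ : AuctionState n c A p m s σ) (h12 : σ.reg 12 = u) (h16 : σ.reg 16 = k)
    (hscan : AuctionScan n A p u k σ) :
    Runs w auctionCompare σ 15 fun σ' => AuctionState n c A p m s σ' ∧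
      AuctionScan n A p u (k + 1) σ' ∧ ∀ r, r < 14 ∨ r = 16 → σ'.reg r = σ.reg r := by
  have ha := mul_add_lt_mul_self hu hk
  have hAk := hA _ ha
  have hpk := hp k hk
  obtain ⟨hs1, hs2, hs3⟩ := hscan
  refine mul (add (load ?_ (ite_last (t := 10) ?_ (fun h => add (load ?_ (lt ?_ ?_
    (ite_last ?_ (fun h' => mov (mov (nil ⟨?_, ?_, ?_⟩))) fun h' => nil ⟨?_, ?_, ?_⟩))))
    fun h => nil ⟨?_, ?_, ?_⟩)))
  all_goals simp only [NatState.set_reg, NatState.set_mem, h12, h16, hσ.r2, hσ.r6, if_true,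
    reduceIte, Nat.reduceEqDiff, hσ.adj _ ha, hσ.price _ hk] at *
  · omega
  · omega
  · omega
  · omega
  · omega
  · split_ifs <;> omega
  · exact (((((((hσ.set 17 _).set 17 _).set 17 _).set 18 _).set 18 _).set 19 _).set 14 _).set 15 _
  · have : p k < σ.reg 14 := by by_contra hc; simp [hc] at h'
    refine ⟨fun v hv hv' => ?_, ?_, ?_⟩
    · simp
      by_cases hvk : v = k
      · rw [hvk]
      · have := hs1 v (by omega) hv'; omega
    · simpa using hpk
    · simpa using fun _ => ⟨hk, h⟩
  · intro r hr
    have h1 : r ≠ 14 := by omega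
    have h2 : r ≠ 15 := by omega
    have h3 : r ≠ 17 := by omega
    have h4 : r ≠ 18 := by omega
    have h5 : r ≠ 19 := by omega
    simp [*]
  · exact ((((((hσ.set 17 _).set 17 _).set 17 _).set 18 _).set 18 _).set 19 _)
  · have : ¬ p k < σ.reg 14 := by by_contra hc; simp [hc] at h'
    refine ⟨fun v hv hv' => ?_, ?_, ?_⟩
    · simp
      by_cases hvk : v = k
      · rw [hvk]; omega
      · exact hs1 v (by omega) hv'
    · simpa using hs2
    · simpa using hs3
  · intro r hr
    have h3 : r ≠ 17 := by omega
    have h4 : r ≠ 18 := by omega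
    have h5 : r ≠ 19 := by omega
    simp [*]
  · exact (((hσ.set 17 _).set 17 _).set 17 _)
  · refine ⟨fun v hv hv' => ?_, ?_, ?_⟩
    · simp
      by_cases hvk : v = k
      · rw [hvk] at hv'; exact absurd h hv'
      · exact hs1 v (by omega) hv'
    · simpa using hs2
    · simpa using hs3
  · intro r hr
    have h3 : r ≠ 17 := by omega
    simp [*]

/-- The scan of all right nodes. -/
theorem auctionCompare_loop (hw : n * n + 2 * n + 2 < 2 ^ w) (hA : ∀ a < n * n, A a ≤ 1)
    (hp : ∀ v < n, p v ≤ n + 1) {σ : NatState} {u : ℕ} (hu : u < n)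
    (hσ : AuctionState n c A p m s σ) (h12 : σ.reg 12 = u) (h14 : σ.reg 14 = n + 1) :
    Runs w (forLoop 16 2 20 auctionCompare) σ (n * 20 + 4) fun σ' =>
      AuctionState n c A p m s σ' ∧ AuctionScan n A p u n σ' ∧
        ∀ r, r < 14 → σ'.reg r = σ.reg r := by
  refine forLoop (t := 15) (N := n) (fun k σ' => AuctionState n c A p m s σ' ∧
    AuctionScan n A p u k σ' ∧ ∀ r, r < 14 → σ'.reg r = σ.reg r)
    (by decide) (by decide) (by decide) (by omega)
    (fun k σ' h => h.1.r2) (fun k σ' h y => ⟨⟨h.1.set 16 y, h.2.1.set 16 y, fun r hr => ?_⟩,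
      h.1.set 20 y, h.2.1.set 20 y, fun r hr => ?_⟩) ?_ σ ?_ ?_
  · rw [NatState.set_reg, if_neg (by omega), h.2.2 r hr]
  · rw [NatState.set_reg, if_neg (by omega), h.2.2 r hr]
  · rintro k hk σ' ⟨h1, h2, h3⟩ h16
    refine (auctionCompare_runs hw hA hp hu hk h1 ((h3 12 (by decide)).trans h12) h16 h2).mono
      le_rfl ?_
    rintro σ'' ⟨h4, h5, h6⟩
    exact ⟨⟨h4, h5, fun r hr => (h6 r (.inl hr)).trans (h3 r hr)⟩, (h6 16 (.inr rfl)).trans h16⟩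
  · exact ⟨hσ, ⟨by simp, h14.le, by simp [h14]⟩, fun _ _ => rfl⟩
  · exact fun _ h => h

/-- How much the prices can still rise. -/
def auctionPotential (n : ℕ) (p : ℕ → ℕ) : ℕ := ∑ v ∈ Finset.range n, (n + 1 - p v)

theorem auctionPotential_buy {v : ℕ} (hv : v < n) (hp : p v < n + 1) :
    auctionPotential n (fun x => if x = v then p v + 1 else p x) < auctionPotential n p := by
  unfold auctionPotential
  refine Finset.sum_lt_sum (fun x _ => ?_) ⟨v, Finset.mem_range.2 hv, by simp; omega⟩
  dsimp only
  split_ifs with h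
  · subst h; omega
  · rfl

theorem card_sold_buy {u v : ℕ} (hv : v < n) :
    ((Finset.range n).filter fun x => (if x = v then u + 1 else m x) ≠ 0).card =
      ((Finset.range n).filter fun x => m x ≠ 0).card + if m v = 0 then 1 else 0 := by
  have : ((Finset.range n).filter fun x => (if x = v then u + 1 else m x) ≠ 0) =
      insert v ((Finset.range n).filter fun x => m x ≠ 0) := by
    ext x
    simp only [Finset.mem_filter, Finset.mem_range, Finset.mem_insert]
    by_cases h : x = v <;> simp [h, hv]
  rw [this]
  split_ifs with h
  · rw [Finset.card_insert_of_notMem (by simp [h])]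
  · rw [Finset.insert_eq_of_mem (by simp [h, hv])]; rfl

/-- The invariant of the loop in which left node `u₀` and the nodes displaced one after the other
bid. At most `k` iterations are left. -/
def AuctionRound (n c : ℕ) (A : ℕ → ℕ) (u₀ k : ℕ) (σ : NatState) : Prop :=
  ∃ p m, AuctionState n c A p m ((Finset.range n).filter fun v => m v ≠ 0).card σ ∧
    AuctionInv n (fun u v => A (u * n + v) ≠ 0) p m
      (fun x => (u₀ < x ∧ x < n) ∨ (σ.reg 13 = 1 ∧ x = σ.reg 12)) ∧
    σ.reg 10 = u₀ ∧ σ.reg 12 ≤ u₀ ∧ σ.reg 13 ≤ 1 ∧ k = auctionPotential n p + σ.reg 13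

theorem auctionBuy_runs (hw : n * n + 2 * n + 2 < 2 ^ w) {σ : NatState} {u v : ℕ} (hm : m v ≤ n)
    (hσ : AuctionState n c A p m ((Finset.range n).filter fun v => m v ≠ 0).card σ)
    (hv : v < n) (h12 : σ.reg 12 = u) (h15 : σ.reg 15 = v) (h14 : σ.reg 14 = p v) :
    Runs w auctionBuy σ 14 fun σ' =>
      AuctionState n c A (fun x => if x = v then p v + 1 else p x)
        (fun x => if x = v then u + 1 else m x)
        ((Finset.range n).filter fun x => (if x = v then u + 1 else m x) ≠ 0).card σ' ∧
      σ'.reg 10 = σ.reg 10 ∧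
      if m v = 0 then σ'.reg 13 = 0 ∧ σ'.reg 12 = σ.reg 12 else
        σ'.reg 12 = m v - 1 ∧ σ'.reg 13 = σ.reg 13 := by
  rw [card_sold_buy hv]
  have hσ' := (((((((hσ.set 18 (n * n + v)).set 14 (p v + 1)).putPrice hv (p v + 1)).set 18
    (n * n + n + v)).set 19 (m v)).set 17 (u + 1)).putMate (v := v) (u + 1))
  refine add_eq (n * n + v) (by rw [hσ.r6, h15]) (add_eq (p v + 1) (by simp [h14, hσ.r9])
    (store_eq (n * n + v) (p v + 1) (by simp) (by omega) (by simp) (add_eq (n * n + n + v)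
    (by simp [hσ.r7, h15]) (load_eq (n * n + n + v) (m v) (by simp) (by omega) ?_ (add_eq (u + 1)
    (by simp [hσ.r9, h12]) (store_eq (n * n + n + v) (u + 1) (by simp) (by omega) (by simp)
    (ite_last (t := 5) (by simp; omega) ?_ ?_)))))))
  · simp [hσ.mate v hv]
    omega
  · intro h
    have h : m v ≠ 0 := by simpa using h
    refine sub (by simp [hσ.r9]; omega) (nil ⟨?_, by simp, ?_⟩)
    · simpa only [if_neg h, Nat.add_zero] using hσ'.set 12 _
    · simp [h, hσ.r9]
  · intro h
    have h : m v = 0 := by simpa using h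
    refine add_eq _ (by simp [hσ.r4, hσ.r9]; rfl) (const (nil ⟨?_, by simp, ?_⟩))
    · simpa only [if_pos h] using (hσ'.setSize _).set 13 0
    · simp [h]

theorem auctionBid_runs (hw : n * n + 2 * n + 2 < 2 ^ w) (hA : ∀ a < n * n, A a ≤ 1)
    {u₀ k : ℕ} (hu₀ : u₀ < n) {σ : NatState} (hσ : AuctionRound n c A u₀ k σ)
    (h13 : σ.reg 13 ≠ 0) :
    Runs w auctionBid σ (n * 20 + 24) fun σ' => ∃ k' < k, AuctionRound n c A u₀ k' σ' := by
  obtain ⟨p, m, hS, hI, h10, h12, h13', hk⟩ := hσ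
  replace h13 : σ.reg 13 = 1 := by omega
  set u := σ.reg 12
  have hu : u < n := by omega
  refine (mov (cons (t := n * 20 + 4) (t' := 17) ((auctionCompare_loop hw hA hI.price_le hu
    (hS.set 14 _) (by simp [u]) (by simp [hS.r8])).mono le_rfl ?_)) : Runs w _ σ (_ + 1) _).mono
    (by omega) fun _ h => h
  rintro σ₁ ⟨h1, ⟨hs1, hs2, hs3⟩, h3⟩
  have e10 : σ₁.reg 10 = u₀ := (h3 10 (by decide)).trans (by simpa using h10)
  have e12 : σ₁.reg 12 = u := (h3 12 (by decide)).trans (by simp [u])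
  have e13 : σ₁.reg 13 = 1 := (h3 13 (by decide)).trans (by simpa using h13)
  clear h3
  have hb : ((σ₁.set 17 (if σ₁.reg 14 < σ₁.reg 8 then 1 else 0)).reg 17 ≠ 0) ↔
      σ₁.reg 14 < n + 1 := by simp [h1.r8]
  refine lt (by omega) (by rw [h1.r8]; omega) (ite_last (t := 14) ?_ ?_ ?_)
  · simp; split_ifs <;> omega
  · rw [hb]
    intro hlt
    obtain ⟨hv, hE, hpv⟩ := hs3 hlt
    set v := σ₁.reg 15
    have hmv := hI.mate_le v hv
    have hmin : ∀ v' < n, A (u * n + v') ≠ 0 → p v ≤ p v' := fun v' hv' h => hpv ▸ hs1 v' hv' h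
    have hI' := hI.buy hu (.inr ⟨h13, rfl⟩) hv hE hmin (by omega)
    have hpot := auctionPotential_buy hv (hpv ▸ hlt)
    refine (auctionBuy_runs hw hmv (h1.set 17 _) hv (by simpa using e12) (by simp [v])
      (by simpa using hpv.symm)).mono le_rfl ?_
    rintro σ₂ ⟨h4, h5, h6⟩
    simp only [NatState.set_reg, Nat.reduceEqDiff, if_false] at h5 h6
    refine ⟨_, ?_, _, _, h4, ?_, ?_, ?_, ?_, rfl⟩
    · rw [hk, h13]
      split_ifs at h6 with h <;> simp [h6, e13] <;> omega
    · refine hI'.congr (fun _ _ => rfl) (fun _ _ => rfl) fun x hx => ?_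
      split_ifs at h6 with h
      · simp [h6, h, h13]
        omega
      · simp [h6, h13, e13]
        omega
    · exact h5.trans e10
    · split_ifs at h6 with h
      · rw [h6.2, e12]; exact h12
      · rw [h6.1]
        obtain ⟨y, hy⟩ := Nat.exists_eq_succ_of_ne_zero h
        have := hI.not_pend v hv y hy
        omega
    · split_ifs at h6 with h <;> simp [h6, e13]
  · rw [← not_ne_iff, hb]
    intro hge
    refine const (nil ⟨_, ?_, p, m, (h1.set 17 _).set 13 0, ?_, ?_, ?_, ?_, rfl⟩)
    · simp [hk, h13]
    · refine (hI.giveUp (u := u) fun v hv hE => ?_).congr (fun _ _ => rfl) (fun _ _ => rfl) ?_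
      · have := hs1 v hv hE
        omega
      · intro x hx
        simp [h13]
        omega
    · simpa using e10
    · simpa [e12] using h12
    · simp

/-- The program `Cmd.matchingSize` is correct and takes `O(n ^ 4)` steps. -/
theorem matchingSize_runs (hn : 1 ≤ n) (hw : n * n + 2 * n + 2 < 2 ^ w)
    (hA : ∀ a < n * n, A a ≤ 1) {S : Finset (Fin n × Fin n)}
    (hAS : ∀ u < n, ∀ v < n, A (u * n + v) ≠ 0 ↔ InPairs S u v) {σ : NatState}
    (h2 : σ.reg 2 = n) (h3 : σ.reg 3 = c) (hσA : ∀ a < n * n, σ.mem a = A a) :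
    Runs w matchingSize σ (200 * n ^ 4) fun σ' => σ'.reg 2 = n ∧ σ'.reg 3 = c ∧
      (∀ a < n * n, σ'.mem a = A a) ∧
      bipartitePerfectMatching.answer n S = (if σ'.reg 4 = n then 1 else 0) ∧
      bipartiteMaximumMatching.answer n S = σ'.reg 4 ∧
      bipartiteMinimumVertexCover.answer n S = σ'.reg 4 := by
  have key : Runs w matchingSize σ ((2 * n * (3 + 5) + 4) +
      ((n * (((n * (n + 1) + 1) * (n * 20 + 24 + 1) + 1) + 1 + 1 + 1 + 5) + 4) + 1) + 7)
      fun σ' => σ'.reg 2 = n ∧ σ'.reg 3 = c ∧ (∀ a < n * n, σ'.mem a = A a) ∧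
      bipartitePerfectMatching.answer n S = (if σ'.reg 4 = n then 1 else 0) ∧
      bipartiteMaximumMatching.answer n S = σ'.reg 4 ∧
      bipartiteMinimumVertexCover.answer n S = σ'.reg 4 := by
    have hN : n < 2 ^ w := by omega
    have hN2 : 2 * n < 2 ^ w := by omega
    refine const (mul (add_eq (n * n + n) (by simp [h2]) (add_eq (n + 1) (by simp [h2])
      (add_eq (2 * n) (by simp [h2]; ring) (const (const ?_))))))
    refine cons (forLoop (N := 2 * n) (fun k σ' => AuctionLayout n c A σ' ∧ σ'.reg 4 = 0 ∧
      σ'.reg 21 = 0 ∧ σ'.reg 11 = 2 * n ∧ ∀ j < k, σ'.mem (n * n + j) = 0) (by decide) (by decide)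
      (by decide) hN2 (fun k σ' h => h.2.2.2.1) (fun k σ' h y => ⟨⟨h.1.set 10 y, h.2⟩,
        ⟨h.1.set 20 y, h.2⟩⟩) ?_ _ ?_ ?_)
    · rintro k hk σ' ⟨g1, g2, g3, g4, g5⟩ g6
      refine add_eq (n * n + k) (by rw [g1.r6, g6]) (store_eq (n * n + k) 0 (by simp) (by omega)
        (by simpa using g3) (nil ⟨⟨⟨g1.r2, g1.r3, g1.r6, g1.r7, g1.r8, g1.r9, ?_⟩, ?_⟩, ?_⟩))
      · intro a ha
        have : a ≠ n * n + k := by omega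
        simp [this, g1.adj a ha]
      · refine ⟨by simpa using g2, by simpa using g3, by simpa using g4, fun j hj => ?_⟩
        by_cases hjk : j = k
        · simp [hjk]
        · simpa [hjk] using g5 j (by omega)
      · simpa using g6
    · exact ⟨⟨by simp [h2], by simp [h3], by simp [h2], by simp, by simp, by simp, hσA⟩,
        by simp, by simp, by simp, by simp⟩
    · rintro σ₁ ⟨g1, g2, -, -, g5⟩
      refine cons (forLoop (N := n) (fun k σ' => ∃ p m,
        AuctionState n c A p m ((Finset.range n).filter fun v => m v ≠ 0).card σ' ∧
        AuctionInv n (fun u v => A (u * n + v) ≠ 0) p m fun x => k ≤ x ∧ x < n)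
        (by decide) (by decide) (by decide) hN
        (fun k σ' ⟨p, m, h, _⟩ => h.r2) (fun k σ' ⟨p, m, h, h'⟩ y => ⟨⟨p, m, h.set 10 y, h'⟩,
        ⟨p, m, h.set 20 y, h'⟩⟩) ?_ _ ?_ ?_)
      · rintro k hk σ' ⟨p, m, hS, hI⟩ h10
        refine mov (const (cons (t := (n * (n + 1) + 1) * (n * 20 + 24 + 1) + 1) (t' := 1) ?_))
        have hpot : auctionPotential n p ≤ n * (n + 1) :=
          (Finset.sum_le_card_nsmul _ _ (n + 1) fun v _ => by omega).trans (by simp)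
        refine (loop (AuctionRound n c A k) ?_ (fun k' σ'' h h13 => auctionBid_runs hw hA hk h h13)
          (auctionPotential n p + 1) _ ?_ (Q := fun σ'' => Runs w (block []) σ'' 1 _) ?_).mono
          (by gcongr) fun _ => id
        · rintro k' σ'' ⟨p', m', h⟩
          omega
        · refine ⟨p, m, (hS.set 12 _).set 13 _, ?_, by simpa using h10, by simp [h10], by simp,
            by simp⟩
          refine hI.congr (fun _ _ => rfl) (fun _ _ => rfl) fun x hx => ?_
          simp [h10]
          omega
        · rintro k' σ'' ⟨p', m', h4, h5, h6, -, -, -⟩ h13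
          refine nil ⟨⟨p', m', h4, ?_⟩, h6⟩
          refine h5.congr (fun _ _ => rfl) (fun _ _ => rfl) fun x hx => ?_
          simp [h13]
      · refine ⟨fun _ => 0, fun _ => 0, ⟨g1, by simp [g2], fun v hv => g5 v (by omega),
          fun v hv => ?_⟩, ?_⟩
        · rw [Nat.add_assoc]; exact g5 _ (by omega)
        · simpa using AuctionInv.start n fun u v => A (u * n + v) ≠ 0
      · rintro σ' ⟨p, m, hS, hI⟩
        refine nil ⟨hS.r2, hS.r3, hS.adj, ?_⟩
        exact hI.answers hAS (fun u hu hc => by omega) hS.r4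
  refine key.mono ?_ fun _ => id
  have e1 : n ≤ n ^ 4 := Nat.le_self_pow (by decide) n
  have e2 : n ^ 2 ≤ n ^ 4 := Nat.pow_le_pow_right hn (by decide)
  have e3 : n ^ 3 ≤ n ^ 4 := Nat.pow_le_pow_right hn (by decide)
  nlinarith

end

/-! ### Graph search -/

/-- The state of a search from node `0`: a node `v` is unseen if `st v = 0`, seen if `st v = 1`,
and done if `st v = 2`; the neighbours of nodes that are done have been seen. -/
structure SearchInv {n : ℕ} (G : SimpleGraph (Fin n)) (st : ℕ → ℕ) : Prop where
  le : ∀ v < n, st v ≤ 2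
  zero : st 0 ≠ 0
  reach : ∀ u v : Fin n, (u : ℕ) = 0 → st v ≠ 0 → G.Reachable u v
  done : ∀ u v : Fin n, st u = 2 → G.Adj u v → st v ≠ 0

/-- The states of the nodes after the node `u` has been declared done and its neighbours below `k`
have been looked at. -/
def searchExpand (E : ℕ → ℕ → Prop) [DecidableRel E] (st : ℕ → ℕ) (u k : ℕ) (v : ℕ) : ℕ :=
  if v = u then 2 else if v < k ∧ E u v ∧ st v = 0 then 1 else st v

/-- Adjacency according to a matrix, of which only one triangle is used. -/
def searchAdj (n : ℕ) (A : ℕ → ℕ) (u v : ℕ) : Prop := A (u * n + v) + A (v * n + u) ≠ 0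

instance (n : ℕ) (A : ℕ → ℕ) : DecidableRel (searchAdj n A) :=
  fun _ _ => inferInstanceAs (Decidable (_ ≠ _))

theorem SearchInv.expand {n : ℕ} {G : SimpleGraph (Fin n)} {st : ℕ → ℕ} (h : SearchInv G st)
    {E : ℕ → ℕ → Prop} [DecidableRel E] (hE : ∀ u v : Fin n, G.Adj u v ↔ E u v) {u : ℕ}
    (hu : u < n) (hst : st u ≠ 0) : SearchInv G (searchExpand E st u n) := by
  have hne : ∀ v, st v ≠ 0 → searchExpand E st u n v ≠ 0 := by
    intro v hv
    unfold searchExpand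
    split_ifs <;> simp_all
  refine ⟨fun v hv => ?_, hne _ h.zero, fun x v hx hv => ?_, fun x v hx hxv => ?_⟩
  · unfold searchExpand
    have := h.le v hv
    split_ifs <;> omega
  · unfold searchExpand at hv
    split_ifs at hv with h1 h2
    · exact h.reach x v hx (h1 ▸ hst)
    · exact (h.reach x ⟨u, hu⟩ hx hst).trans ((hE ⟨u, hu⟩ v).2 h2.2.1).reachable
    · exact h.reach x v hx hv
  · by_cases hxu : (x : ℕ) = u
    · by_cases hv : st v = 0
      · have := (hE x v).1 hxv
        rw [hxu] at this
        unfold searchExpand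
        split_ifs with h1 h2
        · omega
        · omega
        · exact absurd ⟨v.2, this, hv⟩ h2
      · exact hne v hv
    · refine hne v (h.done x v ?_ hxv)
      unfold searchExpand at hx
      rw [if_neg hxu] at hx
      split_ifs at hx
      · omega
      · exact hx

theorem card_done_expand {n : ℕ} {E : ℕ → ℕ → Prop} [DecidableRel E] {st : ℕ → ℕ} {u : ℕ}
    (hu : u < n) (hst : st u = 1) :
    ((Finset.range n).filter fun v => searchExpand E st u n v = 2).card =
      ((Finset.range n).filter fun v => st v = 2).card + 1 := by
  have : ((Finset.range n).filter fun v => searchExpand E st u n v = 2) =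
      insert u ((Finset.range n).filter fun v => st v = 2) := by
    ext v
    simp only [Finset.mem_filter, Finset.mem_range, Finset.mem_insert]
    by_cases h : v = u
    · simp [h, hu, searchExpand]
    · have : searchExpand E st u n v = 2 ↔ st v = 2 := by
        unfold searchExpand
        rw [if_neg h]
        split_ifs with h1
        · simp [h1.2.2]
        · rfl
      simp [this, h]
  rw [this, Finset.card_insert_of_notMem (by simp [hst])]

/-- When no node is seen but not done, the graph is connected if and only if all nodes are done. -/
theorem SearchInv.connected_iff {n : ℕ} {G : SimpleGraph (Fin n)} {st : ℕ → ℕ} (h : SearchInv G st)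
    (hn : 0 < n) (h1 : ∀ v < n, st v ≠ 1) :
    G.Connected ↔ ((Finset.range n).filter fun v => st v = 2).card = n := by
  have h2 : ∀ v < n, st v ≠ 0 → st v = 2 := fun v hv h0 => by
    have := h.le v hv; have := h1 v hv; omega
  constructor
  · intro hG
    rw [Finset.filter_true_of_mem, Finset.card_range]
    intro v hv
    have hv : v < n := Finset.mem_range.1 hv
    have key : ∀ x y : Fin n, G.Walk x y → st x ≠ 0 → st y ≠ 0 := by
      intro x y p
      induction p with
      | nil => exact id
      | cons hadj _ ih => exact fun hx => ih (h.done _ _ (h2 _ (Fin.is_lt _) hx) hadj)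
    obtain ⟨p⟩ := hG.preconnected ⟨0, hn⟩ ⟨v, hv⟩
    exact h2 v hv (key _ _ p h.zero)
  · intro hc
    have hall : ∀ v < n, st v = 2 := by
      intro v hv
      have := Finset.eq_of_subset_of_card_le (Finset.filter_subset (fun v => st v = 2)
        (Finset.range n)) (by rw [hc, Finset.card_range])
      rw [← Finset.mem_range, ← this] at hv
      exact (Finset.mem_filter.1 hv).2
    have : Nonempty (Fin n) := ⟨⟨0, hn⟩⟩
    refine ⟨fun x y => ?_⟩
    have hr := fun v : Fin n => h.reach ⟨0, hn⟩ v rfl (by simp [hall v v.2])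
    exact (hr x).symm.trans (hr y)

/-- A configuration of the search program: `n` in register `2`, the number `c` (not used by the
program) in register `3`, the number of nodes that are done in register `4`, the address `n * n`
of the node states in register `6`, the constant `1` in register `9`. -/
structure SearchState (n c : ℕ) (A st : ℕ → ℕ) (s : ℕ) (σ : NatState) : Prop where
  r2 : σ.reg 2 = n
  r3 : σ.reg 3 = c
  r4 : σ.reg 4 = s
  r6 : σ.reg 6 = n * n
  r9 : σ.reg 9 = 1
  adj : ∀ a < n * n, σ.mem a = A a
  status : ∀ v < n, σ.mem (n * n + v) = st v

theorem SearchState.set {n c : ℕ} {A st : ℕ → ℕ} {s : ℕ} {σ : NatState}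
    (h : SearchState n c A st s σ) (r x : ℕ) (hr : r ∉ [2, 3, 4, 6, 9] := by decide) :
    SearchState n c A st s (σ.set r x) := by
  obtain ⟨h1, h2, h3, h4, h5, h6, h7⟩ := h
  simp only [List.mem_cons, not_or] at hr
  constructor <;> simp_all [Ne.symm]

theorem SearchState.putStatus {n c : ℕ} {A st : ℕ → ℕ} {s : ℕ} {σ : NatState}
    (h : SearchState n c A st s σ) (v x : ℕ) :
    SearchState n c A (fun y => if y = v then x else st y) s (σ.put (n * n + v) x) := by
  obtain ⟨h1, h2, h3, h4, h5, h6, h7⟩ := h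
  refine ⟨h1, h2, h3, h4, h5, fun a ha => ?_, fun y hy => ?_⟩
  · have : a ≠ n * n + v := by omega
    simp [this, h6 a ha]
  · simp [h7 y hy]

theorem SearchState.congr {n c : ℕ} {A st st' : ℕ → ℕ} {s : ℕ} {σ : NatState}
    (h : SearchState n c A st s σ) (hst : ∀ v < n, st v = st' v) : SearchState n c A st' s σ :=
  { h with status := fun v hv => (h.status v hv).trans (hst v hv) }

namespace Cmd

/-- If the node in register `16` is seen but not done, remember it in register `11`. -/
def searchFind : Cmd :=
  block [.op .add 17 6 16, .load 17 17, .op .eq 17 17 9,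
    .ite 17 (block [.const 12 1, mov 11 16]) (block [])]

/-- If the node in register `16` is an unseen neighbour of the node in register `11`, see it. -/
def searchSee : Cmd :=
  block [.op .mul 17 11 2, .op .add 17 17 16, .load 17 17, .op .mul 18 16 2, .op .add 18 18 11,
    .load 18 18, .op .add 17 17 18,
    .ite 17 (block [.op .add 18 6 16, .load 19 18, .ite 19 (block []) (block [.store 18 9])])
      (block [])]

/-- Declare the node in register `11` done. -/
def searchDone : Cmd :=
  block [.op .add 4 4 9, .op .add 17 6 11, .const 18 2, .store 17 18, forLoop 16 2 20 searchSee]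

/-- One round of the search: find a node that is seen but not done, and make it done. -/
def searchRound : Cmd :=
  block [.const 12 0, .const 11 0, forLoop 16 2 20 searchFind, .ite 12 searchDone (block [])]

/-- Leave in register `4` whether the graph is connected. -/
def connectivityCheck : Cmd :=
  block [.const 9 1, .op .mul 6 2 2, .const 4 0, .const 21 0,
    forLoop 10 2 20 (block [.op .add 17 6 10, .store 17 21]), .store 6 9,
    forLoop 10 2 20 searchRound, .op .eq 4 4 2]

end Cmd

section

variable {n c w : ℕ} {A st : ℕ → ℕ} {s : ℕ}

theorem searchFind_loop (hw : n * n + 2 * n + 2 < 2 ^ w) (hst : ∀ v < n, st v ≤ 2) {σ : NatState}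
    (hσ : SearchState n c A st s σ) (h12 : σ.reg 12 = 0) {i : ℕ} (h10 : σ.reg 10 = i) :
    Runs w (forLoop 16 2 20 searchFind) σ (n * (8 + 5) + 4) fun σ' => SearchState n c A st s σ' ∧
      σ'.reg 10 = i ∧ ((σ'.reg 12 = 0 ∧ ∀ v < n, st v ≠ 1) ∨
        (σ'.reg 12 = 1 ∧ σ'.reg 11 < n ∧ st (σ'.reg 11) = 1)) := by
  refine forLoop (N := n) (fun k σ' => SearchState n c A st s σ' ∧
      σ'.reg 10 = i ∧ ((σ'.reg 12 = 0 ∧ ∀ v < k, st v ≠ 1) ∨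
        (σ'.reg 12 = 1 ∧ σ'.reg 11 < n ∧ st (σ'.reg 11) = 1))) (by decide) (by decide) (by decide)
        (by omega) (fun k σ h => h.1.r2)
        (fun k σ h y => ⟨⟨h.1.set 16 y, h.2⟩, ⟨h.1.set 20 y, h.2⟩⟩) ?_ σ
        ⟨hσ, h10, .inl ⟨h12, by simp⟩⟩ fun _ => id
  rintro k hk σ' ⟨h1, h2, h3⟩ h16
  have hstk := hst k hk
  refine add_eq (n * n + k) (by rw [h1.r6, h16]) (load_eq (n * n + k) (st k) (by simp) (by omega)
    (by simpa using h1.status k hk) (eq (by simp only [NatState.set_reg, if_true]; omega)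
    (by simp only [NatState.set_reg, Nat.reduceEqDiff, if_false, h1.r9]; omega)
    (ite_last (t := 3) ?_ ?_ ?_)))
  · simp; split_ifs <;> omega
  · intro h
    have h : st k = 1 := by by_contra hc; simp [h1.r9, hc] at h
    refine const (mov (nil ⟨⟨((((h1.set 17 _).set 17 _).set 17 _).set 12 _).set 11 _, ?_, ?_⟩, ?_⟩))
    · simpa using h2
    · right; simp [h16, hk, h]
    · simp [h16]
  · intro h
    have h : st k ≠ 1 := by intro hc; simp [h1.r9, hc] at h
    refine nil ⟨⟨((h1.set 17 _).set 17 _).set 17 _, ?_, ?_⟩, ?_⟩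
    · simpa using h2
    · refine h3.imp (fun h3 => ⟨by simpa using h3.1, fun v hv => ?_⟩) fun h3 => by simpa using h3
      rcases Nat.lt_succ_iff_lt_or_eq.1 hv with hv | rfl
      · exact h3.2 v hv
      · exact h
    · simp [h16]

theorem searchSee_loop (hw : n * n + 2 * n + 2 < 2 ^ w) (hA : ∀ a < n * n, A a ≤ 1)
    (hst : ∀ v < n, st v ≤ 2) {σ : NatState} {u : ℕ} (hu : u < n)
    (hσ : SearchState n c A (fun v => if v = u then 2 else st v) s σ) (h11 : σ.reg 11 = u)
    {i : ℕ} (h10 : σ.reg 10 = i) :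
    Runs w (forLoop 16 2 20 searchSee) σ (n * (15 + 5) + 4) fun σ' =>
      SearchState n c A (searchExpand (searchAdj n A) st u n) s σ' ∧
      σ'.reg 10 = i := by
  refine (forLoop (t := 15) (N := n) (fun k σ' =>
      SearchState n c A (searchExpand (searchAdj n A) st u k) s σ' ∧
      σ'.reg 10 = i ∧ σ'.reg 11 = u) (by decide) (by decide) (by decide)
        (by omega) (fun k σ h => h.1.r2)
        (fun k σ h y => ⟨⟨h.1.set 16 y, h.2⟩, ⟨h.1.set 20 y, h.2⟩⟩) ?_ σ ?_
        fun σ' h => ⟨h.1, h.2.1⟩)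
  · rintro k hk σ' ⟨h1, h2, h3⟩ h16
    have a1 := mul_add_lt_mul_self hu hk
    have a2 := mul_add_lt_mul_self hk hu
    have hA1 := hA _ a1
    have hA2 := hA _ a2
    have hstk := hst k hk
    have hex : ∀ (h : ¬ (A (u * n + k) + A (k * n + u) ≠ 0 ∧ k ≠ u ∧ st k = 0)) v,
        searchExpand (searchAdj n A) st u k v =
          searchExpand (searchAdj n A) st u (k + 1) v := by
      intro h v
      unfold searchExpand
      by_cases hv : v = k
      · subst hv
        by_cases hvu : v = u
        · simp [hvu]
        · have : ¬ (searchAdj n A u v ∧ st v = 0) := by unfold searchAdj; tauto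
          simp only [hvu, if_false, this, and_false]
      · have : v < k + 1 ↔ v < k := by omega
        simp only [this]
    refine mul (add_eq (u * n + k) (by simp [h3, h16, h1.r2]) (load_eq (u * n + k) (A (u * n + k))
      (by simp) (by omega) (by simpa using h1.adj _ a1) (mul (add_eq (k * n + u)
      (by simp [h3, h16, h1.r2]) (load_eq (k * n + u) (A (k * n + u)) (by simp) (by omega)
      (by simpa using h1.adj _ a2) (add_eq (A (u * n + k) + A (k * n + u)) (by simp)
      (ite_last (t := 6) (by simp; omega) ?_ ?_)))))))
    · intro h
      have h : A (u * n + k) + A (k * n + u) ≠ 0 := by simpa using h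
      have hval : searchExpand (searchAdj n A) st u k k =
          if k = u then 2 else st k := by simp [searchExpand]
      refine add_eq (n * n + k) (by simp [h1.r6, h16]) (load_eq (n * n + k) _ (by simp) (by omega)
        (by simpa using h1.status k hk) (ite_last (t := 2) ?_ ?_ ?_))
      · simp only [NatState.set_reg, if_true, hval]; split_ifs <;> omega
      · intro h'
        refine nil ⟨⟨((((((((h1.set 17 _).set 17 _).set 17 _).set 18 _).set 18 _).set 18 _).set
          17 _).set 18 _).set 19 _ |>.congr fun v _ => hex ?_ v, ?_⟩, ?_⟩
        · rintro ⟨-, g1, g2⟩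
          simp [hval, g1, g2] at h'
        · simpa using ⟨h2, h3⟩
        · simpa using h16
      · intro h'
        have h' : k ≠ u ∧ st k = 0 := by
          simp only [NatState.set_reg, if_true, hval] at h'
          split_ifs at h' with hku
          exact ⟨hku, h'⟩
        refine store_eq (n * n + k) 1 (by simp) (by omega) (by simp [h1.r9]) (nil ⟨⟨
          (((((((((h1.set 17 _).set 17 _).set 17 _).set 18 _).set 18 _).set 18 _).set
          17 _).set 18 _).set 19 _).putStatus k 1 |>.congr fun v _ => ?_, ?_⟩, ?_⟩)
        · unfold searchExpand
          by_cases hv : v = k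
          · subst hv
            simp only [if_true, h'.1, if_false]
            rw [if_pos ⟨by omega, h, h'.2⟩]
          · have : v < k + 1 ↔ v < k := by omega
            simp only [this, if_neg hv]
        · simpa using ⟨h2, h3⟩
        · simpa using h16
    · intro h
      have h : A (u * n + k) + A (k * n + u) = 0 := by simpa using h
      refine nil ⟨⟨(((((((h1.set 17 _).set 17 _).set 17 _).set 18 _).set 18 _).set 18 _).set
          17 _) |>.congr fun v _ => hex ?_ v, ?_⟩, ?_⟩
      · rintro ⟨g, -⟩
        exact g h
      · simpa using ⟨h2, h3⟩
      · simpa using h16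
  · exact ⟨hσ.congr fun v _ => by simp [searchExpand], h10, h11⟩

/-- The program `Cmd.connectivityCheck` is correct and takes `O(n ^ 2)` steps. -/
theorem connectivityCheck_runs (hn : 1 ≤ n) (hw : n * n + 2 * n + 2 < 2 ^ w)
    (hA : ∀ a < n * n, A a ≤ 1) {G : SimpleGraph (Fin n)}
    (hG : ∀ u v : Fin n, G.Adj u v ↔ searchAdj n A u v) {σ : NatState}
    (h2 : σ.reg 2 = n) (h3 : σ.reg 3 = c) (hσA : ∀ a < n * n, σ.mem a = A a) :
    Runs w connectivityCheck σ (150 * n ^ 2) fun σ' => σ'.reg 2 = n ∧ σ'.reg 3 = c ∧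
      (∀ a < n * n, σ'.mem a = A a) ∧ (G.Connected → σ'.reg 4 = 1) ∧
      (¬ G.Connected → σ'.reg 4 = 0) := by
  have key : Runs w connectivityCheck σ ((n * (3 + 5) + 4) +
      (((n * (((n * (8 + 5) + 4) + ((n * (15 + 5) + 4) + 1 + 4) + 2 + 2) + 5) + 4) + 2) + 1) + 4)
      fun σ' => σ'.reg 2 = n ∧ σ'.reg 3 = c ∧ (∀ a < n * n, σ'.mem a = A a) ∧
        (G.Connected → σ'.reg 4 = 1) ∧ (¬ G.Connected → σ'.reg 4 = 0) := by
    have hN : n < 2 ^ w := by omega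
    have hN0 : n * n < 2 ^ w := by omega
    refine const (mul (const (const (cons (forLoop (N := n) (fun k σ' =>
      SearchState n c A (fun v => if v < k then 0 else σ'.mem (n * n + v)) 0 σ' ∧ σ'.reg 21 = 0)
      (by decide) (by decide) (by decide) hN (fun k σ' h => h.1.r2)
      (fun k σ' h y => ⟨⟨h.1.set 10 y, h.2⟩, ⟨h.1.set 20 y, h.2⟩⟩) ?_ _ ?_ ?_)))))
    · rintro k hk σ' ⟨g1, g2⟩ g3
      refine add_eq (n * n + k) (by rw [g1.r6, g3]) (store_eq (n * n + k) 0 (by simp) (by omega)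
        (by simpa using g2) (nil ⟨⟨?_, by simpa using g2⟩, by simpa using g3⟩))
      refine ((g1.set 17 (n * n + k)).putStatus k 0).congr fun v hv => ?_
      by_cases hvk : v = k
      · simp [hvk]
      · have : v < k + 1 ↔ v < k := by omega
        simp [hvk, this]
    · exact ⟨⟨by simp [h2], by simp [h3], by simp, by simp [h2], by simp, hσA, by simp⟩, by simp⟩
    · rintro σ₁ ⟨g1, g2⟩
      refine store_eq (n * n) 1 g1.r6 hN0 g1.r9 (cons (t' := 2) (t := n * (((n * (8 + 5) + 4) +
        ((n * (15 + 5) + 4) + 1 + 4) + 2 + 2) + 5) + 4) (forLoop (N := n) (fun k σ' => ∃ st,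
        SearchState n c A st ((Finset.range n).filter fun v => st v = 2).card σ' ∧
        SearchInv G st ∧ ((((Finset.range n).filter fun v => st v = 2).card = k) ∨
          ∀ v < n, st v ≠ 1)) (by decide) (by decide) (by decide) hN (fun k σ' ⟨st, h, _⟩ => h.r2)
        (fun k σ' ⟨st, h, h'⟩ y => ⟨⟨st, h.set 10 y, h'⟩, ⟨st, h.set 20 y, h'⟩⟩) ?_ _ ?_ ?_))
      · rintro k hk σ' ⟨st, hS, hI, hk'⟩ h10
        refine const (const (cons (t := n * (8 + 5) + 4) (t' := (n * (15 + 5) + 4) + 1 + 4 + 2)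
          (searchFind_loop hw hI.le ((hS.set 12 0).set 11 0) (by simp)
          (by simpa using h10) |>.mono le_rfl ?_)))
        rintro σ₂ ⟨f1, f2, f3⟩
        refine ite_last ?_ ?_ ?_
        · rcases f3 with f3 | f3 <;> omega
        · intro hne
          obtain ⟨-, hu, hst⟩ := f3.resolve_left fun h => hne h.1
          set u := σ₂.reg 11 with hu_def
          have hfree : ¬ ∀ v < n, st v ≠ 1 := fun h => h u hu hst
          refine add_eq _ (by rw [f1.r4, f1.r9]) (add_eq (n * n + u) (by simp [f1.r6, hu_def])
            (const (store_eq (n * n + u) 2 (by simp) (by omega) (by simp) (cons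
            (t := n * (15 + 5) + 4) (t' := 1) (searchSee_loop (st := st)
              (s := ((Finset.range n).filter fun v => st v = 2).card + 1) (u := u) (i := k)
              (n := n) (c := c) hw hA hI.le hu ?_ (by simp [hu_def])
              (by simpa using f2) |>.mono le_rfl ?_)))))
          · refine SearchState.putStatus (SearchState.set (SearchState.set (σ := σ₂.set 4 _) ?_ _ _)
              _ _) _ _
            exact ⟨by simp [f1.r2], by simp [f1.r3], by simp, by simp [f1.r6], by simp [f1.r9],
              f1.adj, f1.status⟩
          · rintro σ₃ ⟨e1, e2⟩
            refine nil ⟨⟨_, ?_, hI.expand hG hu (by omega), .inl ?_⟩, e2⟩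
            · rwa [card_done_expand hu hst]
            · rw [card_done_expand hu hst, hk'.resolve_right hfree]
        · intro h0
          obtain ⟨-, hfree⟩ := f3.resolve_right fun h => by omega
          exact nil ⟨⟨st, f1, hI, .inr hfree⟩, f2⟩
      · refine ⟨fun v => if v = 0 then 1 else 0, ?_, ?_, .inl ?_⟩
        · have h0 : ((Finset.range n).filter fun v => (if v = 0 then 1 else 0) = 2).card = 0 := by
            rw [Finset.card_eq_zero, Finset.filter_eq_empty_iff]
            intro v _
            split_ifs <;> simp
          rw [h0]
          refine (g1.putStatus 0 1).congr fun v hv => ?_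
          simp [hv]
        · refine ⟨fun v _ => ?_, by simp, fun u v hu hv => ?_, fun u v hu => ?_⟩
          · split_ifs <;> omega
          · have : u = v := by
              refine Fin.ext ?_
              by_contra hc
              simp at hv
              omega
            rw [this]
          · split_ifs at hu
            omega
        · rw [Finset.card_eq_zero, Finset.filter_eq_empty_iff]
          intro v _
          dsimp only
          split_ifs <;> simp
      · rintro σ' ⟨st, hS, hI, hk⟩
        have hle := Finset.card_filter_le (Finset.range n) fun v => st v = 2
        rw [Finset.card_range] at hle
        have hfree : ∀ v < n, st v ≠ 1 := by
          rcases hk with hk | hk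
          · intro v hv h1
            have := Finset.eq_of_subset_of_card_le (Finset.filter_subset (fun v => st v = 2)
              (Finset.range n)) (by rw [hk, Finset.card_range])
            rw [← Finset.mem_range, ← this, Finset.mem_filter] at hv
            omega
          · exact hk
        have hconn := hI.connected_iff hn hfree
        refine eq (by rw [hS.r4]; omega) (by rw [hS.r2]; omega) (nil ⟨?_, ?_, hS.adj, ?_, ?_⟩)
        · simp [hS.r2]
        · simp [hS.r3]
        · intro h
          simp [hS.r4, hS.r2, hconn.1 h]
        · intro h
          simp [hS.r4, hS.r2, mt hconn.2 h]
  refine key.mono ?_ fun _ => id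
  have e1 : n ≤ n ^ 2 := Nat.le_self_pow (by decide) n
  nlinarith

end

/-! ### Exact answers for a while, then a fixed answer -/

/-- Recompute the answer after every update until the counter in register `3` is exhausted, then
give a fixed answer for ever. The program `setup` moves `n` to register `2` and sets the counter,
`chk` computes the answer to register `4` from the adjacency matrix, and `dflt` puts the fixed
answer there. -/
def phaseAlg (setup chk dflt : Cmd) : DynAlg where
  pre := block [setup, chk]
  update := .ite 3 (block [.const 9 1, .op .sub 3 3 9, .op .mul 6 0 2, .op .add 6 6 1, .load 7 6,
    .op .sub 7 9 7, .store 6 7, chk]) dflt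
  query := mov 0 4

open Classical in
/-- The adjacency matrix as it is laid out in memory. -/
noncomputable def adjMatrix (P : DynProblem) (n : ℕ) (G : Finset (P.Pair n)) (a : ℕ) : ℕ :=
  if ∃ e ∈ G, a = ((P.ends n e).1 : ℕ) * n + ((P.ends n e).2 : ℕ) then 1 else 0

theorem adjMatrix_le_one (P : DynProblem) (n : ℕ) (G : Finset (P.Pair n)) (a : ℕ) :
    adjMatrix P n G a ≤ 1 := by
  unfold adjMatrix
  split_ifs <;> simp

theorem mul_add_inj {n u v u' v' : ℕ} (hv : v < n) (hv' : v' < n) (h : u * n + v = u' * n + v') :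
    u = u' ∧ v = v' := by
  have hn : 0 < n := by omega
  have h1 := congrArg (· / n) h
  have h2 := congrArg (· % n) h
  simp only [Nat.mul_comm _ n, Nat.mul_add_div hn, Nat.mul_add_mod,
    Nat.div_eq_of_lt hv, Nat.div_eq_of_lt hv', Nat.mod_eq_of_lt hv, Nat.mod_eq_of_lt hv'] at h1 h2
  omega

theorem adjMatrix_ne_zero {P : DynProblem} {n : ℕ} {G : Finset (P.Pair n)} (u v : Fin n) :
    adjMatrix P n G (u * n + v) ≠ 0 ↔ ∃ e ∈ G, P.ends n e = (u, v) := by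
  unfold adjMatrix
  simp only [ne_eq, ite_eq_right_iff, one_ne_zero, imp_false, not_not]
  refine exists_congr fun e => and_congr_right fun _ => ⟨fun h => ?_, fun h => by simp [h]⟩
  obtain ⟨h1, h2⟩ := mul_add_inj v.2 (P.ends n e).2.2 h
  exact Prod.ext (Fin.ext h1.symm) (Fin.ext h2.symm)

theorem adjMatrix_flip {P : DynProblem} {n : ℕ} (hinj : Function.Injective (P.ends n))
    (G : Finset (P.Pair n)) (e : P.Pair n) (a : ℕ) :
    adjMatrix P n (G ∆ {e}) a =
      if a = ((P.ends n e).1 : ℕ) * n + ((P.ends n e).2 : ℕ) then 1 - adjMatrix P n G a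
      else adjMatrix P n G a := by
  have key : ∀ e' : P.Pair n, ((P.ends n e).1 : ℕ) * n + ((P.ends n e).2 : ℕ) =
      ((P.ends n e').1 : ℕ) * n + ((P.ends n e').2 : ℕ) → e' = e := by
    intro e' h
    obtain ⟨h1, h2⟩ := mul_add_inj (P.ends n e).2.2 (P.ends n e').2.2 h
    exact hinj (Prod.ext (Fin.ext h1.symm) (Fin.ext h2.symm))
  unfold adjMatrix
  by_cases ha : a = ((P.ends n e).1 : ℕ) * n + ((P.ends n e).2 : ℕ)
  · have hiff : ∀ G' : Finset (P.Pair n), (∃ e' ∈ G',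
        a = ((P.ends n e').1 : ℕ) * n + ((P.ends n e').2 : ℕ)) ↔ e ∈ G' := fun G' =>
      ⟨fun ⟨e', h, h'⟩ => key e' (ha ▸ h') ▸ h, fun h => ⟨e, h, ha⟩⟩
    simp only [hiff, if_pos ha]
    by_cases he : e ∈ G <;> simp [he, Finset.mem_symmDiff]
  · rw [if_neg ha]
    refine if_congr (exists_congr fun e' => ?_) rfl rfl
    by_cases he : e' = e
    · subst he; simp [ha]
    · simp [Finset.mem_symmDiff, he]

/-- The edge set after a list of flips. -/
def applyFlips {E : Type} [DecidableEq E] (G : Finset E) (l : List E) : Finset E :=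
  l.foldl (fun G e => G ∆ {e}) G

/-- What is required of the constituents of `phaseAlg`: correctness, and running time `tc` of the
exact computation. -/
structure PhaseSpec (P : DynProblem) (w n tc d : ℕ) (chk dflt : Cmd) : Prop where
  ends_inj : Function.Injective (P.ends n)
  word : n * n < 2 ^ w
  answer_lt : ∀ G, P.answer n G < 2 ^ w
  default_lt : d < 2 ^ w
  check : ∀ (G : Finset (P.Pair n)) (c : ℕ) (σ : NatState), σ.reg 2 = n → σ.reg 3 = c →
    (∀ a < n * n, σ.mem a = adjMatrix P n G a) → Runs w chk σ tc fun σ' => σ'.reg 2 = n ∧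
      σ'.reg 3 = c ∧ (∀ a < n * n, σ'.mem a = adjMatrix P n G a) ∧ σ'.reg 4 = P.answer n G
  default : ∀ σ : NatState, σ.reg 2 = n → Runs w dflt σ 2 fun σ' => σ'.reg 2 = n ∧
    σ'.reg 3 = σ.reg 3 ∧ σ'.reg 4 = d

section

variable {P : DynProblem} {w n tc d : ℕ} {setup chk dflt : Cmd}

/-- Answering a query. -/
theorem serve_ask {ops : List (Option (P.Pair n))} {σ : NatState} {tu tq y : ℕ} {out : List ℕ}
    (h4 : σ.reg 4 = y) (hy : y < 2 ^ w)
    (h : (phaseAlg setup chk dflt).Serve P n ops ((σ.set 0 y).toMachine w) tu tq out) :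
    (phaseAlg setup chk dflt).Serve P n (none :: ops) (σ.toMachine w) tu (1 + tq) (y :: out) := by
  have h1 : (phaseAlg setup chk dflt).query.Exec (σ.toMachine w) ((σ.set 0 y).toMachine w) 1 := by
    have := Exec.op (σ.toMachine w) .or 0 4 4
    rw [NatState.toMachine_set]
    change (Cmd.op .or 0 4 4).Exec _ _ 1
    simpa [BinOp.eval, NatState.toMachine, h4] using this
  have := DynAlg.Serve.ask h1 h
  simpa [NatState.toMachine, Nat.mod_eq_of_lt hy] using this

/-- Serving operations when the counter is exhausted. -/
theorem serve_done (hspec : PhaseSpec P w n tc d chk dflt) (ops : List (Option (P.Pair n)))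
    (G : Finset (P.Pair n)) (σ : NatState) (h2 : σ.reg 2 = n) (h3 : σ.reg 3 = 0)
    (h4 : σ.reg 4 = d) :
    ∃ tu tq out, (phaseAlg setup chk dflt).Serve P n ops (σ.toMachine w) tu tq out ∧
      tu ≤ 3 * (ops.filterMap id).length ∧ tq ≤ ops.countP Option.isNone ∧
      ((∀ r ≤ (ops.filterMap id).length,
          P.answer n (applyFlips G ((ops.filterMap id).take r)) = d) →
        out = P.correctAnswers n G ops) := by
  induction ops generalizing G σ with
  | nil => exact ⟨0, 0, [], .nil _, by simp, by simp, fun _ => rfl⟩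
  | cons o ops ih =>
    cases o with
    | none =>
      obtain ⟨tu, tq, out, h5, h6, h7, h8⟩ := ih G (σ.set 0 d) (by simpa using h2)
        (by simpa using h3) (by simpa using h4)
      refine ⟨tu, 1 + tq, _, serve_ask h4 hspec.default_lt h5, by simpa using h6, ?_, fun h => ?_⟩
      · simp; omega
      · simp only [List.filterMap_cons_none, id_eq] at h
        rw [h8 h, DynProblem.correctAnswers]
        congr 1
        simpa [applyFlips] using (h 0 (by simp)).symm
    | some e =>
      obtain ⟨σ', s, h9, h10, h11, h12, h13⟩ :=
        hspec.default ((σ.set 0 (P.ends n e).1).set 1 (P.ends n e).2) (by simpa using h2)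
      obtain ⟨tu, tq, out, h5, h6, h7, h8⟩ := ih (G ∆ {e}) σ' h11 (by simpa [h3] using h12) h13
      refine ⟨s + 1 + tu, tq, out, .change (Exec.ite_false ?_ ?_) h5, ?_, by simpa using h7,
        fun h => ?_⟩
      · simp [Machine.setReg, NatState.toMachine, h3, Function.update]
      · rwa [NatState.toMachine_set, NatState.toMachine_set] at h9
      · rw [List.filterMap_cons_some (f := id) rfl, List.length_cons]; omega
      · rw [DynProblem.correctAnswers]
        refine h8 fun r hr => ?_
        simpa [applyFlips] using h (r + 1) (by simpa using hr)

/-- Serving operations when the counter is at `m`. -/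
theorem serve_phase (hspec : PhaseSpec P w n tc d chk dflt) (ops : List (Option (P.Pair n)))
    (m : ℕ) (hm : m < 2 ^ w) (G : Finset (P.Pair n)) (σ : NatState) (h2 : σ.reg 2 = n)
    (h3 : σ.reg 3 = m) (h4 : σ.reg 4 = P.answer n G)
    (hG : ∀ a < n * n, σ.mem a = adjMatrix P n G a) :
    ∃ tu tq out, (phaseAlg setup chk dflt).Serve P n ops (σ.toMachine w) tu tq out ∧
      tu ≤ m * (tc + 10) + 3 * (ops.filterMap id).length ∧ tq ≤ ops.countP Option.isNone ∧
      ((∀ r, m < r → r ≤ (ops.filterMap id).length →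
          P.answer n (applyFlips G ((ops.filterMap id).take r)) = d) →
        out = P.correctAnswers n G ops) := by
  induction ops generalizing m G σ with
  | nil => exact ⟨0, 0, [], .nil _, by simp, by simp, fun _ => rfl⟩
  | cons o ops ih =>
    cases o with
    | none =>
      obtain ⟨tu, tq, out, h5, h6, h7, h8⟩ := ih m hm G (σ.set 0 (P.answer n G))
        (by simpa using h2) (by simpa using h3) (by simpa using h4) (by simpa using hG)
      refine ⟨tu, 1 + tq, _, serve_ask h4 (hspec.answer_lt G) h5, by simpa using h6, ?_,
        fun h => ?_⟩
      · simp; omega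
      · simp only [List.filterMap_cons_none, id_eq] at h
        rw [h8 h, DynProblem.correctAnswers]
    | some e =>
      rcases Nat.eq_zero_or_pos m with rfl | hm0
      · obtain ⟨σ', s, h9, h10, h11, h12, h13⟩ :=
          hspec.default ((σ.set 0 (P.ends n e).1).set 1 (P.ends n e).2) (by simpa using h2)
        obtain ⟨tu, tq, out, h5, h6, h7, h8⟩ :=
          serve_done hspec ops (G ∆ {e}) σ' h11 (by simpa [h3] using h12) h13
        refine ⟨s + 1 + tu, tq, out, .change (Exec.ite_false ?_ ?_) h5, ?_, by simpa using h7,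
          fun h => ?_⟩
        · simp [Machine.setReg, NatState.toMachine, h3, Function.update]
        · rwa [NatState.toMachine_set, NatState.toMachine_set] at h9
        · rw [List.filterMap_cons_some (f := id) rfl, List.length_cons]; omega
        · rw [DynProblem.correctAnswers]
          refine h8 fun r hr => ?_
          simpa [applyFlips] using h (r + 1) (by omega) (by simpa using hr)
      · have hA := adjMatrix_le_one P n G
          (((P.ends n e).1 : ℕ) * n + ((P.ends n e).2 : ℕ))
        have hlt := mul_add_lt_mul_self (P.ends n e).1.2 (P.ends n e).2.2
        set i := ((P.ends n e).1 : ℕ) * n + ((P.ends n e).2 : ℕ) with hi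
        have hiw := hlt.trans hspec.word
        obtain ⟨σ', s, h9, h10, h11, h12, h13, h14⟩ : Runs w (block [.const 9 1, .op .sub 3 3 9,
            .op .mul 6 0 2, .op .add 6 6 1, .load 7 6, .op .sub 7 9 7, .store 6 7, chk])
            ((σ.set 0 (P.ends n e).1).set 1 (P.ends n e).2) (tc + 1 + 7) fun σ' => σ'.reg 2 = n ∧
              σ'.reg 3 = m - 1 ∧ (∀ a < n * n, σ'.mem a = adjMatrix P n (G ∆ {e}) a) ∧
              σ'.reg 4 = P.answer n (G ∆ {e}) := by
          refine const (sub (by simp [h3]; omega) (mul (add_eq i (by simp [hi, h2]) (load_eq i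
            (adjMatrix P n G i) (by simp) hiw (by simpa using hG i hlt) (sub (by simpa using hA)
            (store_eq i (1 - adjMatrix P n G i) (by simp) hiw (by simp) (cons
            (t := tc) (t' := 1) ?_)))))))
          refine (hspec.check (G ∆ {e}) (m - 1) _ (by simpa using h2) (by simp [h3]) ?_).mono le_rfl
            fun _ h => nil (t := 0) h
          intro a ha
          rw [adjMatrix_flip hspec.ends_inj, ← hi]
          by_cases hai : a = i
          · simp [hai]
          · simpa [hai] using hG a ha
        obtain ⟨tu, tq, out, h5, h6, h7, h8⟩ := ih (m - 1) (by omega) (G ∆ {e}) σ' h11 h12 h14 h13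
        refine ⟨s + 1 + tu, tq, out, .change (Exec.ite_true ?_ ?_) h5, ?_, by simpa using h7,
          fun h => ?_⟩
        · rw [← NatState.toMachine_set, ← NatState.toMachine_set]
          change BitVec.ofNat w _ ≠ 0
          rw [ofNat_ne_zero (by simpa [h3] using hm)]
          simp [h3]
          omega
        · rwa [NatState.toMachine_set, NatState.toMachine_set] at h9
        · obtain ⟨k, rfl⟩ := Nat.exists_eq_succ_of_ne_zero hm0.ne'
          rw [List.filterMap_cons_some (f := id) rfl, List.length_cons]
          simp only [Nat.succ_eq_add_one, Nat.add_sub_cancel] at h6 ⊢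
          nlinarith
        · rw [DynProblem.correctAnswers]
          refine h8 fun r hr hr' => ?_
          simpa [applyFlips] using h (r + 1) (by omega) (by simpa using hr')

end

theorem filterMap_opSequence {E : Type} {T : ℕ} (q : ℕ → ℕ) (x : Fin T → E) :
    (opSequence q x).filterMap id = List.ofFn x := by
  simp [opSequence, List.filterMap_append, List.filterMap_flatMap, List.ofFn_eq_map]
  exact List.flatMap_pure_eq_map _ _

theorem countP_opSequence {E : Type} {T : ℕ} (q : ℕ → ℕ) (x : Fin T → E) :
    (opSequence q x).countP Option.isNone = ∑ r ∈ Finset.range (T + 1), q r := by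
  rw [Finset.sum_range_succ', opSequence, List.countP_append, List.countP_flatMap]
  simp [List.countP_replicate, Function.comp_def]
  rw [Nat.add_comm, ← List.ofFn_eq_map, List.sum_ofFn,
    Fin.sum_univ_eq_sum_range (fun i => q (i + 1))]

/-- The configuration in which preprocessing starts. -/
noncomputable def startState (P : DynProblem) (n R : ℕ) (G₀ : Finset (P.Pair n)) : NatState where
  reg r := if r = 0 then n else if r = 1 then R else 0
  mem := adjMatrix P n G₀

theorem startState_toMachine (P : DynProblem) (w n R : ℕ) (G₀ : Finset (P.Pair n)) :
    (startState P n R G₀).toMachine w = startMachine w P n R G₀ := by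
  simp only [startState, NatState.toMachine, startMachine, Machine.mk.injEq]
  refine ⟨funext fun r => ?_, funext fun a => ?_⟩
  · split_ifs <;> rfl
  · unfold adjMatrix
    split_ifs <;> rfl

/-- The run of `phaseAlg`: the time is as claimed whatever happens, and the answers are right if
the fixed answer is right at all times after the phase of length `L`. -/
theorem phaseAlg_run {P : DynProblem} {w n tc d ts L R T : ℕ} {setup chk dflt : Cmd}
    (hspec : PhaseSpec P w n tc d chk dflt) (hL : L < 2 ^ w) (G₀ : Finset (P.Pair n))
    (hsetup : Runs w setup (startState P n R G₀) ts fun σ => σ.reg 2 = n ∧ σ.reg 3 = L ∧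
      ∀ a < n * n, σ.mem a = adjMatrix P n G₀ a) (q : ℕ → ℕ) (x : Fin T → P.Pair n) :
    ∃ tp tu tq out, (phaseAlg setup chk dflt).Run P w n R G₀ (opSequence q x) tp tu tq out ∧
      tp + tu ≤ (ts + tc + 1) + (L * (tc + 10) + 3 * T) ∧
      tq ≤ ∑ r ∈ Finset.range (T + 1), q r ∧
      ((∀ r, L < r → r ≤ T → P.answer n (applyFlips G₀ ((List.ofFn x).take r)) = d) →
        out = P.correctAnswers n G₀ (opSequence q x)) := by
  obtain ⟨σ, tp, h1, h2, h3, h4, h5, h6⟩ : Runs w (block [setup, chk]) (startState P n R G₀)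
      (ts + (tc + 1)) fun σ => σ.reg 2 = n ∧ σ.reg 3 = L ∧
        (∀ a < n * n, σ.mem a = adjMatrix P n G₀ a) ∧ σ.reg 4 = P.answer n G₀ := by
    refine cons (hsetup.mono le_rfl fun σ ⟨g1, g2, g3⟩ => cons (t := tc) (t' := 1) ?_)
    exact (hspec.check G₀ L σ g1 g2 g3).mono le_rfl fun _ h => nil (t := 0) h
  obtain ⟨tu, tq, out, g1, g2, g3, g4⟩ :=
    serve_phase (setup := setup) hspec (opSequence q x) L hL G₀ σ h3 h4 h6 h5
  rw [filterMap_opSequence, List.length_ofFn] at g2 g4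
  rw [countP_opSequence] at g3
  refine ⟨tp, tu, tq, out, ⟨_, ?_, g1⟩, by omega, g3, g4⟩
  rwa [startState_toMachine] at h1

/-! ### Random flips -/

section

variable {E : Type} [DecidableEq E]

/-- The sign of `y` in `G`: `-1` if `y ∈ G`, and `1` otherwise. -/
def memSign (G : Finset E) (y : E) : ℝ := if y ∈ G then -1 else 1

theorem abs_memSign (G : Finset E) (y : E) : |memSign G y| = 1 := by
  unfold memSign
  split_ifs <;> simp

theorem memSign_symmDiff_singleton (G : Finset E) (e y : E) :
    memSign (G ∆ {e}) y = memSign G y * memSign {e} y := by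
  by_cases h : y = e <;> by_cases h' : y ∈ G <;> simp_all [memSign, Finset.mem_symmDiff]

theorem memSign_applyFlips (G : Finset E) (l : List E) (y : E) :
    memSign (applyFlips G l) y = memSign G y * (l.map fun e => memSign {e} y).prod := by
  induction l generalizing G with
  | nil => simp [applyFlips]
  | cons e l ih =>
    have : applyFlips G (e :: l) = applyFlips (G ∆ {e}) l := rfl
    rw [this, ih, memSign_symmDiff_singleton, List.map_cons, List.prod_cons, mul_assoc]

theorem prod_memSign_singleton (A : Finset E) (e : E) :
    ∏ y ∈ A, memSign {e} y = memSign A e := by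
  simp only [memSign, Finset.mem_singleton]
  rw [Finset.prod_ite_eq' A e fun _ => (-1 : ℝ)]

/-- The characters of the group of edge sets, evaluated at the graph after `r` flips. -/
theorem prod_memSign_take {T : ℕ} (G₀ : Finset E) (x : Fin T → E) (r : ℕ) (A : Finset E) :
    ∏ y ∈ A, memSign (applyFlips G₀ ((List.ofFn x).take r)) y =
      (∏ y ∈ A, memSign G₀ y) * ∏ i : Fin T, if (i : ℕ) < r then memSign A (x i) else 1 := by
  simp only [memSign_applyFlips, Finset.prod_mul_distrib]
  congr 1
  have : ∀ y, (((List.ofFn x).take r).map fun e => memSign {e} y).prod =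
      ∏ i : Fin T, if (i : ℕ) < r then memSign {x i} y else 1 := by
    intro y
    rw [List.map_take, List.map_ofFn, List.prod_take_ofFn, Finset.prod_filter]
    rfl
  simp only [this]
  rw [Finset.prod_comm]
  refine Finset.prod_congr rfl fun i _ => ?_
  split_ifs
  · exact prod_memSign_singleton A (x i)
  · simp

/-- The indicator of disjointness as an average of characters. -/
theorem indicator_disjoint (G B : Finset E) :
    (if Disjoint G B then (1 : ℝ) else 0) =
      (1 / 2) ^ B.card * ∑ A ∈ B.powerset, ∏ y ∈ A, memSign G y := by
  rw [← Finset.prod_one_add, ← Finset.prod_const, ← Finset.prod_mul_distrib]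
  have : ∀ y ∈ B, (1 / 2) * (1 + memSign G y) = if y ∉ G then (1 : ℝ) else 0 := by
    intro y _
    unfold memSign
    split_ifs <;> norm_num
  rw [Finset.prod_congr rfl this, Finset.prod_ite_zero]
  simp only [Finset.prod_const_one]
  refine if_congr ?_ rfl rfl
  rw [disjoint_comm, Finset.disjoint_left]

variable [Fintype E]

/-- The probability that the flip intended as `e` is `z`. -/
noncomputable def flipProb (p : ℝ) (e z : E) : ℝ :=
  p * (if z = e then 1 else 0) + (1 - p) * (1 / (Fintype.card E : ℝ))

theorem flipProb_nonneg {p : ℝ} (hp0 : 0 ≤ p) (hp1 : p ≤ 1) (e z : E) : 0 ≤ flipProb p e z := by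
  have : 0 ≤ 1 - p := by linarith
  unfold flipProb
  split_ifs <;> positivity

theorem sum_flipProb_mul {p : ℝ} (e : E) (f : E → ℝ) :
    ∑ z, flipProb p e z * f z = p * f e + (1 - p) * ((∑ z, f z) / Fintype.card E) := by
  simp only [flipProb, add_mul, Finset.sum_add_distrib]
  congr 1
  · simp
  · rw [← Finset.mul_sum]; ring

theorem sum_flipProb {p : ℝ} (e : E) : ∑ z, flipProb p e z = 1 := by
  have h : (Fintype.card E : ℝ) ≠ 0 := by
    have : Nonempty E := ⟨e⟩
    exact_mod_cast Fintype.card_ne_zero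
  have := sum_flipProb_mul (p := p) e fun _ => 1
  simp only [mul_one, Finset.sum_const, Finset.card_univ, nsmul_eq_mul, div_self h] at this
  linarith

/-- A character that involves `A` pairs shrinks by this factor in every round. -/
theorem abs_sum_flipProb_memSign_le {p : ℝ} (hp0 : 0 ≤ p) (hp1 : p ≤ 1) (e : E) {A : Finset E}
    (hA : 2 * A.card ≤ Fintype.card E) :
    |∑ z, flipProb p e z * memSign A z| ≤
      Real.exp (-2 * (1 - p) / Fintype.card E) ^ A.card := by
  have hN : (0 : ℝ) < Fintype.card E := by
    have : Nonempty E := ⟨e⟩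
    exact_mod_cast Fintype.card_pos
  have hA' : (2 : ℝ) * A.card ≤ Fintype.card E := by exact_mod_cast hA
  have hsum : ∑ z, memSign A z = Fintype.card E - 2 * A.card := by
    have : ∀ z, memSign A z = 1 - 2 * if z ∈ A then 1 else 0 := by
      intro z; unfold memSign; split_ifs <;> norm_num
    simp only [this, Finset.sum_sub_distrib, ← Finset.mul_sum]
    simp
  have h1 : 0 ≤ (Fintype.card E - 2 * A.card : ℝ) / Fintype.card E := by
    apply div_nonneg <;> linarith
  rw [sum_flipProb_mul, hsum, ← Real.exp_nat_mul]
  refine (abs_add_le _ _).trans ?_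
  rw [abs_mul, abs_mul, abs_memSign, abs_of_nonneg hp0, abs_of_nonneg (sub_nonneg.2 hp1),
    abs_of_nonneg h1]
  refine le_trans (le_of_eq ?_) (Real.add_one_le_exp _)
  field_simp
  ring

/-- Whatever the initial graph and the intended flips, `m` given pairs are absent after `r` rounds
with at most the probability that `m` independent Poisson processes, of rate `(1 - p) / N` per round
where `N` is the number of pairs, all have an even number of points. -/
theorem sum_flipProb_disjoint_le {p : ℝ} (hp0 : 0 ≤ p) (hp1 : p ≤ 1) {T : ℕ} (e : Fin T → E)
    (G₀ : Finset E) {r : ℕ} (hr : r ≤ T) {B : Finset E} (hB : 2 * B.card ≤ Fintype.card E) :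
    ∑ x : Fin T → E, (∏ i, flipProb p (e i) (x i)) *
        (if Disjoint (applyFlips G₀ ((List.ofFn x).take r)) B then 1 else 0) ≤
      ((1 + Real.exp (-2 * (1 - p) / Fintype.card E) ^ r) / 2) ^ B.card := by
  set θ := Real.exp (-2 * (1 - p) / Fintype.card E) with hθ
  have key : ∀ A ∈ B.powerset, ∑ x : Fin T → E, (∏ i, flipProb p (e i) (x i)) *
      ∏ y ∈ A, memSign (applyFlips G₀ ((List.ofFn x).take r)) y ≤ (θ ^ r) ^ A.card := by
    intro A hA
    have hA' : 2 * A.card ≤ Fintype.card E :=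
      (Nat.mul_le_mul_left 2 (Finset.card_le_card (Finset.mem_powerset.1 hA))).trans hB
    have h1 : ∀ x : Fin T → E, (∏ i, flipProb p (e i) (x i)) *
        ∏ y ∈ A, memSign (applyFlips G₀ ((List.ofFn x).take r)) y =
        (∏ y ∈ A, memSign G₀ y) * ∏ i : Fin T, flipProb p (e i) (x i) *
          if (i : ℕ) < r then memSign A (x i) else 1 := by
      intro x
      rw [prod_memSign_take, Finset.prod_mul_distrib]
      ring
    simp only [h1]
    rw [← Finset.mul_sum]
    rw [← Fintype.prod_sum fun (i : Fin T) z => flipProb p (e i) z *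
          if (i : ℕ) < r then memSign A z else 1]
    refine (le_abs_self _).trans ?_
    rw [abs_mul, Finset.abs_prod, Finset.abs_prod]
    simp only [abs_memSign, Finset.prod_const_one, one_mul]
    have h2 : ∀ i : Fin T, |∑ z, flipProb p (e i) z * if (i : ℕ) < r then memSign A z else 1| ≤
        if (i : ℕ) < r then θ ^ A.card else 1 := by
      intro i
      split_ifs
      · exact abs_sum_flipProb_memSign_le hp0 hp1 (e i) hA'
      · simp [sum_flipProb]
    refine (Finset.prod_le_prod (fun i _ => abs_nonneg _) fun i _ => h2 i).trans (le_of_eq ?_)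
    rw [← Finset.prod_filter, Finset.prod_const, ← pow_mul, ← pow_mul, mul_comm]
    congr 2
    have := Fin.card_filter_val_lt (n := T) (m := r)
    simpa [hr] using this
  simp only [indicator_disjoint]
  calc _ = (1 / 2) ^ B.card * ∑ A ∈ B.powerset, ∑ x : Fin T → E, (∏ i, flipProb p (e i) (x i)) *
        ∏ y ∈ A, memSign (applyFlips G₀ ((List.ofFn x).take r)) y := by
        rw [Finset.sum_comm, Finset.mul_sum]
        refine Finset.sum_congr rfl fun x _ => ?_
        rw [← Finset.mul_sum]
        ring
    _ ≤ (1 / 2) ^ B.card * ∑ A ∈ B.powerset, (θ ^ r) ^ A.card := by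
        gcongr with A hA
        exact key A hA
    _ = _ := by
        have := Finset.sum_pow_mul_eq_add_pow (θ ^ r) 1 B
        simp only [one_pow, mul_one] at this
        rw [this, ← mul_pow]
        congr 1
        ring

/-- The distribution of the initial graph is a probability distribution. -/
theorem sum_initial_prob (p : ℝ) (H₀ : Finset E) :
    ∑ G₀ : Finset E, ∏ y : E, (p * (if y ∈ G₀ ↔ y ∈ H₀ then 1 else 0) + (1 - p) * (1 / 2)) = 1 := by
  have h := Finset.prod_add (fun y : E => p * (if y ∈ H₀ then 1 else 0) + (1 - p) * (1 / 2))
    (fun y => p * (if y ∉ H₀ then 1 else 0) + (1 - p) * (1 / 2)) Finset.univ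
  rw [Finset.powerset_univ] at h
  rw [← Finset.prod_const_one (s := (Finset.univ : Finset E)) (M := ℝ)]
  refine Eq.trans (Finset.sum_congr rfl fun G₀ _ => ?_) (h.symm.trans
    (Finset.prod_congr rfl fun y _ => ?_))
  · rw [← Finset.prod_mul_prod_compl G₀, Finset.compl_eq_univ_sdiff]
    congr 1
    · refine Finset.prod_congr rfl fun y hy => ?_
      simp [hy]
    · refine Finset.prod_congr rfl fun y hy => ?_
      simp only [Finset.mem_sdiff, Finset.mem_univ, true_and] at hy
      simp [hy]
  · split_ifs <;> ring

/-- If the event happens whenever the graph meets all sets `B j` at all times after `L`, then its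
probability is bounded below by a union bound. -/
theorem le_smoothedProb {p : ℝ} (hp0 : 0 ≤ p) (hp1 : p ≤ 1) {T L : ℕ} (H₀ : Finset E)
    (e : Fin T → E) {ι : Type*} (J : Finset ι) (B : ι → Finset E)
    (hB : ∀ j ∈ J, 2 * (B j).card ≤ Fintype.card E) {ε : ℝ}
    (hε : Real.exp (-2 * (1 - p) / Fintype.card E) ^ L ≤ ε)
    {event : Finset E → (Fin T → E) → Prop}
    (hevent : ∀ G₀ x, (∀ r, L < r → r ≤ T → ∀ j ∈ J,
      ¬ Disjoint (applyFlips G₀ ((List.ofFn x).take r)) (B j)) → event G₀ x) :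
    1 - T * ∑ j ∈ J, ((1 + ε) / 2) ^ (B j).card ≤ smoothedProb p H₀ e event := by
  classical
  set θ := Real.exp (-2 * (1 - p) / Fintype.card E) with hθ
  have hθ0 : 0 ≤ θ := (Real.exp_pos _).le
  have hθ1 : θ ≤ 1 := by
    rw [hθ, Real.exp_le_one_iff]
    apply div_nonpos_of_nonpos_of_nonneg
    · nlinarith
    · positivity
  have hε0 : 0 ≤ ε := le_trans (by positivity) hε
  set a : Finset E → ℝ := fun G₀ =>
    ∏ y : E, (p * (if y ∈ G₀ ↔ y ∈ H₀ then 1 else 0) + (1 - p) * (1 / 2)) with ha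
  have ha0 : ∀ G₀, 0 ≤ a G₀ := by
    intro G₀
    refine Finset.prod_nonneg fun y _ => ?_
    have : 0 ≤ 1 - p := by linarith
    split_ifs <;> positivity
  have ha1 : ∑ G₀, a G₀ = 1 := by
    rw [← sum_initial_prob p H₀]
  set b : (Fin T → E) → ℝ := fun x => ∏ i, flipProb p (e i) (x i) with hb
  have hb0 : ∀ x, 0 ≤ b x := fun x => Finset.prod_nonneg fun i _ => flipProb_nonneg hp0 hp1 _ _
  have hb1 : ∑ x, b x = 1 := by
    rw [hb, ← Fintype.prod_sum fun (i : Fin T) z => flipProb p (e i) z]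
    simp [sum_flipProb]
  have hprob : smoothedProb p H₀ e event = ∑ G₀, a G₀ * ∑ x, b x * if event G₀ x then 1 else 0 := by
    unfold smoothedProb
    refine Finset.sum_congr rfl fun G₀ _ => ?_
    rw [Finset.mul_sum]
    refine Finset.sum_congr rfl fun x _ => ?_
    rw [mul_ite, mul_ite, mul_zero, mul_zero, mul_one]
    refine if_congr Iff.rfl ?_ rfl
    simp only [ha, hb, flipProb]
    congr!
  rw [hprob]
  have hinner : ∀ G₀, 1 - T * ∑ j ∈ J, ((1 + ε) / 2) ^ (B j).card ≤
      ∑ x, b x * if event G₀ x then 1 else 0 := by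
    intro G₀
    set D : ℕ → ι → (Fin T → E) → ℝ := fun r j x =>
      if Disjoint (applyFlips G₀ ((List.ofFn x).take r)) (B j) then 1 else 0 with hD
    have hpt : ∀ x, 1 - ∑ r ∈ Finset.Ioc L T, ∑ j ∈ J, D r j x ≤
        if event G₀ x then 1 else 0 := by
      intro x
      have hD0 : ∀ r j, 0 ≤ D r j x := by
        intro r j; simp only [hD]; split_ifs <;> norm_num
      split_ifs with hx
      · have : 0 ≤ ∑ r ∈ Finset.Ioc L T, ∑ j ∈ J, D r j x :=
          Finset.sum_nonneg fun r _ => Finset.sum_nonneg fun j _ => hD0 r j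
        linarith
      · have hx' := mt (hevent G₀ x) hx
        push Not at hx'
        obtain ⟨r, hr1, hr2, j, hj, hdis⟩ := hx'
        have h1 : D r j x = 1 := by simp only [hD, if_pos hdis]
        have h2 := Finset.single_le_sum (fun j _ => hD0 r j) hj
        have h3 := Finset.single_le_sum (f := fun r => ∑ j ∈ J, D r j x)
          (fun r _ => Finset.sum_nonneg fun j _ => hD0 r j) (Finset.mem_Ioc.2 ⟨hr1, hr2⟩)
        linarith
    calc 1 - T * ∑ j ∈ J, ((1 + ε) / 2) ^ (B j).card
        ≤ 1 - ∑ r ∈ Finset.Ioc L T, ∑ j ∈ J, ((1 + ε) / 2) ^ (B j).card := by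
          rw [Finset.sum_const, nsmul_eq_mul]
          gcongr
          simp
      _ ≤ 1 - ∑ r ∈ Finset.Ioc L T, ∑ j ∈ J, ∑ x, b x * D r j x := by
          gcongr with r hr j hj
          rw [Finset.mem_Ioc] at hr
          refine (sum_flipProb_disjoint_le hp0 hp1 e G₀ hr.2 (hB j hj)).trans ?_
          gcongr
          exact (pow_le_pow_of_le_one hθ0 hθ1 hr.1.le).trans hε
      _ = ∑ x, b x * (1 - ∑ r ∈ Finset.Ioc L T, ∑ j ∈ J, D r j x) := by
          simp only [mul_sub, mul_one, Finset.sum_sub_distrib, hb1, Finset.mul_sum]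
          congr 1
          symm
          rw [Finset.sum_comm]
          exact Finset.sum_congr rfl fun r _ => Finset.sum_comm
      _ ≤ _ := Finset.sum_le_sum fun x _ => mul_le_mul_of_nonneg_left (hpt x) (hb0 x)
  calc 1 - T * ∑ j ∈ J, ((1 + ε) / 2) ^ (B j).card
      = ∑ G₀, a G₀ * (1 - T * ∑ j ∈ J, ((1 + ε) / 2) ^ (B j).card) := by
        rw [← Finset.sum_mul, ha1, one_mul]
    _ ≤ _ := Finset.sum_le_sum fun G₀ _ => mul_le_mul_of_nonneg_left (hinner G₀) (ha0 G₀)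

end

/-! ### Obstructions to perfect matchings and to connectivity -/

/-- A choice of subsets of a prescribed size. -/
theorem exists_subset_choice {ι α : Type*} (s : ι → Finset α) (k : ι → ℕ) :
    ∃ f : ι → Finset α, ∀ i, k i ≤ (s i).card → f i ⊆ s i ∧ (f i).card = k i := by
  classical
  have : ∀ i, ∃ t : Finset α, k i ≤ (s i).card → t ⊆ s i ∧ t.card = k i := by
    intro i
    by_cases h : k i ≤ (s i).card
    · obtain ⟨t, ht⟩ := Finset.exists_subset_card_eq h
      exact ⟨t, fun _ => ht⟩
    · exact ⟨∅, fun h' => absurd h' h⟩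
  choose f hf using this
  exact ⟨f, hf⟩

/-- By Hall's theorem, a bipartite graph without perfect matching misses all pairs between `I` and
the complement of `K`, on one side or the other, for sets with `K` smaller than `I` and `I` at most
(about) half of a side. -/
theorem exists_rectangle_of_no_injective {n : ℕ} (S : Finset (Fin n × Fin n))
    (h : ¬ ∃ f : Fin n → Fin n, Function.Injective f ∧ ∀ i, (i, f i) ∈ S) :
    ∃ I K : Finset (Fin n), K.card < I.card ∧ 2 * I.card ≤ n + 1 ∧
      ((∀ i ∈ I, ∀ j ∉ K, (i, j) ∉ S) ∨ ∀ i ∈ I, ∀ j ∉ K, (j, i) ∉ S) := by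
  have hall := (Finset.all_card_le_biUnion_card_iff_exists_injective
    fun i : Fin n => Finset.univ.filter fun j => (i, j) ∈ S).not.2 (by simpa using h)
  push Not at hall
  obtain ⟨I, hI⟩ := hall
  set K := I.biUnion fun i => Finset.univ.filter fun j => (i, j) ∈ S with hK
  have hIK : ∀ i ∈ I, ∀ j ∉ K, (i, j) ∉ S := by
    intro i hi j hj hij
    exact hj (Finset.mem_biUnion.2 ⟨i, hi, by simpa using hij⟩)
  by_cases h2 : 2 * I.card ≤ n + 1
  · exact ⟨I, K, hI, h2, .inl hIK⟩
  · have e1 := Finset.card_compl_add_card I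
    have e2 := Finset.card_compl_add_card K
    rw [Fintype.card_fin] at e1 e2
    -- on the other side, only `Iᶜ` can be adjacent to the nodes of a large subset of `Kᶜ`
    have h3 : Iᶜ.card + 1 ≤ Kᶜ.card := by omega
    obtain ⟨I', hI', hcard⟩ := Finset.exists_subset_card_eq h3
    refine ⟨I', Iᶜ, by omega, by omega, .inr fun i hi j hj => hIK j (by simpa using hj) i ?_⟩
    simpa using hI' hi

/-- Rectangles of a fixed width that obstruct perfect matchings. -/
theorem exists_bipartite_obstructions (n h : ℕ) (hn : 4 * h ≤ n) :
    ∃ B : Bool × Finset (Fin n) × Finset (Fin n) → Finset (Fin n × Fin n),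
      (∀ j ∈ Finset.univ.filter (fun j : Bool × Finset (Fin n) × Finset (Fin n) =>
          j.2.2.card < j.2.1.card ∧ 2 * j.2.1.card ≤ n + 1),
        2 * (B j).card ≤ Fintype.card (Fin n × Fin n) ∧ (B j).card = j.2.1.card * (2 * h)) ∧
      ∀ S : Finset (Fin n × Fin n),
        (∀ j ∈ Finset.univ.filter (fun j : Bool × Finset (Fin n) × Finset (Fin n) =>
          j.2.2.card < j.2.1.card ∧ 2 * j.2.1.card ≤ n + 1), ¬ Disjoint S (B j)) →
        ∃ f : Fin n → Fin n, Function.Injective f ∧ ∀ i, (i, f i) ∈ S := by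
  obtain ⟨g, hg⟩ := exists_subset_choice (fun K : Finset (Fin n) => Kᶜ) fun _ => 2 * h
  have hg' : ∀ I K : Finset (Fin n), K.card < I.card → 2 * I.card ≤ n + 1 →
      g K ⊆ Kᶜ ∧ (g K).card = 2 * h := by
    intro I K h1 h2
    refine hg K ?_
    have := Finset.card_compl_add_card K
    rw [Fintype.card_fin] at this
    omega
  refine ⟨fun j => if j.1 then j.2.1 ×ˢ g j.2.2 else g j.2.2 ×ˢ j.2.1, fun j hj => ?_,
    fun S hS => ?_⟩
  · obtain ⟨h1, h2⟩ := (Finset.mem_filter.1 hj).2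
    have hc : (if j.1 then j.2.1 ×ˢ g j.2.2 else g j.2.2 ×ˢ j.2.1).card =
        j.2.1.card * (2 * h) := by
      split_ifs
      · rw [Finset.card_product, (hg' _ _ h1 h2).2]
      · rw [Finset.card_product, (hg' _ _ h1 h2).2, Nat.mul_comm]
    refine ⟨?_, hc⟩
    rw [hc, Fintype.card_prod, Fintype.card_fin]
    nlinarith
  · by_contra hcon
    obtain ⟨I, K, h1, h2, h3⟩ := exists_rectangle_of_no_injective S hcon
    have hsub := (hg' I K h1 h2).1
    rcases h3 with h3 | h3
    · refine hS (true, I, K) (by simp [h1, h2]) (Finset.disjoint_left.2 ?_)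
      rintro ⟨i, j⟩ hij hB
      simp only [if_true, Finset.mem_product] at hB
      exact h3 i hB.1 j (by simpa using hsub hB.2) hij
    · refine hS (false, I, K) (by simp [h1, h2]) (Finset.disjoint_left.2 ?_)
      rintro ⟨j, i⟩ hij hB
      simp only [Bool.false_eq_true, if_false, Finset.mem_product] at hB
      exact h3 i hB.2 j (by simpa using hsub hB.1) hij

theorem sum_pow_card_eq {n : ℕ} (Y : ℝ) : ∑ S : Finset (Fin n), Y ^ S.card = (1 + Y) ^ n := by
  have := Fin.sum_pow_mul_eq_add_pow (n := n) Y 1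
  simpa [add_comm] using this

theorem one_add_pow_le {n : ℕ} {Y : ℝ} (hY : 0 ≤ Y) (hn : n * Y ≤ 1) :
    (1 + Y) ^ n ≤ 1 + 2 * (n * Y) := by
  have h1 : (1 + Y) ^ n ≤ Real.exp (n * Y) := by
    rw [Real.exp_nat_mul]
    gcongr
    linarith [Real.add_one_le_exp Y]
  refine h1.trans ?_
  have h0 : 0 ≤ n * Y := by positivity
  have := Real.abs_exp_sub_one_le (x := n * Y) (by rwa [abs_of_nonneg h0])
  rw [abs_of_nonneg h0] at this
  linarith [le_abs_self (Real.exp (n * Y) - 1)]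

theorem sum_bipartite_obstructions_le {n h : ℕ} {z : ℝ} (hz0 : 0 ≤ z) (hz1 : z ≤ 1)
    (hn : n * z ^ h ≤ 1) :
    ∑ j ∈ Finset.univ.filter (fun j : Bool × Finset (Fin n) × Finset (Fin n) =>
      j.2.2.card < j.2.1.card ∧ 2 * j.2.1.card ≤ n + 1), z ^ (j.2.1.card * (2 * h)) ≤
      12 * (n * z ^ h) := by
  classical
  set Y := z ^ h with hY
  have hY0 : 0 ≤ Y := by positivity
  have hY1 : Y ≤ 1 := pow_le_one₀ hz0 hz1
  have hpow := one_add_pow_le hY0 hn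
  have hsum : ∑ I ∈ (Finset.univ : Finset (Finset (Fin n))).erase ∅, Y ^ I.card =
      (1 + Y) ^ n - 1 := by
    rw [← sum_pow_card_eq, ← Finset.add_sum_erase _ _ (Finset.mem_univ (∅ : Finset (Fin n)))]
    simp
  calc _ ≤ ∑ j ∈ (Finset.univ : Finset Bool) ×ˢ
        ((Finset.univ : Finset (Finset (Fin n))).erase ∅ ×ˢ
          (Finset.univ : Finset (Finset (Fin n)))),
        Y ^ j.2.1.card * Y ^ j.2.2.card := by
        refine (Finset.sum_le_sum fun j hj => ?_).trans
          (Finset.sum_le_sum_of_subset_of_nonneg (fun j hj => ?_) fun _ _ _ => by positivity)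
        · have h1 := (Finset.mem_filter.1 hj).2.1
          rw [← pow_add, hY, ← pow_mul]
          refine pow_le_pow_of_le_one hz0 hz1 ?_
          rw [← Nat.mul_assoc, Nat.mul_comm _ h]
          exact Nat.mul_le_mul_left h (by omega)
        · have h1 := (Finset.mem_filter.1 hj).2.1
          simp only [Finset.mem_product, Finset.mem_univ, true_and, Finset.mem_erase, and_true]
          rintro h0
          simp [h0] at h1
    _ = 2 * (((1 + Y) ^ n - 1) * (1 + Y) ^ n) := by
        rw [Finset.sum_product, ← hsum, ← sum_pow_card_eq, Finset.sum_mul_sum]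
        simp only [Finset.sum_product]
        simp
        ring
    _ ≤ 2 * ((2 * (n * Y)) * 3) := by
        have : 1 ≤ (1 + Y) ^ n := one_le_pow₀ (by linarith)
        gcongr <;> linarith
    _ = _ := by ring

theorem nodePair_card_le (n : ℕ) : Fintype.card (NodePair n) ≤ n ^ 2 := by
  refine (Fintype.card_subtype_le _).trans ?_
  simp [sq]

theorem le_nodePair_card (n : ℕ) : n * (n - 1) ≤ 2 * Fintype.card (NodePair n) := by
  have h1 : ((Finset.univ : Finset (Fin n)).offDiag).card = n * (n - 1) := by
    rw [Finset.offDiag_card, Finset.card_univ, Fintype.card_fin, Nat.mul_sub_one]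
  have h2 : (Finset.univ : Finset (Bool × NodePair n)).card = 2 * Fintype.card (NodePair n) := by
    simp
  rw [← h1, ← h2]
  refine Finset.card_le_card_of_surjOn
    (fun e : Bool × NodePair n => if e.1 then e.2.1 else e.2.1.swap) ?_
  rintro ⟨u, v⟩ huv
  have huv : u ≠ v := by simpa using huv
  rcases lt_or_gt_of_ne huv with h | h
  · exact ⟨(true, ⟨(u, v), h⟩), by simp⟩
  · exact ⟨(false, ⟨(v, u), h⟩), by simp⟩

/-- The pairs with exactly one node in `S`. -/
def nodeCut {n : ℕ} (S : Finset (Fin n)) : Finset (NodePair n) :=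
  Finset.univ.filter fun e => ¬ (e.1.1 ∈ S ↔ e.1.2 ∈ S)

theorem card_mul_le_card_nodeCut {n : ℕ} (S : Finset (Fin n)) :
    S.card * Sᶜ.card ≤ (nodeCut S).card := by
  rw [← Finset.card_product]
  refine Finset.card_le_card_of_surjOn
    (fun e : NodePair n => if e.1.1 ∈ S then e.1 else e.1.swap) ?_
  rintro ⟨u, v⟩ huv
  simp only [Finset.coe_product, Set.mem_prod, Finset.mem_coe, Finset.mem_compl] at huv
  have hne : u ≠ v := by rintro rfl; exact huv.2 huv.1
  rcases lt_or_gt_of_ne hne with h | h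
  · exact ⟨⟨(u, v), h⟩, by simp [nodeCut, huv], by simp [huv]⟩
  · exact ⟨⟨(v, u), h⟩, by simp [nodeCut, huv], by simp [huv]⟩

theorem pairGraph_adj {n : ℕ} {S : Finset (NodePair n)} {u v : Fin n} :
    (pairGraph n S).Adj u v ↔ ∃ e ∈ S, e.1 = (u, v) ∨ e.1 = (v, u) := by
  rw [pairGraph, SimpleGraph.fromRel_adj]
  constructor
  · rintro ⟨-, ⟨e, he, rfl, rfl⟩ | ⟨e, he, rfl, rfl⟩⟩
    exacts [⟨e, he, .inl rfl⟩, ⟨e, he, .inr rfl⟩]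
  · rintro ⟨e, he, h | h⟩
    · have := e.2
      simp only [h] at this
      exact ⟨this.ne, .inl ⟨e, he, by simp [h]⟩⟩
    · have := e.2
      simp only [h] at this
      exact ⟨this.ne', .inr ⟨e, he, by simp [h]⟩⟩

/-- A disconnected graph misses all pairs of the cut of some set of at most half of the nodes. -/
theorem exists_nodeCut_of_not_connected {n : ℕ} (hn : 0 < n) (S : Finset (NodePair n))
    (h : ¬ (pairGraph n S).Connected) :
    ∃ I : Finset (Fin n), I.Nonempty ∧ 2 * I.card ≤ n ∧ Disjoint S (nodeCut I) := by
  classical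
  have hne : Nonempty (Fin n) := ⟨⟨0, hn⟩⟩
  have h' : ¬ (pairGraph n S).Preconnected := fun hc => h ⟨hc⟩
  unfold SimpleGraph.Preconnected at h'
  push Not at h'
  obtain ⟨u, v, huv⟩ := h'
  set I : Finset (Fin n) := Finset.univ.filter fun x => (pairGraph n S).Reachable u x with hI
  have hdisj : Disjoint S (nodeCut I) := by
    refine Finset.disjoint_left.2 fun e he hcut => ?_
    have hadj : (pairGraph n S).Adj e.1.1 e.1.2 := pairGraph_adj.2 ⟨e, he, .inl rfl⟩
    refine (Finset.mem_filter.1 hcut).2 ?_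
    simp only [hI, Finset.mem_filter, Finset.mem_univ, true_and]
    exact ⟨fun hr => hr.trans hadj.reachable, fun hr => hr.trans hadj.symm.reachable⟩
  have hcard := Finset.card_compl_add_card I
  rw [Fintype.card_fin] at hcard
  by_cases h2 : 2 * I.card ≤ n
  · exact ⟨I, ⟨u, by simp [hI]⟩, h2, hdisj⟩
  · refine ⟨Iᶜ, ⟨v, by simpa [hI] using huv⟩, by omega, ?_⟩
    have : nodeCut Iᶜ = nodeCut I := by
      ext e
      simp only [nodeCut, Finset.mem_filter, Finset.mem_compl]
      tauto
    rwa [this]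

/-- Sets of pairs of prescribed sizes that obstruct connectivity. -/
theorem exists_connectivity_obstructions (n h : ℕ) (hn : 0 < n) (hh : 2 * h + 1 ≤ n) :
    ∃ B : Finset (Fin n) → Finset (NodePair n),
      (∀ I ∈ Finset.univ.filter (fun I : Finset (Fin n) => I.Nonempty ∧ 2 * I.card ≤ n),
        2 * (B I).card ≤ Fintype.card (NodePair n) ∧ (B I).card = I.card * h) ∧
      ∀ S : Finset (NodePair n),
        (∀ I ∈ Finset.univ.filter (fun I : Finset (Fin n) => I.Nonempty ∧ 2 * I.card ≤ n),
          ¬ Disjoint S (B I)) → (pairGraph n S).Connected := by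
  obtain ⟨B, hB⟩ := exists_subset_choice (fun I : Finset (Fin n) => nodeCut I) fun I => I.card * h
  have hB' : ∀ I : Finset (Fin n), 2 * I.card ≤ n → B I ⊆ nodeCut I ∧ (B I).card = I.card * h := by
    intro I hI
    refine hB I (le_trans (Nat.mul_le_mul_left _ ?_) (card_mul_le_card_nodeCut I))
    have := Finset.card_compl_add_card I
    rw [Fintype.card_fin] at this
    omega
  refine ⟨B, fun I hI => ?_, fun S hS => ?_⟩
  · obtain ⟨-, h2⟩ := (Finset.mem_filter.1 hI).2
    refine ⟨?_, (hB' I h2).2⟩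
    have h3 := le_nodePair_card n
    have h4 : (2 * I.card) * (2 * h) ≤ n * (n - 1) := Nat.mul_le_mul h2 (by omega)
    rw [(hB' I h2).2]
    nlinarith
  · by_contra hcon
    obtain ⟨I, h1, h2, h3⟩ := exists_nodeCut_of_not_connected hn S hcon
    exact hS I (by simp [h1, h2]) (h3.mono_right (hB' I h2).1)

theorem sum_connectivity_obstructions_le {n h : ℕ} {z : ℝ} (hz0 : 0 ≤ z) (hn : n * z ^ h ≤ 1) :
    ∑ I ∈ Finset.univ.filter (fun I : Finset (Fin n) => I.Nonempty ∧ 2 * I.card ≤ n),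
      z ^ (I.card * h) ≤ 2 * (n * z ^ h) := by
  classical
  have hY0 : 0 ≤ z ^ h := by positivity
  have hpow := one_add_pow_le hY0 hn
  have hsum : ∑ I ∈ (Finset.univ : Finset (Finset (Fin n))).erase ∅, (z ^ h) ^ I.card =
      (1 + z ^ h) ^ n - 1 := by
    rw [← sum_pow_card_eq, ← Finset.add_sum_erase _ _ (Finset.mem_univ (∅ : Finset (Fin n)))]
    simp
  have : ∑ I ∈ Finset.univ.filter (fun I : Finset (Fin n) => I.Nonempty ∧ 2 * I.card ≤ n),
      z ^ (I.card * h) ≤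
        ∑ I ∈ (Finset.univ : Finset (Finset (Fin n))).erase ∅, (z ^ h) ^ I.card := by
    simp only [← pow_mul, Nat.mul_comm _ h]
    refine Finset.sum_le_sum_of_subset_of_nonneg (fun I hI => ?_) fun _ _ _ => by positivity
    exact Finset.mem_erase.2 ⟨(Finset.mem_filter.1 hI).2.1.ne_empty, Finset.mem_univ _⟩
  linarith

/-! ### Programs for the length of the phase -/

/-- Set the counter to `n ^ 2 * R`. -/
def matchingSetup : Cmd := block [mov 2 0, .op .mul 3 0 0, .op .mul 3 3 1]

theorem matchingSetup_runs {P : DynProblem} {w n R : ℕ} (G₀ : Finset (P.Pair n)) :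
    Runs w matchingSetup (startState P n R G₀) 4 fun σ => σ.reg 2 = n ∧ σ.reg 3 = n * n * R ∧
      ∀ a < n * n, σ.mem a = adjMatrix P n G₀ a :=
  mov (mul (mul (nil ⟨by simp [startState], by simp [startState], fun _ _ => rfl⟩)))

/-- Set the counter to `ℓ ^ 2 * n * R`, where `ℓ` is the binary logarithm of `n`, rounded up. -/
def connectivitySetup : Cmd :=
  block [mov 2 0, .const 4 1, .const 5 0, .const 6 1, .op .lt 7 4 2,
    .loop 7 (block [.op .add 4 4 4, .op .add 5 5 6, .op .lt 7 4 2]),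
    .op .mul 3 5 5, .op .mul 3 3 2, .op .mul 3 3 1]

theorem connectivitySetup_runs {P : DynProblem} {w n R : ℕ} (hn : 1 ≤ n) (hw : 2 * n < 2 ^ w)
    (G₀ : Finset (P.Pair n)) :
    Runs w connectivitySetup (startState P n R G₀) (Nat.clog 2 n * 5 + 1 + 4 + 5) fun σ =>
      σ.reg 2 = n ∧ σ.reg 3 = Nat.clog 2 n * Nat.clog 2 n * n * R ∧
      ∀ a < n * n, σ.mem a = adjMatrix P n G₀ a := by
  have hlt : ∀ j, 2 ^ j < n ↔ j < Nat.clog 2 n := fun j =>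
    (Nat.lt_clog_iff_pow_lt (by norm_num)).symm
  refine mov (const (const (const (lt ?_ (by simp [startState]; omega)
    (cons (t := Nat.clog 2 n * 5 + 1) (t' := 4) (loop (fun k σ => k ≤ Nat.clog 2 n ∧
      σ.reg 1 = R ∧ σ.reg 2 = n ∧ σ.reg 4 = 2 ^ (Nat.clog 2 n - k) ∧
      σ.reg 5 = Nat.clog 2 n - k ∧ σ.reg 6 = 1 ∧
      σ.reg 7 = (if 2 ^ (Nat.clog 2 n - k) < n then 1 else 0) ∧
      ∀ a < n * n, σ.mem a = adjMatrix P n G₀ a) ?_ ?_ _ _ ?_ ?_))))))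
  · simp only [NatState.set_reg, Nat.reduceEqDiff, if_false, if_true]
    omega
  · rintro k σ ⟨-, -, -, -, -, -, h, -⟩
    rw [h]
    split_ifs <;> omega
  · rintro k σ ⟨hk, h1, h2, h4, h5, h6, h7, hm⟩ hne
    have hj : 2 ^ (Nat.clog 2 n - k) < n := by
      by_contra hc
      rw [if_neg hc] at h7
      exact hne h7
    have hj' := (hlt _).1 hj
    have hk' : Nat.clog 2 n - (k - 1) = Nat.clog 2 n - k + 1 := by omega
    refine add_eq (2 ^ (Nat.clog 2 n - (k - 1))) (by rw [h4, hk', pow_succ]; ring) (add_eq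
      (Nat.clog 2 n - (k - 1)) (by simp [h5, h6, hk']) (lt ?_ (by simp [h2]; omega)
      (nil ⟨k - 1, by omega, by omega, ?_⟩)))
    · simp only [NatState.set_reg, Nat.reduceEqDiff, if_false, if_true, hk', pow_succ]
      omega
    · exact ⟨by simp [h1], by simp [h2], by simp, by simp, by simp [h6], by simp [h2], hm⟩
  · refine ⟨le_rfl, by simp [startState], by simp [startState], by simp, by simp, by simp, ?_,
      fun _ _ => rfl⟩
    simp [startState]
  · rintro k σ ⟨hk, h1, h2, h4, h5, h6, h7, hm⟩ h0
    have hj : ¬ 2 ^ (Nat.clog 2 n - k) < n := by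
      intro hc
      rw [if_pos hc] at h7
      omega
    rw [hlt] at hj
    have hk0 : Nat.clog 2 n - k = Nat.clog 2 n := by omega
    refine mul (mul (mul (nil ⟨?_, ?_, hm⟩)))
    · simpa using h2
    · simp [h1, h2, h5, hk0]

/-! ### Success of the algorithms -/

/-- `phaseAlg` succeeds if the exact computations of the phase take time `O(T)`, the fixed answer
`d` is right for all graphs that meet the sets `B j`, and the union bound over these sets is
small. -/
theorem phaseAlg_succeeds {P : DynProblem} {n w T C L ts tc d : ℕ} {p ε δ : ℝ}
    {setup chk dflt : Cmd} (hp0 : 0 ≤ p) (hp1 : p ≤ 1) (hspec : PhaseSpec P w n tc d chk dflt)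
    (hL : L < 2 ^ w)
    (hsetup : ∀ G₀ : Finset (P.Pair n), Runs w setup (startState P n ⌈1 / (1 - p)⌉₊ G₀) ts
      fun σ => σ.reg 2 = n ∧ σ.reg 3 = L ∧ ∀ a < n * n, σ.mem a = adjMatrix P n G₀ a)
    {ι : Type*} (J : Finset ι) (B : ι → Finset (P.Pair n))
    (hB : ∀ j ∈ J, 2 * (B j).card ≤ Fintype.card (P.Pair n))
    (hε : Real.exp (-2 * (1 - p) / Fintype.card (P.Pair n)) ^ L ≤ ε)
    (hmiss : ∀ S : Finset (P.Pair n), (∀ j ∈ J, ¬ Disjoint S (B j)) → P.answer n S = d)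
    (htime : (ts + tc + 1) + (L * (tc + 10) + 3 * T) ≤ C * T) (hC : 1 ≤ C)
    (hδ : T * ∑ j ∈ J, ((1 + ε) / 2) ^ (B j).card ≤ δ)
    (H₀ : Finset (P.Pair n)) (e : Fin T → P.Pair n) (q : ℕ → ℕ) :
    (phaseAlg setup chk dflt).Succeeds P n p w T C H₀ e q δ := by
  refine ⟨fun G₀ x => ?_, ?_⟩
  · obtain ⟨tp, tu, tq, out, h1, h2, h3, -⟩ := phaseAlg_run hspec hL G₀ (hsetup G₀) q x
    exact ⟨tp, tu, tq, out, h1, h2.trans htime, h3.trans (Nat.le_mul_of_pos_left _ hC)⟩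
  · refine le_trans (by linarith) (le_smoothedProb hp0 hp1 H₀ e J B hB hε ?_)
    intro G₀ x hgood
    obtain ⟨tp, tu, tq, out, h1, -, -, h4⟩ := phaseAlg_run hspec hL G₀ (hsetup G₀) q x
    rw [h4 fun r hr hr' => hmiss _ (hgood r hr hr')] at h1
    exact ⟨tp, tu, tq, h1⟩

/-- Words of `O(log n)` bits hold numbers polynomial in `n`. -/
theorem pow_le_two_pow {n w M : ℕ} (hn : 4 ≤ n) (h : 2 * M * Nat.log 2 n ≤ w) : n ^ M ≤ 2 ^ w := by
  have h1 : n < 2 ^ (Nat.log 2 n + 1) := Nat.lt_pow_succ_log_self (by norm_num) n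
  rw [pow_succ] at h1
  have h2 : n ≤ (2 ^ Nat.log 2 n) ^ 2 := by nlinarith
  calc n ^ M ≤ ((2 ^ Nat.log 2 n) ^ 2) ^ M := Nat.pow_le_pow_left h2 M
    _ = 2 ^ (2 * M * Nat.log 2 n) := by rw [← pow_mul, ← pow_mul]; congr 1; ring
    _ ≤ 2 ^ w := Nat.pow_le_pow_right (by norm_num) h

/-- What is known about the parameters `p` and `R = ⌈1 / (1 - p)⌉`. -/
theorem smoothing_param {n : ℕ} {p c : ℝ} (hn : 4 ≤ n) (hp0 : 0 ≤ p) (hp : p ≤ 1 - (n : ℝ) ^ (-c)) :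
    0 < 1 - p ∧ 1 ≤ ⌈1 / (1 - p)⌉₊ ∧ ⌈1 / (1 - p)⌉₊ ≤ n ^ ⌈c⌉₊ ∧
      (⌈1 / (1 - p)⌉₊ : ℝ) ≤ 2 / (1 - p) ∧ 1 ≤ (1 - p) * ⌈1 / (1 - p)⌉₊ := by
  have hn0 : (0 : ℝ) < n := by positivity
  have hn1 : (1 : ℝ) ≤ n := by exact_mod_cast (by omega : 1 ≤ n)
  have hpos : (0 : ℝ) < (n : ℝ) ^ (-c) := Real.rpow_pos_of_pos hn0 _
  have h1 : 0 < 1 - p := by linarith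
  have h2 : 1 ≤ 1 / (1 - p) := by rw [le_div_iff₀ h1]; linarith
  refine ⟨h1, Nat.one_le_ceil_iff.2 (by positivity), ?_, ?_, ?_⟩
  · rw [Nat.ceil_le]
    push_cast
    calc 1 / (1 - p) ≤ 1 / (n : ℝ) ^ (-c) := by gcongr; linarith
      _ = (n : ℝ) ^ c := by rw [Real.rpow_neg hn0.le, one_div, inv_inv]
      _ ≤ (n : ℝ) ^ (⌈c⌉₊ : ℝ) := Real.rpow_le_rpow_of_exponent_le hn1 (Nat.le_ceil c)
      _ = _ := Real.rpow_natCast _ _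
  · have h3 := (Nat.ceil_lt_add_one (by positivity : (0 : ℝ) ≤ 1 / (1 - p))).le
    refine h3.trans ?_
    rw [show 2 / (1 - p) = 1 / (1 - p) + 1 / (1 - p) by ring]
    linarith
  · calc (1 : ℝ) = (1 - p) * (1 / (1 - p)) := by field_simp
      _ ≤ _ := by gcongr; exact Nat.le_ceil _

theorem eventually_mul_three_quarters_pow_le (K : ℕ) :
    ∀ᶠ n : ℕ in Filter.atTop, 12 * (n : ℝ) ^ K * (3 / 4) ^ (n / 4) ≤ 1 := by
  -- `m ^ K * (3 / 4) ^ m` tends to zero; apply this to `m = n / 4`, which is at least `n / 8`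
  have h1 := (tendsto_pow_const_mul_const_pow_of_lt_one K (r := 3 / 4) (by norm_num)
    (by norm_num)).const_mul (12 * 8 ^ K : ℝ)
  rw [mul_zero] at h1
  have h2 := h1.comp (Nat.tendsto_div_const_atTop (n := 4) (by norm_num))
  filter_upwards [h2.eventually_le_const one_pos, Filter.eventually_ge_atTop 4] with n hn hn4
  refine le_trans ?_ hn
  have : (n : ℝ) ≤ 8 * (n / 4 : ℕ) := by exact_mod_cast (by omega : n ≤ 8 * (n / 4))
  simp only [Function.comp]
  calc 12 * (n : ℝ) ^ K * (3 / 4) ^ (n / 4) ≤ 12 * (8 * (n / 4 : ℕ)) ^ K * (3 / 4) ^ (n / 4) := by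
        gcongr
    _ = _ := by rw [mul_pow]; ring

theorem log_le_clog {n : ℕ} (hn : 1 ≤ n) : Real.log n ≤ Nat.clog 2 n := by
  have h : (n : ℝ) ≤ 2 ^ Nat.clog 2 n := by exact_mod_cast Nat.le_pow_clog (by norm_num) n
  have hn0 : (0 : ℝ) < n := by exact_mod_cast hn
  calc Real.log n ≤ Real.log (2 ^ Nat.clog 2 n) := Real.log_le_log hn0 h
    _ = Nat.clog 2 n * Real.log 2 := by rw [Real.log_pow]
    _ ≤ Nat.clog 2 n * 1 := by gcongr; linarith [Real.log_two_lt_d9]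
    _ = _ := mul_one _

theorem clog_le_log {n : ℕ} (hn : 3 ≤ n) : (Nat.clog 2 n : ℝ) ≤ 3 * Real.log n := by
  have hn0 : (0 : ℝ) < n := by positivity
  have h : (2 : ℝ) ^ (Nat.clog 2 n - 1) ≤ n := by
    exact_mod_cast (Nat.pow_pred_clog_lt_self (by norm_num) (by omega : 1 < n)).le
  have h1 : 1 ≤ Real.log n := by
    rw [Real.le_log_iff_exp_le hn0]
    have : (3 : ℝ) ≤ n := by exact_mod_cast hn
    linarith [Real.exp_one_lt_d9]
  have h2 := Real.log_le_log (by positivity) h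
  rw [Real.log_pow] at h2
  have h3 : 1 ≤ Nat.clog 2 n := Nat.clog_pos (by norm_num) (by omega)
  rw [Nat.cast_sub h3, Nat.cast_one] at h2
  nlinarith [Real.log_two_gt_d9]

theorem half_one_add_exp_neg_le {x : ℝ} (h0 : 0 ≤ x) (h1 : x ≤ 1) :
    (1 + Real.exp (-x)) / 2 ≤ Real.exp (-(x / 4)) := by
  have h2 : Real.exp (-x) ≤ 1 / (1 + x) := by
    rw [Real.exp_neg, ← one_div]
    exact one_div_le_one_div_of_le (by linarith) (by linarith [Real.add_one_le_exp x])
  have h3 : 1 / (1 + x) ≤ 1 - x / 2 := by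
    rw [div_le_iff₀ (by linarith)]
    nlinarith
  have h4 := Real.add_one_le_exp (-(x / 4))
  linarith

theorem eventually_clog_sq_le :
    ∀ᶠ n : ℕ in Filter.atTop, ((Nat.clog 2 n : ℝ)) ^ 2 ≤ n := by
  have h := (Real.isLittleO_pow_log_id_atTop (n := 2)).bound (c := 1 / 9) (by norm_num)
  have h' := tendsto_natCast_atTop_atTop.eventually h
  filter_upwards [h', Filter.eventually_ge_atTop 3] with n hn hn3
  have h1 := clog_le_log hn3
  rw [Real.norm_eq_abs, abs_of_nonneg (sq_nonneg _), id, Real.norm_eq_abs, Nat.abs_cast] at hn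
  have h2 : ((Nat.clog 2 n : ℝ)) ^ 2 ≤ (3 * Real.log n) ^ 2 := by gcongr
  nlinarith

/-- Although the base of the power tends to `1`, the power is at most `exp (-ℓ ^ 2 / 16)`, where
`ℓ ≥ log n`, and this is less than any power of `1 / n`. -/
theorem eventually_mul_half_one_add_exp_pow_le (K : ℕ) :
    ∀ᶠ n : ℕ in Filter.atTop, 2 * (n : ℝ) ^ K *
      ((1 + Real.exp (-((Nat.clog 2 n : ℝ) ^ 2 / n))) / 2) ^ ((n - 1) / 2) ≤ 1 := by
  have h1 := (Real.tendsto_log_atTop.comp tendsto_natCast_atTop_atTop).eventually_ge_atTop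
    (16 * (K + 1) : ℝ)
  filter_upwards [h1, eventually_clog_sq_le, Filter.eventually_ge_atTop 4] with n hlog hsq hn
  have hn0 : (0 : ℝ) < n := by positivity
  simp only [Function.comp] at hlog
  set ℓ : ℝ := (Nat.clog 2 n : ℝ)
  have hℓ : Real.log n ≤ ℓ := log_le_clog (by omega)
  have hx1 : ℓ ^ 2 / n ≤ 1 := by rw [div_le_one hn0]; exact hsq
  have hh : (n : ℝ) ≤ 4 * ((n - 1) / 2 : ℕ) := by
    exact_mod_cast (by omega : n ≤ 4 * ((n - 1) / 2))
  have hlog0 : 0 ≤ Real.log n := le_trans (by positivity) hlog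
  have h2 : ((1 + Real.exp (-(ℓ ^ 2 / n))) / 2) ^ ((n - 1) / 2) ≤
      Real.exp (-((K + 1) * Real.log n)) := by
    calc _ ≤ Real.exp (-(ℓ ^ 2 / n / 4)) ^ ((n - 1) / 2) := by
          gcongr
          exact half_one_add_exp_neg_le (by positivity) hx1
      _ = Real.exp (-(ℓ ^ 2 / n / 4 * ((n - 1) / 2 : ℕ))) := by
          rw [← Real.exp_nat_mul]; congr 1; ring
      _ ≤ _ := by
          rw [Real.exp_le_exp, neg_le_neg_iff]
          calc (K + 1) * Real.log n ≤ Real.log n / 16 * Real.log n := by gcongr; linarith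
            _ ≤ ℓ ^ 2 / 16 := by nlinarith
            _ = ℓ ^ 2 / n / 4 * (n / 4) := by field_simp; norm_num
            _ ≤ _ := by gcongr; linarith
  have h3 : Real.exp (-((K + 1) * Real.log n)) = ((n : ℝ) ^ (K + 1))⁻¹ := by
    rw [Real.exp_neg, ← Real.exp_log (by positivity : (0 : ℝ) < (n : ℝ) ^ (K + 1)), Real.log_pow]
    push_cast
    rfl
  calc _ ≤ 2 * (n : ℝ) ^ K * ((n : ℝ) ^ (K + 1))⁻¹ := by rw [← h3]; gcongr
    _ = 2 / n := by rw [pow_succ]; field_simp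
    _ ≤ 1 := by
        rw [div_le_one hn0]
        exact_mod_cast (by omega : 2 ≤ n)

/-! ### The bipartite problems -/

/-- The problem of answering queries about a bipartite graph with `n` nodes on each side. -/
abbrev bipartiteProblem (answer : ∀ n, Finset (Fin n × Fin n) → ℕ) : DynProblem where
  Pair n := Fin n × Fin n
  ends _ e := e
  answer := answer

/-- One side of the graph is a vertex cover. -/
theorem bipartite_answers_le {n : ℕ} (S : Finset (Fin n × Fin n)) :
    bipartiteMaximumMatching.answer n S ≤ n ∧ bipartiteMinimumVertexCover.answer n S ≤ n := by
  have hc : (bipGraph n S).IsVertexCover (Set.range Sum.inl) := by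
    intro a b hab
    rcases bipGraph_adj.1 hab with ⟨e, -, rfl, -⟩ | ⟨e, -, rfl, -⟩
    · exact .inl ⟨_, rfl⟩
    · exact .inr ⟨_, rfl⟩
  have hcard : (Set.range (Sum.inl : Fin n → Fin n ⊕ Fin n)).ncard = n := by
    rw [← Set.image_univ, Set.ncard_image_of_injective _ Sum.inl_injective]
    simp
  constructor
  · unfold bipartiteMaximumMatching
    refine csSup_le' ?_
    rintro k ⟨M, hM, rfl⟩
    exact (hM.ncard_edgeSet_le hc).trans_eq hcard
  · unfold bipartiteMinimumVertexCover
    refine ENat.toNat_le_of_le_natCast (hc.vertexCoverNum_le.trans_eq ?_)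
    rw [← (Set.toFinite _).cast_ncard_eq, hcard]

theorem bipartitePerfectMatching_answer_le {n : ℕ} (S : Finset (Fin n × Fin n)) :
    bipartitePerfectMatching.answer n S ≤ 1 := by
  simp only [bipartitePerfectMatching]
  split_ifs <;> simp

theorem sq_add_lt_cube {n : ℕ} (hn : 4 ≤ n) : n * n + 2 * n + 2 < n ^ 3 := by
  rw [pow_succ, sq]
  nlinarith

/-- The time of a phase of `n * n * R` rounds at `O(n ^ 4)` steps each. The phase and the
preprocessing take at most `426 * n ^ 6 * R` steps, and `R ≤ 2 / (1 - p)`; an update after the phase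
takes three steps. -/
theorem matching_time_le {n T R C : ℕ} {a p : ℝ} (hn : 4 ≤ n) (ha : 0 < a) (hp : 0 < 1 - p)
    (hR1 : 1 ≤ R) (hR : (R : ℝ) ≤ 2 / (1 - p)) (hT : a * ((n : ℝ) ^ 6 / (1 - p)) ≤ T)
    (hC : C = ⌈852 / a⌉₊ + 3) :
    (4 + 203 * n ^ 4 + 1) + (n * n * R * (203 * n ^ 4 + 10) + 3 * T) ≤ C * T := by
  have hn4 : 1 ≤ n ^ 4 := Nat.one_le_pow _ _ (by omega)
  have h1 : (4 + 203 * n ^ 4 + 1) + n * n * R * (203 * n ^ 4 + 10) ≤ 426 * (n ^ 6 * R) := by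
    have h2 : 1 ≤ n * n * R := Nat.mul_pos (Nat.mul_pos (by omega) (by omega)) hR1
    have h3 : n ^ 6 * R = n * n * R * n ^ 4 := by ring
    rw [h3]
    nlinarith
  have h4 : (426 * (n ^ 6 * R : ℕ) : ℝ) ≤ ⌈852 / a⌉₊ * T := by
    push_cast
    calc 426 * ((n : ℝ) ^ 6 * R) ≤ 426 * ((n : ℝ) ^ 6 * (2 / (1 - p))) := by gcongr
      _ = 852 / a * (a * ((n : ℝ) ^ 6 / (1 - p))) := by field_simp; norm_num
      _ ≤ ⌈852 / a⌉₊ * T := by gcongr; exact Nat.le_ceil _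
  have h5 : 426 * (n ^ 6 * R) ≤ ⌈852 / a⌉₊ * T := by exact_mod_cast h4
  rw [hC, Nat.add_mul]
  omega

/-- If the answer can be computed from the adjacency matrix in time `O(n ^ 4)` and is `D n`
whenever there is a perfect matching, then `phaseAlg` succeeds. -/
theorem exists_bipartite_alg {P : DynProblem} (answer : ∀ n, Finset (Fin n × Fin n) → ℕ) (D : ℕ → ℕ)
    (chk dflt : Cmd) (hP : P = bipartiteProblem answer)
    (hchk : ∀ (n w c : ℕ) (A : ℕ → ℕ) (S : Finset (Fin n × Fin n)) (σ : NatState), 1 ≤ n →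
      n * n + 2 * n + 2 < 2 ^ w → (∀ a < n * n, A a ≤ 1) →
      (∀ u < n, ∀ v < n, A (u * n + v) ≠ 0 ↔ InPairs S u v) → σ.reg 2 = n → σ.reg 3 = c →
      (∀ a < n * n, σ.mem a = A a) → Runs w chk σ (203 * n ^ 4) fun σ' => σ'.reg 2 = n ∧
        σ'.reg 3 = c ∧ (∀ a < n * n, σ'.mem a = A a) ∧ σ'.reg 4 = answer n S)
    (hdflt : ∀ (n w : ℕ) (σ : NatState), σ.reg 2 = n → Runs w dflt σ 2 fun σ' => σ'.reg 2 = n ∧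
      σ'.reg 3 = σ.reg 3 ∧ σ'.reg 4 = D n)
    (hanswer : ∀ n S, 1 ≤ n → answer n S ≤ n) (hD : ∀ n, 1 ≤ n → D n ≤ n)
    (hmatch : ∀ n S (f : Fin n → Fin n), Function.Injective f → (∀ i, (i, f i) ∈ S) →
      answer n S = D n) :
    ∃ A : DynAlg, ∀ a : ℝ, 0 < a → ∃ C : ℕ,
      ∀ c : ℝ, 0 < c → ∀ k : ℕ, ∃ κ : ℕ, ∀ d : ℕ, ∃ n₀ : ℕ, ∀ n : ℕ, n₀ ≤ n →
      ∀ p : ℝ, 0 ≤ p → p ≤ 1 - (n : ℝ) ^ (-c) →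
      ∀ T : ℕ, a * ((n : ℝ) ^ 6 / (1 - p)) ≤ (T : ℝ) → T ≤ n ^ k →
      ∀ w : ℕ, κ * Nat.log 2 n ≤ w →
      ∀ (H₀ : Finset (P.Pair n)) (e : Fin T → P.Pair n) (q : ℕ → ℕ),
        A.Succeeds P n p w T C H₀ e q (1 / (n : ℝ) ^ d) := by
  subst hP
  refine ⟨phaseAlg matchingSetup chk dflt, fun a ha => ⟨⌈852 / a⌉₊ + 3, fun c hc k =>
    ⟨2 * (⌈c⌉₊ + 3), fun d => ?_⟩⟩⟩
  obtain ⟨n₀, hn₀⟩ := Filter.eventually_atTop.1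
    ((eventually_mul_three_quarters_pow_le (k + 1 + d)).and (Filter.eventually_ge_atTop 4))
  refine ⟨n₀, fun n hn p hp0 hp T hT hTk w hw H₀ e q => ?_⟩
  obtain ⟨hsmall, hn4⟩ := hn₀ n hn
  obtain ⟨hp1, hR1, hRn, hR2, hpR⟩ := smoothing_param hn4 hp0 hp
  have hn0 : (0 : ℝ) < n := by positivity
  have hw' := pow_le_two_pow hn4 hw
  have hcube : n ^ 3 ≤ 2 ^ w := (Nat.pow_le_pow_right (by omega) (by omega)).trans hw'
  have hword := (sq_add_lt_cube hn4).trans_le hcube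
  have hL : n * n * ⌈1 / (1 - p)⌉₊ < 2 ^ w := by
    refine lt_of_lt_of_le ?_ hw'
    calc n * n * ⌈1 / (1 - p)⌉₊ ≤ n * n * n ^ ⌈c⌉₊ := Nat.mul_le_mul_left _ hRn
      _ = n ^ (⌈c⌉₊ + 2) := by ring
      _ < n ^ (⌈c⌉₊ + 3) := Nat.pow_lt_pow_right (by omega) (by omega)
  have hspec : PhaseSpec (bipartiteProblem answer) w n (203 * n ^ 4) (D n) chk dflt := {
    ends_inj := fun _ _ h => h
    word := by omega
    answer_lt := fun G => (hanswer n G (by omega)).trans_lt (by omega)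
    default_lt := (hD n (by omega)).trans_lt (by omega)
    check := fun G c σ h2 h3 hm => by
      refine hchk n w c _ G σ (by omega) hword (fun a _ => adjMatrix_le_one _ n G a) ?_ h2 h3 hm
      intro u hu v hv
      refine (adjMatrix_ne_zero (P := bipartiteProblem answer) (G := G) ⟨u, hu⟩ ⟨v, hv⟩).trans ?_
      simp only [InPairs, Prod.ext_iff, Fin.ext_iff]
    default := hdflt n w }
  obtain ⟨B, hB, hmiss⟩ := exists_bipartite_obstructions n (n / 4) (by omega)
  have hE : (Fintype.card ((bipartiteProblem answer).Pair n) : ℝ) = (n : ℝ) ^ 2 := by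
    have : Fintype.card ((bipartiteProblem answer).Pair n) = n ^ 2 := by
      change Fintype.card (Fin n × Fin n) = n ^ 2
      simp [sq]
    exact_mod_cast this
  refine phaseAlg_succeeds (ε := 1 / 2) hp0 (by linarith) hspec hL matchingSetup_runs _ B
    (fun j hj => (hB j hj).1) ?_ ?_ (matching_time_le hn4 ha hp1 hR1 hR2 hT rfl) (by omega) ?_
    H₀ e q
  -- a phase lasts long enough for every pair to be flipped at random once on average
  · rw [hE, ← Real.exp_nat_mul]
    have h1 : ((n * n * ⌈1 / (1 - p)⌉₊ : ℕ) : ℝ) * (-2 * (1 - p) / (n : ℝ) ^ 2) =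
        -(2 * ((1 - p) * ⌈1 / (1 - p)⌉₊)) := by
      push_cast
      field_simp
    rw [h1]
    calc _ ≤ Real.exp (-1) := Real.exp_le_exp.2 (by linarith)
      _ ≤ 1 / 2 := by linarith [Real.exp_neg_one_lt_d9]
  · intro S hS
    obtain ⟨f, hf, hfS⟩ := hmiss S hS
    exact hmatch n S f hf hfS
  · refine (mul_le_mul_of_nonneg_left (Finset.sum_le_sum fun j hj =>
      (congrArg ((((1 : ℝ) + 1 / 2) / 2) ^ ·) (hB j hj).2).le) T.cast_nonneg).trans ?_
    have hz : ((1 : ℝ) + 1 / 2) / 2 = 3 / 4 := by norm_num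
    rw [hz]
    have hpow : (0 : ℝ) ≤ (3 / 4) ^ (n / 4) := by positivity
    have hn1 : (1 : ℝ) ≤ n := by exact_mod_cast (by omega : 1 ≤ n)
    have hTk' : (T : ℝ) ≤ (n : ℝ) ^ k := by exact_mod_cast hTk
    have h1 : (n : ℝ) * (3 / 4) ^ (n / 4) ≤ 1 := by
      refine le_trans ?_ hsmall
      gcongr
      have : (n : ℝ) ≤ (n : ℝ) ^ (k + 1 + d) := le_self_pow₀ hn1 (by omega)
      linarith
    have h2 := sum_bipartite_obstructions_le (n := n) (h := n / 4) (z := 3 / 4) (by norm_num)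
      (by norm_num) h1
    calc _ ≤ (n : ℝ) ^ k * (12 * (n * (3 / 4) ^ (n / 4))) := by gcongr
      _ = 12 * (n : ℝ) ^ (k + 1 + d) * (3 / 4) ^ (n / 4) / (n : ℝ) ^ d := by
          rw [pow_add, pow_succ]; field_simp
      _ ≤ _ := by gcongr

/-! ### Connectivity -/

/-- The time of a phase of `ℓ * ℓ * n * R` rounds at `O(n ^ 2)` steps each. The constant is
`6480 = 360 * 9 * 2`, because `ℓ ≤ 3 * log n` and `R ≤ 2 / (1 - p)`. -/
theorem connectivity_time_le {n T R C ℓ : ℕ} {a p : ℝ} (hn : 4 ≤ n) (ha : 0 < a) (hp : 0 < 1 - p)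
    (hR1 : 1 ≤ R) (hR : (R : ℝ) ≤ 2 / (1 - p)) (hℓ1 : 1 ≤ ℓ) (hℓ : (ℓ : ℝ) ≤ 3 * Real.log n)
    (hT : a * ((n : ℝ) ^ 3 * Real.log n ^ 2 / (1 - p)) ≤ T) (hC : C = ⌈6480 / a⌉₊ + 3) :
    ((ℓ * 5 + 1 + 4 + 5) + 150 * n ^ 2 + 1) + (ℓ * ℓ * n * R * (150 * n ^ 2 + 10) + 3 * T) ≤
      C * T := by
  have hn2 : 16 ≤ n ^ 2 := by nlinarith
  have h1 : ((ℓ * 5 + 1 + 4 + 5) + 150 * n ^ 2 + 1) + ℓ * ℓ * n * R * (150 * n ^ 2 + 10) ≤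
      360 * (n ^ 3 * ℓ ^ 2 * R) := by
    have h2 : ℓ ≤ ℓ * ℓ * n * R := by
      calc ℓ = ℓ * 1 * 1 * 1 := by ring
        _ ≤ _ := by gcongr; omega
    have h3 : n ^ 3 * ℓ ^ 2 * R = ℓ * ℓ * n * R * n ^ 2 := by ring
    rw [h3]
    nlinarith
  have h4 : (360 * (n ^ 3 * ℓ ^ 2 * R : ℕ) : ℝ) ≤ ⌈6480 / a⌉₊ * T := by
    push_cast
    calc 360 * ((n : ℝ) ^ 3 * ℓ ^ 2 * R) ≤
        360 * ((n : ℝ) ^ 3 * (3 * Real.log n) ^ 2 * (2 / (1 - p))) := by gcongr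
      _ = 6480 / a * (a * ((n : ℝ) ^ 3 * Real.log n ^ 2 / (1 - p))) := by field_simp; ring
      _ ≤ ⌈6480 / a⌉₊ * T := by gcongr; exact Nat.le_ceil _
  have h5 : 360 * (n ^ 3 * ℓ ^ 2 * R) ≤ ⌈6480 / a⌉₊ * T := by exact_mod_cast h4
  rw [hC, Nat.add_mul]
  omega

/-- The specification of the algorithm for connectivity. -/
theorem connectivity_phaseSpec {n w : ℕ} (hn : 4 ≤ n) (hw : n * n + 2 * n + 2 < 2 ^ w) :
    PhaseSpec dynamicConnectivity w n (150 * n ^ 2) 1 connectivityCheck (block [.const 4 1]) where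
  ends_inj := Subtype.val_injective
  word := by omega
  answer_lt G := by
    have : dynamicConnectivity.answer n G ≤ 1 := by
      simp only [dynamicConnectivity]
      split_ifs <;> simp
    omega
  default_lt := by nlinarith
  check G c σ h2 h3 hm := by
    refine (connectivityCheck_runs (by omega) hw (fun a _ => adjMatrix_le_one _ n G a)
      (G := pairGraph n G) ?_ h2 h3 hm).mono le_rfl ?_
    · intro u v
      have key : ∀ u v : Fin n, adjMatrix dynamicConnectivity n G (u * n + v) ≠ 0 ↔
          ∃ e ∈ G, e.1 = (u, v) := adjMatrix_ne_zero
      refine (pairGraph_adj (S := G)).trans ?_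
      rw [searchAdj, ← Nat.pos_iff_ne_zero, Nat.add_pos_iff_pos_or_pos,
        Nat.pos_iff_ne_zero, Nat.pos_iff_ne_zero, key, key, ← exists_or]
      exact exists_congr fun e => and_or_left
    · rintro σ' ⟨g1, g2, g3, g4, g5⟩
      refine ⟨g1, g2, g3, ?_⟩
      by_cases h : (pairGraph n G).Connected
      · simp only [dynamicConnectivity, if_pos h, g4 h]
      · simp only [dynamicConnectivity, if_neg h, g5 h]
  default σ h := const (nil ⟨by simpa using h, by simp, by simp⟩)

/-- The algorithm for connectivity succeeds on all sizes `n` that are large enough for the union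
bound over the cuts. -/
theorem connectivity_succeeds {n k d w T : ℕ} {a c p : ℝ} (ha : 0 < a)
    (hsmall : 2 * (n : ℝ) ^ (k + 1 + d) *
      ((1 + Real.exp (-((Nat.clog 2 n : ℝ) ^ 2 / n))) / 2) ^ ((n - 1) / 2) ≤ 1)
    (hsq : (Nat.clog 2 n : ℝ) ^ 2 ≤ n) (hn4 : 4 ≤ n)
    (hp0 : 0 ≤ p) (hp : p ≤ 1 - (n : ℝ) ^ (-c))
    (hT : a * ((n : ℝ) ^ 3 * Real.log n ^ 2 / (1 - p)) ≤ T) (hTk : T ≤ n ^ k)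
    (hw : 2 * (⌈c⌉₊ + 3) * Nat.log 2 n ≤ w) (H₀ : Finset (dynamicConnectivity.Pair n))
    (e : Fin T → dynamicConnectivity.Pair n) (q : ℕ → ℕ) :
    (phaseAlg connectivitySetup connectivityCheck (block [.const 4 1])).Succeeds
      dynamicConnectivity n p w T (⌈6480 / a⌉₊ + 3) H₀ e q (1 / (n : ℝ) ^ d) := by
  obtain ⟨hp1, hR1, hRn, hR2, hpR⟩ := smoothing_param hn4 hp0 hp
  set R := ⌈1 / (1 - p)⌉₊ with hR
  set ℓ := Nat.clog 2 n with hℓ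
  have hn0 : (0 : ℝ) < n := by positivity
  have hw' := pow_le_two_pow hn4 hw
  have hcube : n ^ 3 ≤ 2 ^ w := (Nat.pow_le_pow_right (by omega) (by omega)).trans hw'
  have hword := (sq_add_lt_cube hn4).trans_le hcube
  have hsq' : ℓ * ℓ ≤ n := by rw [← sq]; exact_mod_cast hsq
  have hL : ℓ * ℓ * n * R < 2 ^ w := by
    refine lt_of_lt_of_le ?_ hw'
    calc ℓ * ℓ * n * R ≤ n * n * n ^ ⌈c⌉₊ := by gcongr
      _ = n ^ (⌈c⌉₊ + 2) := by ring
      _ < n ^ (⌈c⌉₊ + 3) := Nat.pow_lt_pow_right (by omega) (by omega)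
  obtain ⟨B, hB, hmiss⟩ := exists_connectivity_obstructions n ((n - 1) / 2) (by omega) (by omega)
  have hE : (Fintype.card (dynamicConnectivity.Pair n) : ℝ) ≤ (n : ℝ) ^ 2 := by
    have : Fintype.card (dynamicConnectivity.Pair n) ≤ n ^ 2 := nodePair_card_le n
    exact_mod_cast this
  have hE0 : 0 < (Fintype.card (dynamicConnectivity.Pair n) : ℝ) := by
    have h1 : n * (n - 1) ≤ 2 * Fintype.card (dynamicConnectivity.Pair n) := le_nodePair_card n
    have h2 : 0 < n * (n - 1) := Nat.mul_pos (by omega) (by omega)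
    exact_mod_cast (by omega : 0 < Fintype.card (dynamicConnectivity.Pair n))
  refine phaseAlg_succeeds (ε := Real.exp (-((ℓ : ℝ) ^ 2 / n))) hp0 (by linarith)
    (connectivity_phaseSpec hn4 hword) hL
    (fun G₀ => connectivitySetup_runs (by omega) (by omega) G₀) _ B
    (fun j hj => (hB j hj).1) ?_ ?_
    (connectivity_time_le hn4 ha hp1 hR1 hR2 (Nat.clog_pos (by norm_num) (by omega))
      (clog_le_log (by omega)) hT rfl) (by omega) ?_ H₀ e q
  · rw [← Real.exp_nat_mul, Real.exp_le_exp]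
    have h1 : ((ℓ * ℓ * n * R : ℕ) : ℝ) * (-2 * (1 - p) / Fintype.card (dynamicConnectivity.Pair n))
        = -((ℓ : ℝ) ^ 2 * n * (2 * ((1 - p) * R)) / Fintype.card (dynamicConnectivity.Pair n)) := by
      push_cast
      ring
    rw [h1, neg_le_neg_iff]
    calc (ℓ : ℝ) ^ 2 / n = (ℓ : ℝ) ^ 2 * n * 1 / (n : ℝ) ^ 2 := by field_simp
      _ ≤ _ := by gcongr; linarith
  · intro S hS
    simp only [dynamicConnectivity, if_pos (hmiss S hS)]
  · set z := (1 + Real.exp (-((ℓ : ℝ) ^ 2 / n))) / 2 with hz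
    refine (mul_le_mul_of_nonneg_left (Finset.sum_le_sum fun j hj =>
      (congrArg (z ^ ·) (hB j hj).2).le) T.cast_nonneg).trans ?_
    have hz0 : 0 ≤ z := by positivity
    have hn1 : (1 : ℝ) ≤ n := by exact_mod_cast (by omega : 1 ≤ n)
    have hTk' : (T : ℝ) ≤ (n : ℝ) ^ k := by exact_mod_cast hTk
    have h1 : (n : ℝ) * z ^ ((n - 1) / 2) ≤ 1 := by
      refine le_trans ?_ hsmall
      gcongr
      have : (n : ℝ) ≤ (n : ℝ) ^ (k + 1 + d) := le_self_pow₀ hn1 (by omega)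
      linarith
    have h2 := sum_connectivity_obstructions_le hz0 h1
    calc _ ≤ (n : ℝ) ^ k * (2 * (n * z ^ ((n - 1) / 2))) := by gcongr
      _ = 2 * (n : ℝ) ^ (k + 1 + d) * z ^ ((n - 1) / 2) / (n : ℝ) ^ d := by
          rw [pow_add, pow_succ]; field_simp
      _ ≤ _ := by gcongr

theorem mainTheorem7 :
    (∀ P : DynProblem,
      (P = bipartitePerfectMatching ∨ P = bipartiteMaximumMatching ∨
        P = bipartiteMinimumVertexCover) →
      ∃ A : DynAlg, ∀ a : ℝ, 0 < a → ∃ C : ℕ,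
        ∀ c : ℝ, 0 < c → ∀ k : ℕ, ∃ κ : ℕ, ∀ d : ℕ, ∃ n₀ : ℕ, ∀ n : ℕ, n₀ ≤ n →
        ∀ p : ℝ, 0 ≤ p → p ≤ 1 - (n : ℝ) ^ (-c) →
        ∀ T : ℕ, a * ((n : ℝ) ^ 6 / (1 - p)) ≤ (T : ℝ) → T ≤ n ^ k →
        ∀ w : ℕ, κ * Nat.log 2 n ≤ w →
        ∀ (H₀ : Finset (P.Pair n)) (e : Fin T → P.Pair n) (q : ℕ → ℕ),
          A.Succeeds P n p w T C H₀ e q (1 / (n : ℝ) ^ d)) ∧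
    (∃ (A : DynAlg) (b : ℕ), ∀ a : ℝ, 0 < a → ∃ C : ℕ,
        ∀ c : ℝ, 0 < c → ∀ k : ℕ, ∃ κ : ℕ, ∀ d : ℕ, ∃ n₀ : ℕ, ∀ n : ℕ, n₀ ≤ n →
        ∀ p : ℝ, 0 ≤ p → p ≤ 1 - (n : ℝ) ^ (-c) →
        ∀ T : ℕ, a * ((n : ℝ) ^ 3 * Real.log n ^ b / (1 - p)) ≤ (T : ℝ) → T ≤ n ^ k →
        ∀ w : ℕ, κ * Nat.log 2 n ≤ w →
        ∀ (H₀ : Finset (dynamicConnectivity.Pair n)) (e : Fin T → dynamicConnectivity.Pair n)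
          (q : ℕ → ℕ),
          A.Succeeds dynamicConnectivity n p w T C H₀ e q (1 / (n : ℝ) ^ d)) := by
  constructor
  · rintro P (hP | hP | hP)
    · refine exists_bipartite_alg bipartitePerfectMatching.answer (fun _ => 1)
        (block [matchingSize, .op .eq 4 4 2]) (block [.const 4 1]) (hP.trans rfl) ?_ ?_ ?_ ?_ ?_
      · intro n w c A S σ hn hw hA hAS h2 h3 hm
        have hn4 : 1 ≤ n ^ 4 := Nat.one_le_pow _ _ hn
        refine Runs.mono (t := 200 * n ^ 4 + 2) (cons
          ((matchingSize_runs hn hw hA hAS h2 h3 hm).mono le_rfl ?_)) (by omega) fun _ h => h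
        rintro σ' ⟨g1, g2, g3, g4, g5, -⟩
        -- `PhaseSpec.check` asks for the answer to the query, so the size is compared with `n`
        have h4 : σ'.reg 4 ≤ n := g5 ▸ (bipartite_answers_le S).1
        refine eq (by omega) (by omega) (nil (t := 0) ⟨by simpa using g1, by simpa using g2,
          by simpa using g3, ?_⟩)
        rw [g4, ← g1]
        rfl
      · intro n w σ h
        exact const (nil ⟨by simpa using h, by simp, by simp⟩)
      · intro n S hn
        exact (bipartitePerfectMatching_answer_le S).trans hn
      · intro n hn
        exact hn
      · intro n S f hf hfS
        exact (bipartite_answers_of_injective hf hfS).1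
    · refine exists_bipartite_alg bipartiteMaximumMatching.answer id matchingSize
        (block [mov 4 2]) (hP.trans rfl) ?_ ?_ ?_ ?_ ?_
      · intro n w c A S σ hn hw hA hAS h2 h3 hm
        refine (matchingSize_runs hn hw hA hAS h2 h3 hm).mono (by omega) ?_
        rintro σ' ⟨g1, g2, g3, -, g4, -⟩
        exact ⟨g1, g2, g3, g4.symm⟩
      · intro n w σ h
        exact mov (nil ⟨by simpa using h, by simp, by simpa using h⟩)
      · intro n S _
        exact (bipartite_answers_le S).1
      · intro n _
        exact le_rfl
      · intro n S f hf hfS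
        exact (bipartite_answers_of_injective hf hfS).2.1
    · refine exists_bipartite_alg bipartiteMinimumVertexCover.answer id matchingSize
        (block [mov 4 2]) (hP.trans rfl) ?_ ?_ ?_ ?_ ?_
      · intro n w c A S σ hn hw hA hAS h2 h3 hm
        refine (matchingSize_runs hn hw hA hAS h2 h3 hm).mono (by omega) ?_
        rintro σ' ⟨g1, g2, g3, -, -, g4⟩
        exact ⟨g1, g2, g3, g4.symm⟩
      · intro n w σ h
        exact mov (nil ⟨by simpa using h, by simp, by simpa using h⟩)
      · intro n S _
        exact (bipartite_answers_le S).2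
      · intro n _
        exact le_rfl
      · intro n S f hf hfS
        exact (bipartite_answers_of_injective hf hfS).2.2
  · refine ⟨phaseAlg connectivitySetup connectivityCheck (block [.const 4 1]), 2, fun a ha =>
      ⟨⌈6480 / a⌉₊ + 3, fun c _ k => ⟨2 * (⌈c⌉₊ + 3), fun d => ?_⟩⟩⟩
    obtain ⟨n₀, hn₀⟩ := Filter.eventually_atTop.1
      ((eventually_mul_half_one_add_exp_pow_le (k + 1 + d)).and
        (eventually_clog_sq_le.and (Filter.eventually_ge_atTop 4)))
    refine ⟨n₀, fun n hn p hp0 hp T hT hTk w hw H₀ e q => ?_⟩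
    obtain ⟨h1, h2, h3⟩ := hn₀ n hn
    exact connectivity_succeeds ha h1 h2 h3 hp0 hp hT hTk hw H₀ e q
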